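/- **Setting.** On Minkowski space $\mathbb R^4$ (signature $(+,-,-,-)$, $xy=x_0y_0-\boldsymbol x\boldsymbol y$, $\square=\partial_0^2-\triangle$) let $\mathcal A$ be the polynomial $*$-algebra of the free massless scalar field $\phi_0$, i.e. the unital algebra generated by the smeared real field $\phi_0(f)$, linear in the complex test function $f\in C_c^\infty(\mathbb R^4)$, with $\phi_0(f)^*=\phi_0(\bar f)$, $\phi_0(\square f)=0$ and $[\phi_0(x_1),\phi_0(x_2)]=(2\pi)^{-3}\int dp\, e^{-i(x_1-x_2)p}\varepsilon(p_0)\delta(p^2)\cdot 1$. Let $\alpha_y(\phi_0(x))=\phi_0(x+y)$ be the translations. States are positive normalized linear functionals on $\mathcal A$ that are invariant under $\phi_0\mapsto-\phi_0$. For $\beta$ in the open forward light cone $V_+$, $\omega_\beta$ denotes the quasifree equilibrium (KMS) state with two-point function $\omega_\beta(\phi_0(x_1)\phi_0(x_2))=(2\pi)^{-3}\int dp\, e^{-i(x_1-x_2)p}\varepsilon(p_0)\delta(p^2)(1-e^{-\beta p})^{-1}$, and $\omega_\infty$ is the vacuum state, in whose two-point function the last factor is replaced by the characteristic function of $p_0>0$.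 Reference states are the mixtures $\int d\rho(\beta)\,\omega_\beta$, where $\rho$ is a probability measure with compact support in $V_+$. Let $\mathcal S_x$ be the span of $1$, $\phi_0(x)$ and all $\theta^{\boldsymbol\mu}(x)=\lim_{\zeta\to0}\partial_\zeta^{\boldsymbol\mu}\big(\phi_0(x+\zeta)\phi_0(x-\zeta)-\omega_\infty(\phi_0(x+\zeta)\phi_0(x-\zeta))1\big)$, the limit being taken through spacelike $\zeta$. A state $\omega$ is considered at $x$ only if its expectation values of the $\theta^{\boldsymbol\mu}(x)$ exist: $\omega(\phi_0(x'+\zeta)\phi_0(x'-\zeta))-\omega_\infty(\phi_0(x'+\zeta)\phi_0(x'-\zeta))$ is given, for $(x',\zeta)$ near $(x,0)$ with $\zeta$ spacelike, by a function that is smooth in $\zeta$ with $\zeta$-derivatives that are jointly continuous and, order by order, bounded near $(x,0)$, and the limits at $x$ exist. A state $\omega$ is called $\mathcal S_{\mathcal O}$-thermal if for each $x\in\mathcal O$ it agrees on $\mathcal S_x$ with some reference state $\int d\rho_x(\beta)\,\omega_\beta$, where $x\mapsto\int d\rho_x(\beta)\,\omega_\beta(A)$ is locally integrable on $\mathcal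 O$ for all $A\in\mathcal A$, and the supports of the $\rho_x$ lie in a common compact subset of $V_+$ for $x$ in any given compact subset of $\mathcal O$. Its lift to a smooth solution $\Xi$ of the wave equation on $V_+$ is $\omega(\Xi)(x)=\int d\rho_x(\beta)\,\Xi(\beta)$; this does not depend on the choice of the reference state that agrees with $\omega$ on $\mathcal S_x$. **Statement.** Let $\omega$ be an $\mathcal S_{\mathcal O_\omega}$-thermal state on an open set $\mathcal O_\omega\subset\mathbb R^4$, let $f\ge0$ be a real test function with $\int f=1$, and let $\omega_f=\int dy\,f(y)\,\omega\circ\alpha_y$ be the regularized state (this weak integral is assumed to exist). Let $\mathcal O$ be open with $\mathcal O+\operatorname{supp}f\subset\mathcal O_\omega$. Then $\omega_f$ is $\mathcal S_{\mathcal O}$-thermal, and for its lifts to $E_p(\beta)=e^{i\beta p}$ and $M_p^n(\beta)=(\beta p)^n$, for every positive lightlike $p$ (i.e. $p_0>0$, $p^2=0$) and every $x\in\mathcal O$: (a) $x\mapsto\omega_f(E_p)(x)$ is smooth on $\mathcal O$, $(p\,\partial)\,\omega_f(E_p)(x)=0$ and $\square\,\omega_f(E_p)(x)=0$. (b) $|\omega_f(E_p)(x)|\le1$.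 (c) $p\mapsto\omega_f(E_p)(x)$ extends to an entire analytic function on $\mathbb C^4$ which is smooth in $x$: there is $F:\mathbb C^4\times\mathcal O\to\mathbb C$, jointly smooth and entire in the first variable, with $F(p,x)=\omega_f(E_p)(x)$ for all positive lightlike $p$ and all $x\in\mathcal O$. (d) $0\le\omega_f(M_p^{n+1})(x)\le\big(\omega_f(M_p^{n})(x)\big)^{n/(n+1)}\big(\omega_f(M_p^{2n+1})(x)\big)^{1/(n+1)}$ for all $n\in\mathbb N_0$. -/

import Mathlib

open MeasureTheory Filter Topology Set Complex
open scoped ComplexOrder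

noncomputable section

namespace LocalEq

/-! ### Minkowski space -/

/-- Space-time `ℝ⁴`; the index `0` is time. (The Euclidean structure is only used for the topology,
the differentiable structure and Lebesgue measure.) -/
abbrev Spacetime : Type := EuclideanSpace ℝ (Fin 4)

/-- The diagonal entries of the metric, signature `(+,-,-,-)`. -/
def eta (μ : Fin 4) : ℝ := if μ = 0 then 1 else -1

/-- The Lorentz product `x y = x₀ y₀ - 𝐱 · 𝐲`. -/
def mink (x y : Spacetime) : ℝ := ∑ μ, eta μ * (x μ * y μ)

/-- The open forward light cone `V₊`. -/
def forwardCone : Set Spacetime := {β | 0 < β 0 ∧ 0 < mink β β}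

/-- The space-like vectors. -/
def spacelike : Set Spacetime := {ζ | mink ζ ζ < 0}

/-- Positive light-like vectors `p = (|𝐩|, 𝐩)`, `𝐩 ≠ 0`. -/
def IsPositiveLightlike (p : Spacetime) : Prop := 0 < p 0 ∧ mink p p = 0

/-- The coordinate vector `e_μ`. -/
def basisVec (μ : Fin 4) : Spacetime := EuclideanSpace.single μ 1

/-- The coordinate derivative `∂_μ u`. -/
def pd (μ : Fin 4) (u : Spacetime → ℂ) (x : Spacetime) : ℂ := fderiv ℝ u x (basisVec μ)

/-- The wave operator `□ = ∂_0² - ∂_1² - ∂_2² - ∂_3²`. -/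
def box (u : Spacetime → ℂ) (x : Spacetime) : ℂ := ∑ μ, (eta μ : ℂ) * pd μ (pd μ u) x

/-! ### Test functions -/

/-- Complex test functions: smooth with compact support. -/
def TestFn : Submodule ℂ (Spacetime → ℂ) where
  carrier := {f | ContDiff ℝ (⊤ : ℕ∞) f ∧ HasCompactSupport f}
  add_mem' hf hg := ⟨hf.1.add hg.1, hf.2.add hg.2⟩
  zero_mem' := ⟨contDiff_const, HasCompactSupport.zero⟩
  smul_mem' c _ hf := ⟨contDiff_const.smul hf.1, hf.2.smul_left (f := fun _ => c)⟩

/-- Complex conjugation of test functions. -/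
def conjT (f : TestFn) : TestFn :=
  ⟨fun x => (starRingEnd ℂ) (f.1 x),
    Complex.conjCLE.contDiff.comp f.2.1, f.2.2.comp_left (map_zero _)⟩

/-- The translate `x ↦ f (x - y)`. -/
def translT (y : Spacetime) : TestFn →ₗ[ℂ] TestFn where
  toFun f := ⟨fun x => f.1 (x - y), f.2.1.comp (contDiff_id.sub contDiff_const), by
    have h := f.2.2.comp_homeomorph (Homeomorph.subRight y)
    exact h⟩
  map_add' _ _ := rfl
  map_smul' _ _ := rfl

/-! ### The distributions of the free massless field -/

/-- Fourier transform `∫ dx f(x) e^{-ixp}`, with the Lorentz product in the exponent. -/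
def minkFT (f : TestFn) (p : Spacetime) : ℂ := ∫ x, f.1 x * exp (-I * (mink x p : ℂ))

/-- The momentum `(|𝐩|, 𝐩)` on the mass shell. -/
def shell (q : EuclideanSpace ℝ (Fin 3)) : Spacetime :=
  WithLp.toLp 2 (Fin.cons ‖q‖ (fun i => q i))

/-- The smeared distribution
`(2π)⁻³ ∫ dp e^{-i(x₁-x₂)p} ε(p₀) δ(p²) h(p)`, in which the measure `ε(p₀) δ(p²) dp` is written out
as `d³𝐩 / 2|𝐩|` on the forward shell minus its image under `p ↦ -p` on the backward shell. -/
def shellForm (h : Spacetime → ℂ) (f g : TestFn) : ℂ :=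
  ((2 * Real.pi : ℝ) : ℂ)⁻¹ ^ 3 * ∫ q : EuclideanSpace ℝ (Fin 3), ((2 * ‖q‖ : ℝ) : ℂ)⁻¹ *
    (minkFT f (shell q) * minkFT g (-shell q) * h (shell q) -
      minkFT f (-shell q) * minkFT g (shell q) * h (-shell q))

/-- The commutator distribution. -/
def commForm (f g : TestFn) : ℂ := shellForm (fun _ => 1) f g

/-- The two-point function of the vacuum (only positive energies contribute). -/
def vacForm (f g : TestFn) : ℂ := shellForm (fun p => if 0 < p 0 then 1 else 0) f g

/-- The two-point function of the equilibrium (KMS) state `ω_β`. -/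
def kmsForm (β : Spacetime) (f g : TestFn) : ℂ :=
  shellForm (fun p => (1 - exp (-(mink β p : ℂ)))⁻¹) f g

/-- Wick's rule: the sum over all pairings of the product of two-point functions, where in each
pair the original order is kept. It is `0` for lists of odd length. -/
def wick (W : TestFn → TestFn → ℂ) : List TestFn → ℂ
  | [] => 1
  | f :: l => ∑ i : Fin l.length, W f (l.get i) * wick W (l.eraseIdx i)
termination_by l => l.length
decreasing_by
  have := i.isLt
  simp [List.length_eraseIdx]

/-! ### The field algebra -/

/-- Field equation and canonical commutation relations. -/
inductive Rel : TensorAlgebra ℂ TestFn → TensorAlgebra ℂ TestFn → Prop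
  | fieldEq (f g : TestFn) (h : g.1 = box f.1) : Rel (TensorAlgebra.ι ℂ g) 0
  | ccr (f g : TestFn) :
      Rel (TensorAlgebra.ι ℂ f * TensorAlgebra.ι ℂ g)
        (TensorAlgebra.ι ℂ g * TensorAlgebra.ι ℂ f + algebraMap ℂ _ (commForm f g))

/-- The polynomial algebra of the free massless scalar field. -/
def FieldAlgebra : Type := RingQuot Rel

instance : Ring FieldAlgebra := inferInstanceAs (Ring (RingQuot Rel))
instance : Algebra ℂ FieldAlgebra := inferInstanceAs (Algebra ℂ (RingQuot Rel))

/-- The quotient map. -/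
def quotMap : TensorAlgebra ℂ TestFn →ₐ[ℂ] FieldAlgebra := RingQuot.mkAlgHom ℂ Rel

/-- The smeared field `φ₀(f) = ∫ dx f(x) φ₀(x)`. -/
def field : TestFn →ₗ[ℂ] FieldAlgebra := quotMap.toLinearMap ∘ₗ TensorAlgebra.ι ℂ

theorem field_eq_zero (f g : TestFn) (h : g.1 = box f.1) : field g = 0 := by
  have := RingQuot.mkAlgHom_rel ℂ (Rel.fieldEq f g h)
  exact this.trans (map_zero _)

theorem field_mul (f g : TestFn) :
    field f * field g = field g * field f + algebraMap ℂ _ (commForm f g) := by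
  have := RingQuot.mkAlgHom_rel ℂ (Rel.ccr f g)
  rw [map_mul, map_add, map_mul, AlgHom.commutes] at this
  exact this

/-- The universal property of the field algebra. -/
def liftField {A : Type} [Ring A] [Algebra ℂ A] (L : TestFn →ₗ[ℂ] A)
    (h0 : ∀ f g : TestFn, g.1 = box f.1 → L g = 0)
    (h1 : ∀ f g, L f * L g = L g * L f + algebraMap ℂ A (commForm f g)) :
    FieldAlgebra →ₐ[ℂ] A :=
  RingQuot.liftAlgHom ℂ ⟨TensorAlgebra.lift ℂ L, by
    rintro _ _ (⟨f, g, h⟩ | ⟨f, g⟩)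
    · simpa using h0 f g h
    · simpa using h1 f g⟩

theorem liftField_field {A : Type} [Ring A] [Algebra ℂ A] (L : TestFn →ₗ[ℂ] A) (h0 h1)
    (f : TestFn) : liftField L h0 h1 (field f) = L f := by
  have : liftField L h0 h1 (field f) = TensorAlgebra.lift ℂ L (TensorAlgebra.ι ℂ f) :=
    RingQuot.liftAlgHom_mkAlgHom_apply ℂ (TensorAlgebra.lift ℂ L) _ (TensorAlgebra.ι ℂ f)
  simpa using this

theorem FieldAlgebra.induction {P : FieldAlgebra → Prop}
    (hc : ∀ c : ℂ, P (algebraMap ℂ _ c)) (hf : ∀ f, P (field f))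
    (hm : ∀ a b, P a → P b → P (a * b)) (ha : ∀ a b, P a → P b → P (a + b)) (a : FieldAlgebra) :
    P a := by
  obtain ⟨t, rfl⟩ : ∃ t, quotMap t = a := RingQuot.mkAlgHom_surjective ℂ Rel a
  induction t using TensorAlgebra.induction with
  | algebraMap r => simpa using hc r
  | ι x => exact hf x
  | mul a b h1 h2 => rw [map_mul]; exact hm _ _ h1 h2
  | add a b h1 h2 => rw [map_add]; exact ha _ _ h1 h2

/-! #### Symmetry of the relations -/

theorem box_conj (u : Spacetime → ℂ) :
    box (fun x => (starRingEnd ℂ) (u x)) = fun x => (starRingEnd ℂ) (box u x) := by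
  have h : ∀ (v : Spacetime → ℂ) (μ : Fin 4),
      pd μ (fun x => (starRingEnd ℂ) (v x)) = fun x => (starRingEnd ℂ) (pd μ v x) := by
    intro v μ
    funext x
    have := Complex.conjCLE.comp_fderiv (f := v) (x := x)
    have h2 := congrArg (fun T => T (basisVec μ)) this
    exact h2
  funext x
  simp only [box, h, map_sum, map_mul, Complex.conj_ofReal]

theorem box_transl (u : Spacetime → ℂ) (y : Spacetime) :
    box (fun x => u (x - y)) = fun x => box u (x - y) := by
  have h : ∀ (v : Spacetime → ℂ) (μ : Fin 4),
      pd μ (fun x => v (x - y)) = fun x => pd μ v (x - y) := by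
    intro v μ
    funext x
    simp only [pd, fderiv_comp_sub]
  funext x
  simp only [box, h]

theorem mink_neg_right (x p : Spacetime) : mink x (-p) = -mink x p := by
  simp [mink]

theorem mink_add_left (x y p : Spacetime) : mink (x + y) p = mink x p + mink y p := by
  simp [mink, ← Finset.sum_add_distrib]
  exact Finset.sum_congr rfl fun i _ => by ring

theorem minkFT_conj (f : TestFn) (p : Spacetime) :
    minkFT (conjT f) p = (starRingEnd ℂ) (minkFT f (-p)) := by
  rw [minkFT, minkFT, ← integral_conj]
  congr 1
  funext x
  simp [conjT, mink_neg_right, ← Complex.exp_conj]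

theorem minkFT_transl (y : Spacetime) (f : TestFn) (p : Spacetime) :
    minkFT (translT y f) p = exp (-I * (mink y p : ℂ)) * minkFT f p := by
  rw [minkFT, minkFT, ← integral_const_mul, ← integral_add_right_eq_self _ y]
  congr 1
  funext x
  simp only [translT, LinearMap.coe_mk, AddHom.coe_mk, add_sub_cancel_right, mink_add_left,
    Complex.ofReal_add, mul_add, Complex.exp_add]
  ring

theorem minkFT_neg (f : TestFn) (p : Spacetime) : minkFT (-f) p = -minkFT f p := by
  simp [minkFT, integral_neg]

theorem commForm_conj (f g : TestFn) :
    commForm (conjT g) (conjT f) = (starRingEnd ℂ) (commForm f g) := by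
  simp only [commForm, shellForm, map_mul, map_pow, map_inv₀, Complex.conj_ofReal, ← integral_conj,
    map_sub, minkFT_conj, neg_neg, map_one]
  congr 2
  funext q
  ring

theorem commForm_transl (y : Spacetime) (f g : TestFn) :
    commForm (translT y f) (translT y g) = commForm f g := by
  simp only [commForm, shellForm, minkFT_transl, mink_neg_right]
  congr 2
  funext q
  have h : exp (-I * (mink y (shell q) : ℂ)) * exp (-I * ((-mink y (shell q) : ℝ) : ℂ)) = 1 := by
    rw [← Complex.exp_add]; simp
  congr 1
  linear_combination (minkFT f (shell q) * minkFT g (-shell q) -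
    minkFT f (-shell q) * minkFT g (shell q)) * h

theorem commForm_neg (f g : TestFn) : commForm (-f) (-g) = commForm f g := by
  simp [commForm, shellForm, minkFT_neg]

/-! #### Translations, gauge transformation and adjoint -/

/-- The translations `α_y`, `α_y (φ₀(x)) = φ₀(x + y)`. -/
def translation (y : Spacetime) : FieldAlgebra →ₐ[ℂ] FieldAlgebra :=
  liftField (field ∘ₗ translT y)
    (fun f g h => field_eq_zero (translT y f) _ (by
      rw [show (translT y f).1 = fun x => f.1 (x - y) from rfl, box_transl, ← h]; rfl))
    (fun f g => by simpa [commForm_transl] using field_mul (translT y f) (translT y g))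

/-- The gauge transformation `γ (φ₀(x)) = -φ₀(x)`. -/
def gauge : FieldAlgebra →ₐ[ℂ] FieldAlgebra :=
  liftField (-field)
    (fun f g h => by simp [field_eq_zero f g h])
    (fun f g => by simpa using field_mul f g)

/-- The opposite algebra with complex conjugate scalars, an auxiliary target for the adjoint. -/
def ConjOp : Type := FieldAlgebraᵐᵒᵖ

instance : Ring ConjOp := inferInstanceAs (Ring FieldAlgebraᵐᵒᵖ)

instance : Algebra ℂ ConjOp :=
  RingHom.toAlgebra' ((algebraMap ℂ FieldAlgebraᵐᵒᵖ).comp (starRingEnd ℂ))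
    fun c x => Algebra.commutes (A := FieldAlgebraᵐᵒᵖ) ((starRingEnd ℂ) c) x

/-- The identity map. -/
def toConjOp (a : FieldAlgebra) : ConjOp := MulOpposite.op a

/-- The identity map. -/
def ofConjOp (a : ConjOp) : FieldAlgebra := MulOpposite.unop a

/-- The antilinear antimultiplicative map with `φ₀(f) ↦ φ₀(conj f)`. -/
def adjHom : FieldAlgebra →ₐ[ℂ] ConjOp :=
  liftField (A := ConjOp)
    { toFun := fun f => toConjOp (field (conjT f))
      map_add' := fun f g => by
        have : conjT (f + g) = conjT f + conjT g := by
          apply Subtype.ext; funext x; exact map_add (starRingEnd ℂ) (f.1 x) (g.1 x)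
        rw [this, map_add]; rfl
      map_smul' := fun c f => by
        have : conjT (c • f) = (starRingEnd ℂ) c • conjT f := by
          apply Subtype.ext; funext x; exact map_mul (starRingEnd ℂ) c (f.1 x)
        have h : c • toConjOp (field (conjT f)) =
            toConjOp (field (conjT f) * algebraMap ℂ _ ((starRingEnd ℂ) c)) :=
          Algebra.smul_def c (toConjOp (field (conjT f)))
        rw [this, map_smul, RingHom.id_apply, h, Algebra.smul_def, Algebra.commutes] }
    (fun f g h => congrArg toConjOp (field_eq_zero (conjT f) (conjT g) (by
      rw [show (conjT f).1 = fun x => (starRingEnd ℂ) (f.1 x) from rfl, box_conj, ← h]; rfl)))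
    (fun f g => congrArg toConjOp (by
      have := field_mul (conjT g) (conjT f)
      rw [commForm_conj] at this
      exact this))

/-- The `*`-operation, `(c φ₀(f₁) ⋯ φ₀(fₙ))* = c̄ φ₀(f̄ₙ) ⋯ φ₀(f̄₁)`. -/
instance : Star FieldAlgebra := ⟨fun a => ofConjOp (adjHom a)⟩

theorem star_field (f : TestFn) : star (field f) = field (conjT f) :=
  congrArg ofConjOp (liftField_field _ _ _ f)

theorem star_scalar (c : ℂ) :
    star (algebraMap ℂ FieldAlgebra c) = algebraMap ℂ FieldAlgebra ((starRingEnd ℂ) c) :=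
  congrArg ofConjOp (adjHom.commutes c)

theorem star_mul_aux (a b : FieldAlgebra) : star (a * b) = star b * star a :=
  congrArg ofConjOp (map_mul adjHom a b)

theorem star_add_aux (a b : FieldAlgebra) : star (a + b) = star a + star b :=
  congrArg ofConjOp (map_add adjHom a b)

instance : StarRing FieldAlgebra where
  star_involutive a := by
    induction a using FieldAlgebra.induction with
    | hc c => simp [star_scalar]
    | hf f =>
      rw [star_field, star_field]
      congr 1
      apply Subtype.ext; funext x; exact Complex.conj_conj (f.1 x)
    | hm a b h1 h2 => rw [star_mul_aux, star_mul_aux, h1, h2]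
    | ha a b h1 h2 => rw [star_add_aux, star_add_aux, h1, h2]
  star_mul := star_mul_aux
  star_add := star_add_aux

/-! ### States -/

/-- Gauge invariant states: positive normalized linear functionals on the field algebra. -/
structure State where
  toLin : FieldAlgebra →ₗ[ℂ] ℂ
  nonneg : ∀ a, 0 ≤ toLin (star a * a)
  map_one : toLin 1 = 1
  gauge_inv : ∀ a, toLin (gauge a) = toLin a

/-- The two-point function of a state. -/
def State.twoPoint (ω : State) (f g : TestFn) : ℂ := ω.toLin (field f * field g)

/-- The one-point function of a gauge invariant state vanishes. -/
theorem State.onePoint (ω : State) (f : TestFn) : ω.toLin (field f) = 0 := by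
  have h := ω.gauge_inv (field f)
  rw [gauge, liftField_field] at h
  simp only [LinearMap.neg_apply, map_neg] at h
  linear_combination (-1 / 2 : ℂ) * h

/-- The n-point functions of the reference state `ω_B = ∫ dρ(β) ω_β`, where `ω_β` is the quasifree
equilibrium state with inverse temperature vector `β`. As the monomials in the field span the field
algebra, they determine `ω_B`. -/
def refNPoint (ρ : Measure Spacetime) (l : List TestFn) : ℂ := ∫ β, wick (kmsForm β) l ∂ρ

/-! ### Balanced derivatives of the normal ordered square -/

/-- The function `w (x, ζ)` is the kernel of the vacuum subtracted two-point function `G - ω_∞` at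
the points `x + ζ`, `x - ζ`, for `(x, ζ) ∈ U` with space-like `ζ`; it is smooth in `ζ`, with
derivatives that are continuous in `(x, ζ)`. -/
structure IsKernelOn (G : TestFn → TestFn → ℂ) (U : Set (Spacetime × Spacetime))
    (w : Spacetime → Spacetime → ℂ) : Prop where
  smooth : ∀ x ζ, (x, ζ) ∈ U → ζ ∈ spacelike → ContDiffAt ℝ (⊤ : ℕ∞) (w x) ζ
  cont : ∀ m : ℕ, ContinuousOn (fun q : Spacetime × Spacetime => iteratedFDeriv ℝ m (w q.1) q.2)
    {q | q ∈ U ∧ q.2 ∈ spacelike}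
  kernel : ∀ f g : TestFn,
    (∀ x₁ ∈ tsupport f.1, ∀ x₂ ∈ tsupport g.1,
      ((1 / 2 : ℝ) • (x₁ + x₂), (1 / 2 : ℝ) • (x₁ - x₂)) ∈ U ∧
        (1 / 2 : ℝ) • (x₁ - x₂) ∈ spacelike) →
    G f g - vacForm f g = ∫ x₁, ∫ x₂, f.1 x₁ * g.1 x₂ *
      w ((1 / 2 : ℝ) • (x₁ + x₂)) ((1 / 2 : ℝ) • (x₁ - x₂))

/-- A state with two-point function `G` is in the domain of the form
`θ^μ(x) = lim_{ζ → 0} ∂_ζ^μ (φ₀(x+ζ) φ₀(x-ζ) - ω_∞(φ₀(x+ζ) φ₀(x-ζ)) 1)`, the limit being taken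
through space-like `ζ`, and its expectation value there is `t`. The derivatives are required to stay
bounded near `(x, 0)`, so that the limit is also one of distributions in `x`. -/
def HasThetaValue (G : TestFn → TestFn → ℂ) (x : Spacetime) {m : ℕ} (μ : Fin m → Fin 4) (t : ℂ) :
    Prop :=
  ∃ (U : Set (Spacetime × Spacetime)) (w : Spacetime → Spacetime → ℂ),
    IsOpen U ∧ (x, 0) ∈ U ∧ IsKernelOn G U w ∧
    (∃ C : ℝ, ∀ q ∈ U, q.2 ∈ spacelike → ‖iteratedFDeriv ℝ m (w q.1) q.2‖ ≤ C) ∧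
    Tendsto (fun ζ => iteratedFDeriv ℝ m (w x) ζ (fun i => eta (μ i) • basisVec (μ i)))
      (𝓝[spacelike] 0) (𝓝 t)

/-! ### Local thermal equilibrium -/

/-- The state `ω` agrees on the space of local observables at `x` with the reference state
`∫ dρ(β) ω_β`, where `ρ` is a probability measure with compact support in `V₊`. The space is spanned
by `1`, `φ₀(x)` and all `θ^μ(x)`; on `1` both states have the value `1`, and on the field both vanish
by gauge invariance. -/
def IsThermalAt (ω : State) (x : Spacetime) (ρ : Measure Spacetime) : Prop :=
  IsProbabilityMeasure ρ ∧
  (∃ B : Set Spacetime, IsCompact B ∧ B ⊆ forwardCone ∧ ρ Bᶜ = 0) ∧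
  ∀ (m : ℕ) (μ : Fin m → Fin 4), ∃ t : ℂ,
    HasThetaValue ω.twoPoint x μ t ∧ HasThetaValue (fun f g => refNPoint ρ [f, g]) x μ t

/-- The state `ω` is locally thermal in `O`: at each `x ∈ O` it agrees with a reference state on the
local observables, where the reference states are weakly (locally) integrable in `x`, and have
temperature supports in a common compact subset of `V₊` for `x` in compact subsets of `O`. -/
def IsThermalOn (ω : State) (O : Set Spacetime) : Prop :=
  ∃ ρ : Spacetime → Measure Spacetime,
    (∀ x ∈ O, IsThermalAt ω x (ρ x)) ∧
    (∀ l : List TestFn, LocallyIntegrableOn (fun x => refNPoint (ρ x) l) O) ∧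
    ∀ K ⊆ O, IsCompact K →
      ∃ B : Set Spacetime, IsCompact B ∧ B ⊆ forwardCone ∧ ∀ x ∈ K, ρ x Bᶜ = 0

open Classical in
/-- The lift `ω(Ξ)(x)` of a locally thermal state to the macro-observable with thermal function `Ξ`:
the expectation value of `Ξ` in a reference state that agrees with `ω` on the local observables at
`x`. For smooth solutions `Ξ` of the wave equation on `V₊`, it does not depend on which such
reference state is taken. -/
def lift {E : Type*} [NormedAddCommGroup E] [NormedSpace ℝ E] (ω : State) (Ξ : Spacetime → E)
    (x : Spacetime) : E :=
  if h : ∃ ρ, IsThermalAt ω x ρ then ∫ β, Ξ β ∂h.choose else 0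

/-- The thermal function `E_p(β) = e^{iβp}`. -/
def thermE (p β : Spacetime) : ℂ := exp (I * (mink β p : ℂ))

/-- The thermal function `M_p^n(β) = (βp)^n`. -/
def thermM (p : Spacetime) (n : ℕ) (β : Spacetime) : ℝ := mink β p ^ n

/-! ### Regularized states -/

/-- Non-negative test functions with integral `1`. -/
structure IsMollifier (f : Spacetime → ℝ) : Prop where
  smooth : ContDiff ℝ (⊤ : ℕ∞) f
  compact : HasCompactSupport f
  nonneg : ∀ y, 0 ≤ f y
  integral_eq : ∫ y, f y = 1

/-- `ω_f = ∫ dy f(y) ω ∘ α_y`. -/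
def IsRegularization (ω : State) (f : Spacetime → ℝ) (ωf : State) : Prop :=
  ∀ a : FieldAlgebra, Integrable (fun y => (f y : ℂ) * ω.toLin (translation y a)) ∧
    ωf.toLin a = ∫ y, (f y : ℂ) * ω.toLin (translation y a)

end LocalEq

end

noncomputable section

namespace LocalEq

/-! ### Geometry of the light cone -/

/-! The vacuum-subtracted two-point function of a reference state depends only on the difference of
its arguments. It is the Fourier transform of a density on the mass shell, the Bose factor averaged
over the temperature measure, which decays exponentially because the temperatures stay in a compact
subset of `V₊`. Its derivatives at coinciding points are therefore moments of this density. In polar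
coordinates the radial integral separates: with `n = (1, 𝐧)` light-like, the expectation value of a
balanced derivative of order `m` is a constant times `∫ dρ(β) ∫_{S²} n^{μ₁} ⋯ n^{μ_m}
(βn)^{-(m+2)}`. The constant is zero for odd `m` and nonzero for even `m`.

The pivot is the density argument `functional_eq_zero`. Let `Λ` be a bounded linear functional on
functions of the number `βn` that depends continuously on the direction `n`. Since `n⁰ = 1`, indices
can be padded with zeros, so one and the same monomial in `n` is paired with all sufficiently high
even negative powers of `βn`. If `Λ` annihilates these moments, Weierstrass' theorem in the variable
`(βn)^{-2}` extends this to all continuous `φ`, and Stone-Weierstrass on the sphere localizes it to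
each direction. Two things follow. The local observables at a point determine `∫ φ(βp) dρ(β)` for
every positive light-like `p`, so the lifts do not depend on the reference state chosen. And linear
differential identities between the `θ^μ` become identities for all functions of `βp`.

The regularized state should be represented at `x` by the average of the `ρ_z` with weight `f(z -
x)`. This average comes from the Riesz-Markov theorem, which needs measurability of `z ↦ ∫ ψ dρ_z`
for all continuous `ψ`. The hypothesis speaks of n-point functions only, that is, of Wick sums in
the thermal two-point functions, and these do not form an algebra. Clustering repairs this: moving a
pair of fields to spatial infinity splits off its two-point function as a factor, so products of
two-point functions are covered as pointwise limits, and Stone-Weierstrass on the temperature set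
does the rest (`ThermalFamily.aestronglyMeasurable_prod_wick`). The averaged kernel `∫ f(z - x) w(z,
ζ) dz` is a kernel for the regularized state, and dominated convergence identifies its limits at `ζ
= 0` with the values in the averaged reference state. This is thermality.

The averaged kernel is smooth in `x` too, because all `x`-derivatives fall on `f`. The field
equation holds in each of the points `x + ζ` and `x - ζ`. The difference and the sum of the two wave
equations read `∂_x · ∂_ζ w = 0` and `(□_x + □_ζ) w = 0`. After further `ζ`-derivatives and the
limit `ζ → 0`, the first states that the `θ^{μν}` are divergence free; in the second the `□_ζ` term
is a trace, which vanishes since `n` is light-like. The density argument turns these into the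
transport equation and the wave equation for averages of `φ(βp)`, used with `φ = cos` and `φ = sin`.

The remaining claims are direct: the bound is `|e^{iβp}| = 1`, the entire extension is the
Fourier-Laplace transform of a compactly supported measure, and the moment inequality is Hölder's.
-/

abbrev Space : Type := EuclideanSpace ℝ (Fin 3)

theorem mink_eq (x y : Spacetime) : mink x y = x 0 * y 0 - x 1 * y 1 - x 2 * y 2 - x 3 * y 3 := by
  simp [mink, eta, Fin.sum_univ_four]; ring

theorem mink_comm (x y : Spacetime) : mink x y = mink y x := by
  rw [mink_eq, mink_eq]; ring

theorem mink_add_right (x p p' : Spacetime) : mink x (p + p') = mink x p + mink x p' := by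
  simp only [mink_eq, PiLp.add_apply]; ring

theorem mink_smul_left (c : ℝ) (x p : Spacetime) : mink (c • x) p = c * mink x p := by
  simp only [mink_eq, PiLp.smul_apply, smul_eq_mul]; ring

theorem mink_smul_right (c : ℝ) (x p : Spacetime) : mink x (c • p) = c * mink x p := by
  rw [mink_comm, mink_smul_left, mink_comm]

theorem mink_neg_left (x p : Spacetime) : mink (-x) p = -mink x p := by
  rw [mink_comm, mink_neg_right, mink_comm]

theorem mink_sub_left (x y p : Spacetime) : mink (x - y) p = mink x p - mink y p := by
  rw [sub_eq_add_neg, mink_add_left, mink_neg_left, ← sub_eq_add_neg]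

/-- The Lorentz product as a continuous bilinear form. -/
def minkL : Spacetime →L[ℝ] Spacetime →L[ℝ] ℝ :=
  (LinearMap.mk₂ ℝ mink mink_add_left mink_smul_left mink_add_right
    mink_smul_right).toContinuousBilinearMap

@[simp] theorem minkL_apply (x y : Spacetime) : minkL x y = mink x y := rfl

@[fun_prop]
theorem Continuous.mink {X : Type*} [TopologicalSpace X] {u v : X → Spacetime}
    (hu : Continuous u) (hv : Continuous v) : Continuous fun x => mink (u x) (v x) := by
  have := (minkL.continuous.comp hu).clm_apply hv
  exact this

theorem abs_mink_le (x y : Spacetime) : |mink x y| ≤ ‖minkL‖ * ‖x‖ * ‖y‖ := by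
  have := minkL.le_opNorm₂ x y
  simpa using this

theorem mink_basisVec_left (μ : Fin 4) (p : Spacetime) : mink (basisVec μ) p = eta μ * p μ := by
  simp [mink, basisVec]

theorem eta_mul_eta (μ : Fin 4) : eta μ * eta μ = 1 := by
  unfold eta; split_ifs <;> norm_num

@[simp] theorem shell_zero_coord (q : Space) : shell q 0 = ‖q‖ := rfl

theorem shell_succ (q : Space) (i : Fin 3) : shell q i.succ = q i := by
  simp [shell]

@[fun_prop]
theorem continuous_shell : Continuous shell := by
  unfold shell
  refine (PiLp.continuous_toLp 2 _).comp (continuous_pi fun i => ?_)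
  refine Fin.cases ?_ (fun j => ?_) i
  · simpa using continuous_norm
  · simp only [Fin.cons_succ]; fun_prop

theorem shell_smul {r : ℝ} (hr : 0 ≤ r) (q : Space) : shell (r • q) = r • shell q := by
  ext i
  refine Fin.cases ?_ (fun j => ?_) i
  · simp [norm_smul, abs_of_nonneg hr]
  · simp [shell_succ]

theorem norm_sq_space (q : Space) : ‖q‖ ^ 2 = q 0 ^ 2 + q 1 ^ 2 + q 2 ^ 2 := by
  simp [EuclideanSpace.norm_sq_eq, Fin.sum_univ_three]

theorem mink_shell_self (q : Space) : mink (shell q) (shell q) = 0 := by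
  have h1 := shell_succ q 0
  have h2 := shell_succ q 1
  have h3 := shell_succ q 2
  have := norm_sq_space q
  simp only [Fin.succ_zero_eq_one, Fin.succ_one_eq_two] at h1 h2
  rw [show Fin.succ (2 : Fin 3) = 3 from rfl] at h3
  rw [mink_eq, h1, h2, h3, shell_zero_coord]
  nlinarith

theorem norm_shell_le (q : Space) : ‖shell q‖ ≤ 2 * ‖q‖ := by
  have h : ‖shell q‖ ^ 2 = 2 * ‖q‖ ^ 2 := by
    rw [EuclideanSpace.norm_sq_eq, Fin.sum_univ_succ]
    simp only [shell_succ, shell_zero_coord, EuclideanSpace.norm_sq_eq q]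
    simp [two_mul, EuclideanSpace.norm_sq_eq q]
  nlinarith [norm_nonneg q, norm_nonneg (shell q)]

theorem norm_le_norm_shell (q : Space) : ‖q‖ ≤ ‖shell q‖ := by
  have h : ‖shell q‖ ^ 2 = 2 * ‖q‖ ^ 2 := by
    rw [EuclideanSpace.norm_sq_eq, Fin.sum_univ_succ]
    simp only [shell_succ, shell_zero_coord, EuclideanSpace.norm_sq_eq q]
    simp [two_mul, EuclideanSpace.norm_sq_eq q]
  nlinarith [norm_nonneg q, norm_nonneg (shell q)]

/-- The spatial part of a vector. -/
def spatial (p : Spacetime) : Space := WithLp.toLp 2 fun i => p i.succ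

@[fun_prop]
theorem continuous_spatial : Continuous spatial := by
  unfold spatial
  exact (PiLp.continuous_toLp 2 _).comp (continuous_pi fun i => by fun_prop)

theorem mink_eq_spatial (x y : Spacetime) :
    mink x y = x 0 * y 0 - inner ℝ (spatial x) (spatial y) := by
  rw [mink_eq]
  simp only [PiLp.inner_apply, Fin.sum_univ_three, spatial]
  simp
  ring

theorem spatial_shell (q : Space) : spatial (shell q) = q := by
  ext i; simp [spatial, shell_succ]

theorem IsPositiveLightlike.exists_shell {p : Spacetime} (hp : IsPositiveLightlike p) :
    ∃ q : Space, q ≠ 0 ∧ p = shell q := by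
  have h0 := hp.1
  have h1 := hp.2
  rw [mink_eq_spatial, real_inner_self_eq_norm_sq] at h1
  have h2 : p 0 = ‖spatial p‖ := by nlinarith [norm_nonneg (spatial p)]
  refine ⟨spatial p, fun h => ?_, ?_⟩
  · rw [h, norm_zero] at h2; exact h0.ne' h2
  · ext i
    refine Fin.cases ?_ (fun j => ?_) i
    · simpa using h2
    · simp [shell_succ, spatial]

theorem mink_self_eq (x : Spacetime) : mink x x = x 0 ^ 2 - ‖spatial x‖ ^ 2 := by
  rw [mink_eq_spatial, real_inner_self_eq_norm_sq]; ring

/-- Cauchy-Schwarz for the spatial parts. -/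
theorem mink_shell_ge (β : Spacetime) (q : Space) :
    (β 0 - ‖spatial β‖) * ‖q‖ ≤ mink β (shell q) := by
  rw [mink_eq_spatial, spatial_shell, shell_zero_coord]
  nlinarith [real_inner_le_norm (spatial β) q]

theorem norm_spatial_lt {β : Spacetime} (h : β ∈ forwardCone) : ‖spatial β‖ < β 0 := by
  have h0 := h.1
  have h1 := h.2
  rw [mink_self_eq] at h1
  nlinarith [norm_nonneg (spatial β)]

/-- The continuous function `β⁰ - |𝛃|` is positive on the cone and attains its minimum on `B`. The
constant makes all momentum-space estimates uniform over a temperature set. -/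
theorem exists_cone_bound {B : Set Spacetime} (hB : IsCompact B) (hBV : B ⊆ forwardCone) :
    ∃ c > 0, ∀ β ∈ B, ∀ q : Space, c * ‖q‖ ≤ mink β (shell q) := by
  rcases B.eq_empty_or_nonempty with rfl | hne
  · exact ⟨1, one_pos, by simp⟩
  · obtain ⟨β₀, hβ₀, hmin⟩ := hB.exists_isMinOn hne
      (f := fun β : Spacetime => β 0 - ‖spatial β‖) (by fun_prop)
    refine ⟨β₀ 0 - ‖spatial β₀‖, sub_pos.2 (norm_spatial_lt (hBV hβ₀)), fun β hβ q => ?_⟩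
    refine le_trans ?_ (mink_shell_ge β q)
    exact mul_le_mul_of_nonneg_right (hmin hβ) (norm_nonneg q)

theorem mink_shell_pos {β : Spacetime} (h : β ∈ forwardCone) {q : Space} (hq : q ≠ 0) :
    0 < mink β (shell q) :=
  (mul_pos (sub_pos.2 (norm_spatial_lt h)) (norm_pos_iff.2 hq)).trans_le (mink_shell_ge β q)

theorem isOpen_forwardCone : IsOpen forwardCone := by
  have h1 : IsOpen {β : Spacetime | 0 < β 0} := isOpen_lt continuous_const (by fun_prop)
  have h2 : IsOpen {β : Spacetime | 0 < mink β β} := isOpen_lt continuous_const (by fun_prop)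
  exact h1.inter h2

theorem isOpen_spacelike : IsOpen spacelike := isOpen_lt (by fun_prop) continuous_const

/-- Limits through space-like `ζ` are unique only because the origin is in the closure of the
space-like vectors; multiples of a spatial unit vector show this. -/
theorem nhdsWithin_spacelike_neBot : (𝓝[spacelike] (0 : Spacetime)).NeBot := by
  rw [← mem_closure_iff_nhdsWithin_neBot]
  have h : Tendsto (fun n : ℕ => (1 / ((n : ℝ) + 1)) • basisVec 1) atTop (𝓝 (0 : Spacetime)) := by
    simpa using (tendsto_one_div_add_atTop_nhds_zero_nat (𝕜 := ℝ)).smul_const (basisVec 1)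
  refine mem_closure_of_tendsto h (Eventually.of_forall fun n => ?_)
  simp only [spacelike, Set.mem_ofPred_eq, mink_smul_left, mink_smul_right, mink_basisVec_left]
  have : (0 : ℝ) < 1 / ((n : ℝ) + 1) := by positivity
  simp [basisVec, eta]
  positivity

/-! ### Thermal densities -/

/-- The Bose-Einstein function. -/
def bose (s : ℝ) : ℝ := (Real.exp s - 1)⁻¹

/-- Here `e^s - 1 = 2 e^{s/2} sinh(s/2)` and `sinh t ≥ t`. The bound yields the `1/s` singularity
and the exponential decay of the Bose function at once. -/
theorem mul_exp_half_le {s : ℝ} (hs : 0 ≤ s) : s * Real.exp (s / 2) ≤ Real.exp s - 1 := by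
  have h1 : Real.exp s = Real.exp (s / 2) * Real.exp (s / 2) := by rw [← Real.exp_add]; ring_nf
  have h2 : s / 2 ≤ Real.sinh (s / 2) := Real.self_le_sinh_iff.2 (by linarith)
  rw [Real.sinh_eq] at h2
  have h3 : Real.exp (-(s / 2)) * Real.exp (s / 2) = 1 := by rw [← Real.exp_add]; simp
  nlinarith [Real.exp_pos (s / 2)]

theorem bose_nonneg {s : ℝ} (hs : 0 ≤ s) : 0 ≤ bose s :=
  inv_nonneg.2 (sub_nonneg.2 (Real.one_le_exp hs))

theorem bose_pos {s : ℝ} (hs : 0 < s) : 0 < bose s :=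
  inv_pos.2 (sub_pos.2 (Real.one_lt_exp_iff.2 hs))

theorem bose_le {s t : ℝ} (ht : 0 < t) (hts : t ≤ s) : bose s ≤ t⁻¹ * Real.exp (-(t / 2)) := by
  have h1 := mul_exp_half_le ht.le
  have h2 : t * Real.exp (t / 2) ≤ Real.exp s - 1 := h1.trans (by gcongr)
  rw [Real.exp_neg, ← mul_inv]
  exact inv_anti₀ (by positivity) h2

/-- At positive energy the thermal factor is the vacuum contribution `1` plus the Bose function, and
at negative energy it is minus the Bose function. After subtraction of the vacuum only the Bose
function remains. -/
theorem kms_factor_shell {s : ℝ} (hs : 0 < s) : (1 - exp (-(s : ℂ)))⁻¹ = 1 + (bose s : ℂ) := by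
  have h1 : (Real.exp s - 1 : ℝ) ≠ 0 := (sub_pos.2 (Real.one_lt_exp_iff.2 hs)).ne'
  have h2 : (1 - Real.exp (-s)) ≠ 0 := (sub_pos.2 (Real.exp_lt_one_iff.mpr (by linarith))).ne'
  have h3 : Real.exp (-s) * Real.exp s = 1 := by rw [← Real.exp_add]; simp
  have : (1 - Real.exp (-s))⁻¹ = 1 + bose s := by
    unfold bose; field_simp; nlinarith
  rw [← Complex.ofReal_neg, ← Complex.ofReal_exp]
  exact_mod_cast congrArg (fun x : ℝ => (x : ℂ)) this

theorem kms_factor_neg_shell (s : ℝ) : (1 - exp (s : ℂ))⁻¹ = -(bose s : ℂ) := by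
  unfold bose
  push_cast
  rw [← neg_sub, inv_neg]

/-- The volume factor `r²` of three-dimensional space cancels the singularity `|q|⁻²`, the worst one
that occurs. -/
theorem integrable_radial_exp {c : ℝ} (hc : 0 < c) (m : ℕ) :
    Integrable fun q : Space => ‖q‖⁻¹ ^ 2 * ‖q‖ ^ m * Real.exp (-(c * ‖q‖)) := by
  rw [integrable_fun_norm_addHaar volume (f := fun r => r⁻¹ ^ 2 * r ^ m * Real.exp (-(c * r)))]
  have h := integrableOn_rpow_mul_exp_neg_mul_rpow (s := m) (p := 1) (b := c) (by
    have : (0 : ℝ) ≤ m := by positivity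
    linarith) one_pos hc
  refine (integrableOn_congr_fun (fun r hr => ?_) measurableSet_Ioi).2 h
  have hr : (0 : ℝ) < r := hr
  simp only [finrank_euclideanSpace, Fintype.card_fin, smul_eq_mul, Real.rpow_natCast, Real.rpow_one]
  field_simp

/-! ### Decay of Fourier transforms of test functions -/

/-- The reflection of the spatial components. -/
def reflect (p : Spacetime) : Spacetime := WithLp.toLp 2 fun i => eta i * p i

theorem mink_eq_inner (x p : Spacetime) : mink x p = inner ℝ x (reflect p) := by
  simp only [mink, reflect, PiLp.inner_apply]
  exact Finset.sum_congr rfl fun i _ => by simp; ring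

theorem norm_reflect (p : Spacetime) : ‖reflect p‖ = ‖p‖ := by
  have h : ∀ i, eta i ^ 2 = 1 := fun i => by rw [sq, eta_mul_eta]
  simp [EuclideanSpace.norm_eq, reflect, mul_pow, h]

@[fun_prop]
theorem continuous_reflect : Continuous reflect := by
  unfold reflect
  exact (PiLp.continuous_toLp 2 _).comp (continuous_pi fun i => by fun_prop)

-- The Lorentz product is the Euclidean one with a reflected momentum, so the rapid decay of Fourier
-- transforms of Schwartz functions carries over.
open FourierTransform in
theorem minkFT_eq_fourier (f : TestFn) (p : Spacetime) :
    minkFT f p = 𝓕 (f.2.2.toSchwartzMap f.2.1) ((2 * Real.pi)⁻¹ • reflect p) := by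
  rw [SchwartzMap.fourier_coe, Real.fourier_eq', minkFT]
  congr 1
  funext x
  rw [HasCompactSupport.toSchwartzMap_toFun, smul_eq_mul, mul_comm, mink_eq_inner,
    real_inner_smul_right]
  congr 2
  have : -2 * Real.pi * ((2 * Real.pi)⁻¹ * inner ℝ x (reflect p)) = -inner ℝ x (reflect p) := by
    field_simp
  rw [this]
  push_cast
  ring

@[fun_prop]
theorem continuous_minkFT (f : TestFn) : Continuous (minkFT f) := by
  rw [show minkFT f = _ from funext (minkFT_eq_fourier f)]
  exact (SchwartzMap.continuous _).comp (by fun_prop)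

theorem exists_minkFT_bound (f : TestFn) (N : ℕ) :
    ∃ C, 0 ≤ C ∧ ∀ p, ‖minkFT f p‖ ≤ C * ((1 + ‖p‖) ^ N)⁻¹ := by
  set g := FourierTransform.fourier (f.2.2.toSchwartzMap f.2.1)
  have h := fun x => SchwartzMap.one_add_le_sup_seminorm_apply (𝕜 := ℝ) (m := (N, 0)) le_rfl
    le_rfl g x
  set C := 2 ^ N * ((Finset.Iic (N, 0)).sup fun m => SchwartzMap.seminorm ℝ m.1 m.2) g
  have hC : 0 ≤ C := by positivity
  have hpi : (1 : ℝ) ≤ 2 * Real.pi := by nlinarith [Real.pi_gt_three]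
  refine ⟨(2 * Real.pi) ^ N * C, by positivity, fun p => ?_⟩
  have h1 := h ((2 * Real.pi)⁻¹ • reflect p)
  rw [norm_iteratedFDeriv_zero, ← minkFT_eq_fourier, norm_smul, norm_reflect, Real.norm_of_nonneg
    (by positivity)] at h1
  have h2 : (1 + ‖p‖) ^ N ≤ (2 * Real.pi) ^ N * (1 + (2 * Real.pi)⁻¹ * ‖p‖) ^ N := by
    rw [← mul_pow]
    gcongr
    rw [mul_add, mul_inv_cancel_left₀ (by positivity)]
    linarith
  rw [← div_eq_mul_inv, le_div_iff₀ (by positivity)]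
  calc ‖minkFT f p‖ * (1 + ‖p‖) ^ N
      ≤ ‖minkFT f p‖ * ((2 * Real.pi) ^ N * (1 + (2 * Real.pi)⁻¹ * ‖p‖) ^ N) := by gcongr
    _ = (2 * Real.pi) ^ N * ((1 + (2 * Real.pi)⁻¹ * ‖p‖) ^ N * ‖minkFT f p‖) := by ring
    _ ≤ _ := by gcongr

/-- A translation is a phase in momentum space. Hence all bounds below are uniform in translations,
as clustering requires. -/
theorem norm_minkFT_transl (y : Spacetime) (f : TestFn) (p : Spacetime) :
    ‖minkFT (translT y f) p‖ = ‖minkFT f p‖ := by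
  rw [minkFT_transl, norm_mul, show -I * (mink y p : ℂ) = ((-mink y p : ℝ) : ℂ) * I by
    push_cast; ring, Complex.norm_exp_ofReal_mul_I, one_mul]

/-! ### Integrability on the mass shell -/

/-- A bound for the two halves of the integrand of `shellForm`. -/
def formBound (f g : TestFn) (q : Space) : ℝ :=
  ‖q‖⁻¹ * ((‖minkFT f (shell q)‖ * ‖minkFT g (-shell q)‖ +
    ‖minkFT f (-shell q)‖ * ‖minkFT g (shell q)‖) * (1 + ‖q‖⁻¹))

theorem formBound_nonneg (f g : TestFn) (q : Space) : 0 ≤ formBound f g q := by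
  unfold formBound; positivity

theorem formBound_transl (a b : Spacetime) (f g : TestFn) :
    formBound (translT a f) (translT b g) = formBound f g := by
  funext q; simp only [formBound, norm_minkFT_transl]

theorem integrable_weight :
    Integrable fun q : Space => ‖q‖⁻¹ ^ 2 * ((1 + ‖q‖) ^ 2)⁻¹ := by
  rw [integrable_fun_norm_addHaar volume (f := fun r => r⁻¹ ^ 2 * ((1 + r) ^ 2)⁻¹)]
  have h : IntegrableOn (fun r : ℝ => (1 + ‖r‖) ^ (-(2 : ℝ))) (Ioi 0) :=
    (integrable_one_add_norm (by simp)).integrableOn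
  refine (integrableOn_congr_fun (fun r hr => ?_) measurableSet_Ioi).2 h
  have hr : (0 : ℝ) < r := hr
  simp only [finrank_euclideanSpace, Fintype.card_fin, smul_eq_mul, Real.norm_eq_abs,
    abs_of_pos hr, Real.rpow_neg (by positivity : (0 : ℝ) ≤ 1 + r), Real.rpow_two]
  field_simp

theorem integrable_formBound (f g : TestFn) : Integrable (formBound f g) := by
  -- The weight `|q|⁻¹ (1 + |q|⁻¹)` equals `(1 + |q|) |q|⁻²`; decay of order three leaves `|q|⁻² (1
  -- + |q|)⁻²`, which is integrable.
  obtain ⟨C, hC0, hC⟩ := exists_minkFT_bound f 3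
  obtain ⟨D, hD0, hD⟩ := exists_minkFT_bound g 0
  refine (integrable_weight.const_mul (2 * (C * D))).mono' ?_ (Eventually.of_forall fun q => ?_)
  · refine Measurable.aestronglyMeasurable ?_
    unfold formBound
    fun_prop
  · rw [Real.norm_of_nonneg (formBound_nonneg f g q)]
    rcases eq_or_ne q 0 with rfl | hq
    · simp [formBound]
    have hq0 : 0 < ‖q‖ := norm_pos_iff.2 hq
    have hs := norm_le_norm_shell q
    have h1 : ∀ p : Spacetime, ‖p‖ = ‖shell q‖ → ‖minkFT f p‖ ≤ C * ((1 + ‖q‖) ^ 3)⁻¹ := by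
      intro p hp
      refine (hC p).trans ?_
      rw [hp]
      gcongr
    have h2 : ∀ p : Spacetime, ‖minkFT g p‖ ≤ D := fun p => by simpa using hD p
    have hA := h1 (shell q) rfl
    have hB := h1 (-shell q) (norm_neg _)
    calc formBound f g q
        ≤ ‖q‖⁻¹ * ((C * ((1 + ‖q‖) ^ 3)⁻¹ * D + C * ((1 + ‖q‖) ^ 3)⁻¹ * D) * (1 + ‖q‖⁻¹)) := by
          unfold formBound
          gcongr
          · exact h2 _
          · exact h2 _
      _ = 2 * (C * D) * (‖q‖⁻¹ ^ 2 * ((1 + ‖q‖) ^ 2)⁻¹) := by field_simp; ring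

/-- The half of the integrand of `shellForm` that belongs to the momentum `p`. -/
def formHalf (h : Spacetime → ℂ) (f g : TestFn) (q : Space) (p : Spacetime) : ℂ :=
  ((2 * ‖q‖ : ℝ) : ℂ)⁻¹ * (minkFT f p * minkFT g (-p) * h p)

theorem shellForm_eq_half (h : Spacetime → ℂ) (f g : TestFn) :
    shellForm h f g = ((2 * Real.pi : ℝ) : ℂ)⁻¹ ^ 3 *
      ∫ q : Space, (formHalf h f g q (shell q) - formHalf h f g q (-shell q)) := by
  simp only [shellForm, formHalf, neg_neg, mul_sub]

theorem norm_formHalf_le {h : Spacetime → ℂ} {A : ℝ} (f g : TestFn) (q : Space) (p : Spacetime)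
    (hp : p = shell q ∨ p = -shell q)
    (hh : q ≠ 0 → ‖h p‖ ≤ A * (1 + ‖q‖⁻¹)) : ‖formHalf h f g q p‖ ≤ A * formBound f g q := by
  rcases eq_or_ne q 0 with rfl | hq
  · simp [formHalf, formBound]
  have hq0 : 0 < ‖q‖ := norm_pos_iff.2 hq
  have h1 := hh hq
  have hA : 0 ≤ A * (1 + ‖q‖⁻¹) := (norm_nonneg _).trans h1
  have h2 : ‖((2 * ‖q‖ : ℝ) : ℂ)⁻¹‖ ≤ ‖q‖⁻¹ := by
    rw [norm_inv, Complex.norm_real, Real.norm_of_nonneg (by positivity)]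
    exact inv_anti₀ hq0 (by linarith)
  have h3 : ‖minkFT f p‖ * ‖minkFT g (-p)‖ ≤ ‖minkFT f (shell q)‖ * ‖minkFT g (-shell q)‖ +
    ‖minkFT f (-shell q)‖ * ‖minkFT g (shell q)‖ := by
    rcases hp with rfl | rfl
    · exact le_add_of_nonneg_right (by positivity)
    · rw [neg_neg]; exact le_add_of_nonneg_left (by positivity)
  calc ‖formHalf h f g q p‖
      = ‖((2 * ‖q‖ : ℝ) : ℂ)⁻¹‖ * ((‖minkFT f p‖ * ‖minkFT g (-p)‖) * ‖h p‖) := by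
        simp only [formHalf, norm_mul]
    _ ≤ ‖q‖⁻¹ * ((‖minkFT f (shell q)‖ * ‖minkFT g (-shell q)‖ +
          ‖minkFT f (-shell q)‖ * ‖minkFT g (shell q)‖) * (A * (1 + ‖q‖⁻¹))) := by
        gcongr
    _ = A * formBound f g q := by unfold formBound; ring

theorem integrable_formHalf {h : Spacetime → ℂ} {A : ℝ} (hm : Measurable h) (f g : TestFn)
    {P : Space → Spacetime} (hPm : Measurable P) (hP : ∀ q, P q = shell q ∨ P q = -shell q)
    (hh : ∀ q, q ≠ 0 → ‖h (P q)‖ ≤ A * (1 + ‖q‖⁻¹)) :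
    Integrable fun q => formHalf h f g q (P q) := by
  refine ((integrable_formBound f g).const_mul A).mono' ?_
    (Eventually.of_forall fun q => norm_formHalf_le f g q _ (hP q) (hh q))
  refine Measurable.aestronglyMeasurable ?_
  unfold formHalf
  fun_prop

/-- The momentum factor of the equilibrium state. -/
def kmsFactor (β p : Spacetime) : ℂ := (1 - exp (-(mink β p : ℂ)))⁻¹

/-- The momentum factor of the vacuum. -/
def vacFactor (p : Spacetime) : ℂ := if 0 < p 0 then 1 else 0

theorem measurable_kmsFactor (β : Spacetime) : Measurable (kmsFactor β) := by
  have : Continuous fun p => mink β p := by fun_prop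
  have := this.measurable
  unfold kmsFactor
  fun_prop

theorem measurable_vacFactor : Measurable vacFactor := by
  refine Measurable.ite (measurableSet_lt measurable_const ?_) measurable_const measurable_const
  fun_prop

theorem norm_kmsFactor_le {c : ℝ} (hc : 0 < c) {β : Spacetime} {q : Space} (hq : q ≠ 0)
    (h : c * ‖q‖ ≤ mink β (shell q)) {p : Spacetime} (hp : p = shell q ∨ p = -shell q) :
    ‖kmsFactor β p‖ ≤ (1 + c⁻¹) * (1 + ‖q‖⁻¹) := by
  have hq0 : 0 < ‖q‖ := norm_pos_iff.2 hq
  have hs : 0 < mink β (shell q) := (mul_pos hc hq0).trans_le h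
  have hb : bose (mink β (shell q)) ≤ c⁻¹ * ‖q‖⁻¹ := by
    refine (bose_le (mul_pos hc hq0) h).trans ?_
    rw [mul_inv]
    refine mul_le_of_le_one_right (by positivity) (Real.exp_le_one_iff.2 ?_)
    have := mul_pos hc hq0
    linarith
  have hb0 := bose_nonneg hs.le
  have hci : 0 < c⁻¹ := inv_pos.2 hc
  have hqi : 0 < ‖q‖⁻¹ := inv_pos.2 hq0
  rcases hp with rfl | rfl
  · rw [kmsFactor, kms_factor_shell hs]
    refine (norm_add_le _ _).trans ?_
    rw [norm_one, Complex.norm_real, Real.norm_of_nonneg hb0]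
    nlinarith
  · rw [kmsFactor, mink_neg_right]
    push_cast
    rw [neg_neg, kms_factor_neg_shell, norm_neg, Complex.norm_real, Real.norm_of_nonneg hb0]
    nlinarith

theorem norm_vacFactor_le (p : Spacetime) (q : Space) : ‖vacFactor p‖ ≤ 1 * (1 + ‖q‖⁻¹) := by
  have : 0 ≤ ‖q‖⁻¹ := by positivity
  unfold vacFactor
  split_ifs
  · simp
  · simp; linarith

theorem kmsForm_eq (β : Spacetime) : kmsForm β = shellForm (kmsFactor β) := rfl

theorem vacForm_eq : vacForm = shellForm vacFactor := rfl

theorem norm_shellForm_le {h : Spacetime → ℂ} {A : ℝ} (f g : TestFn)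
    (hh : ∀ q : Space, q ≠ 0 → ∀ p, p = shell q ∨ p = -shell q → ‖h p‖ ≤ A * (1 + ‖q‖⁻¹)) :
    ‖shellForm h f g‖ ≤ (2 * Real.pi)⁻¹ ^ 3 * (2 * A * ∫ q, formBound f g q) := by
  rw [shellForm_eq_half, norm_mul, norm_pow, norm_inv, Complex.norm_real,
    Real.norm_of_nonneg (by positivity)]
  gcongr
  rw [← integral_const_mul]
  refine norm_integral_le_of_norm_le ((integrable_formBound f g).const_mul _)
    (Eventually.of_forall fun q => ?_)
  refine (norm_sub_le _ _).trans ?_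
  have h1 := norm_formHalf_le f g q _ (Or.inl rfl) fun hq => hh q hq _ (Or.inl rfl)
  have h2 := norm_formHalf_le f g q _ (Or.inr rfl) fun hq => hh q hq _ (Or.inr rfl)
  linarith

theorem exists_kmsForm_bound {B : Set Spacetime} (hB : IsCompact B) (hBV : B ⊆ forwardCone)
    (f g : TestFn) :
    ∃ C, ∀ β ∈ B, ∀ a b : Spacetime, ‖kmsForm β (translT a f) (translT b g)‖ ≤ C := by
  obtain ⟨c, hc, hcB⟩ := exists_cone_bound hB hBV
  refine ⟨(2 * Real.pi)⁻¹ ^ 3 * (2 * (1 + c⁻¹) * ∫ q, formBound f g q), fun β hβ a b => ?_⟩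
  have := norm_shellForm_le (A := 1 + c⁻¹) (h := kmsFactor β) (translT a f) (translT b g)
    (fun q hq p hp => norm_kmsFactor_le hc hq (hcB β hβ q) hp)
  rwa [formBound_transl] at this

theorem kmsForm_transl (β y : Spacetime) (f g : TestFn) :
    kmsForm β (translT y f) (translT y g) = kmsForm β f g := by
  simp only [kmsForm, shellForm, minkFT_transl, mink_neg_right]
  congr 2
  funext q
  have h : exp (-I * (mink y (shell q) : ℂ)) * exp (-I * ((-mink y (shell q) : ℝ) : ℂ)) = 1 := by
    rw [← Complex.exp_add]; simp
  linear_combination (((2 * ‖q‖ : ℝ) : ℂ)⁻¹ * (minkFT f (shell q) * minkFT g (-shell q) *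
    (1 - exp (-(mink β (shell q) : ℂ)))⁻¹ - minkFT f (-shell q) * minkFT g (shell q) *
    (1 - exp (-((-mink β (shell q) : ℝ) : ℂ)))⁻¹)) * h

theorem vacForm_transl (y : Spacetime) (f g : TestFn) :
    vacForm (translT y f) (translT y g) = vacForm f g := by
  simp only [vacForm, shellForm, minkFT_transl, mink_neg_right]
  congr 2
  funext q
  have h : exp (-I * (mink y (shell q) : ℂ)) * exp (-I * ((-mink y (shell q) : ℝ) : ℂ)) = 1 := by
    rw [← Complex.exp_add]; simp
  linear_combination (((2 * ‖q‖ : ℝ) : ℂ)⁻¹ * (minkFT f (shell q) * minkFT g (-shell q) *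
    (if 0 < shell q 0 then 1 else 0) - minkFT f (-shell q) * minkFT g (shell q) *
    (if 0 < (-shell q) 0 then 1 else 0))) * h

theorem continuousAt_kmsFactor {β₀ : Spacetime} (h0 : β₀ ∈ forwardCone) {q : Space} (hq : q ≠ 0)
    {p : Spacetime} (hp : p = shell q ∨ p = -shell q) :
    ContinuousAt (fun β => kmsFactor β p) β₀ := by
  have hs := mink_shell_pos h0 hq
  have hc : Continuous fun β => 1 - exp (-(mink β p : ℂ)) := by fun_prop
  refine hc.continuousAt.inv₀ fun h => ?_
  have h1 : exp (-(mink β₀ p : ℂ)) = 1 := by linear_combination -h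
  rw [← Complex.ofReal_neg, ← Complex.ofReal_exp] at h1
  have h2 : -mink β₀ p = 0 := Real.exp_eq_one_iff _ |>.1 (by exact_mod_cast h1)
  rcases hp with rfl | rfl
  · linarith
  · rw [mink_neg_right] at h2; linarith

/-- Dominated convergence: on a compact neighbourhood of `β₀` in the cone the thermal factors have a
common bound. -/
theorem continuousOn_kmsForm (f g : TestFn) : ContinuousOn (fun β => kmsForm β f g) forwardCone := by
  refine fun β₀ h0 => ContinuousAt.continuousWithinAt ?_
  obtain ⟨B, hB, h0B, hBV⟩ := exists_compact_subset isOpen_forwardCone h0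
  obtain ⟨c, hc, hcB⟩ := exists_cone_bound hB hBV
  simp only [kmsForm_eq, shellForm_eq_half]
  refine continuousAt_const.mul ?_
  have hev : ∀ᶠ β in 𝓝 β₀, β ∈ B := mem_interior_iff_mem_nhds.1 h0B
  refine continuousAt_of_dominated (bound := fun q => 2 * ((1 + c⁻¹) * formBound f g q)) ?_ ?_
    (((integrable_formBound f g).const_mul _).const_mul _) ?_
  · refine Eventually.of_forall fun β => Measurable.aestronglyMeasurable ?_
    have := measurable_kmsFactor β
    unfold formHalf
    fun_prop
  · filter_upwards [hev] with β hβ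
    refine Eventually.of_forall fun q => (norm_sub_le _ _).trans ?_
    have h1 := norm_formHalf_le (A := 1 + c⁻¹) (h := kmsFactor β) f g q _ (Or.inl rfl)
      fun hq => norm_kmsFactor_le hc hq (hcB β hβ q) (Or.inl rfl)
    have h2 := norm_formHalf_le (A := 1 + c⁻¹) (h := kmsFactor β) f g q _ (Or.inr rfl)
      fun hq => norm_kmsFactor_le hc hq (hcB β hβ q) (Or.inr rfl)
    linarith
  · refine Eventually.of_forall fun q => ?_
    rcases eq_or_ne q 0 with rfl | hq
    · simp only [formHalf, norm_zero, mul_zero, Complex.ofReal_zero, inv_zero, zero_mul]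
      exact continuousAt_const
    · unfold formHalf
      exact (continuousAt_const.mul (continuousAt_const.mul
        (continuousAt_kmsFactor h0 hq (Or.inl rfl)))).sub (continuousAt_const.mul
        (continuousAt_const.mul (continuousAt_kmsFactor h0 hq (Or.inr rfl))))

/-! ### Clustering -/

/-- The Riemann-Lebesgue lemma along the sequence of frequencies proportional to `n` in the first
coordinate direction. -/
theorem tendsto_integral_phase {F : Space → ℂ} (s : ℝ) (hs : s ≠ 0) :
    Tendsto (fun n : ℕ => ∫ q, exp (I * ((s * n * inner ℝ (EuclideanSpace.single 0 1) q : ℝ) : ℂ))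
      * F q) atTop (𝓝 0) := by
  have h := tendsto_integral_exp_inner_smul_cocompact F
  set e : Space := EuclideanSpace.single 0 1
  have he : ‖e‖ = 1 := by simp [e]
  have h2 : Tendsto (fun n : ℕ => (-(s * n) / (2 * Real.pi)) • e) atTop (cocompact Space) := by
    rw [← Metric.cobounded_eq_cocompact, ← tendsto_norm_atTop_iff_cobounded]
    have : (fun n : ℕ => ‖(-(s * n) / (2 * Real.pi)) • e‖) =
        fun n : ℕ => (|s| / (2 * Real.pi)) * (n : ℝ) := by
      funext n
      rw [norm_smul, he, mul_one, Real.norm_eq_abs, abs_div, abs_neg, abs_mul, Nat.abs_cast,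
        abs_of_pos (by positivity : 0 < 2 * Real.pi)]
      ring
    rw [this]
    exact tendsto_natCast_atTop_atTop.const_mul_atTop (by positivity)
  refine (h.comp h2).congr fun n => ?_
  simp only [Function.comp]
  congr 1
  funext q
  rw [Circle.smul_def, Real.fourierChar_apply, smul_eq_mul, real_inner_smul_right,
    real_inner_comm q e]
  congr 2
  have : 2 * Real.pi * -(-(s * n) / (2 * Real.pi) * inner ℝ q e) = s * n * inner ℝ q e := by
    field_simp
  rw [this, mul_comm]

theorem formHalf_transl (h : Spacetime → ℂ) (y : Spacetime) (f g : TestFn) (q : Space)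
    (p : Spacetime) :
    formHalf h (translT y f) g q p = exp (-I * (mink y p : ℂ)) * formHalf h f g q p := by
  simp only [formHalf, minkFT_transl]; ring

/-- A spatial translation of one argument multiplies the two halves of the integrand by phases of
opposite frequency, and each half is integrable. -/
theorem tendsto_kmsForm_transl {β : Spacetime} (hβ : β ∈ forwardCone) (f g : TestFn) :
    Tendsto (fun n : ℕ => kmsForm β (translT ((n : ℝ) • basisVec 1) f) g) atTop (𝓝 0) := by
  obtain ⟨c, hc, hcB⟩ := exists_cone_bound (B := {β}) isCompact_singleton (by simpa using hβ)
  have hmk : ∀ (n : ℕ) (q : Space), mink ((n : ℝ) • basisVec 1) (shell q) =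
      -(n * inner ℝ (EuclideanSpace.single 0 1) q) := by
    intro n q
    have : shell q 1 = q 0 := shell_succ q 0
    rw [mink_smul_left, mink_basisVec_left, this]
    simp [eta, EuclideanSpace.inner_single_left]
  have hI : ∀ (f : TestFn) {P : Space → Spacetime}, Measurable P →
      (∀ q, P q = shell q ∨ P q = -shell q) → Integrable fun q => formHalf (kmsFactor β) f g q (P q) :=
    fun f P hPm hP => integrable_formHalf (measurable_kmsFactor β) f g hPm hP
      fun q hq => norm_kmsFactor_le hc hq (hcB β rfl q) (hP q)
  have hsm : Measurable shell := continuous_shell.measurable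
  have key : ∀ n : ℕ, kmsForm β (translT ((n : ℝ) • basisVec 1) f) g =
      ((2 * Real.pi : ℝ) : ℂ)⁻¹ ^ 3 *
        ((∫ q : Space, exp (I * ((1 * n * inner ℝ (EuclideanSpace.single 0 1) q : ℝ) : ℂ)) *
          formHalf (kmsFactor β) f g q (shell q)) -
        ∫ q : Space, exp (I * ((-1 * n * inner ℝ (EuclideanSpace.single 0 1) q : ℝ) : ℂ)) *
          formHalf (kmsFactor β) f g q (-shell q)) := by
    intro n
    rw [kmsForm_eq, shellForm_eq_half, integral_sub (hI _ hsm fun q => Or.inl rfl)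
      (hI _ (P := fun q => -shell q) hsm.neg fun q => Or.inr rfl)]
    congr 2
    · congr 1
      funext q
      rw [formHalf_transl, hmk]
      congr 2
      push_cast
      ring
    · congr 1
      funext q
      rw [formHalf_transl, mink_neg_right, hmk]
      congr 2
      push_cast
      ring
  simp only [key]
  have h1 := tendsto_integral_phase (F := fun q => formHalf (kmsFactor β) f g q (shell q)) 1
    one_ne_zero
  have h2 := tendsto_integral_phase (F := fun q => formHalf (kmsFactor β) f g q (-shell q)) (-1)
    (by norm_num)
  simpa using (h1.sub h2).const_mul (((2 * Real.pi : ℝ) : ℂ)⁻¹ ^ 3)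

/-! ### Wick's rule -/

theorem wick_cons (W : TestFn → TestFn → ℂ) (f : TestFn) (l : List TestFn) :
    wick W (f :: l) = ∑ i : Fin l.length, W f (l.get i) * wick W (l.eraseIdx i) := by
  rw [wick]

theorem wick_pair (W : TestFn → TestFn → ℂ) (f g : TestFn) : wick W [f, g] = W f g := by
  simp [wick_cons, wick]

theorem wick_cons_cons (W : TestFn → TestFn → ℂ) (f g : TestFn) (l : List TestFn) :
    wick W (f :: g :: l) = W f g * wick W l +
      ∑ i : Fin l.length, W f (l.get i) * wick W (g :: l.eraseIdx i) := by
  rw [wick_cons]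
  simp only [List.length_cons]
  rw [Fin.sum_univ_succ]
  simp

/-- A bound for the Wick sum in terms of the number of fields. -/
def wickBound (C : ℝ) : ℕ → ℝ
  | 0 => 1
  | 1 => 0
  | n + 2 => (n + 1) * (C * wickBound C n)

theorem norm_wick_le (W : TestFn → TestFn → ℂ) {C : ℝ} (hC : 0 ≤ C) :
    ∀ (n : ℕ) (l : List TestFn), l.length = n → (∀ f ∈ l, ∀ g ∈ l, ‖W f g‖ ≤ C) →
      ‖wick W l‖ ≤ wickBound C n
  | 0, l, hl, _ => by
    rw [List.length_eq_zero_iff] at hl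
    subst hl
    simp [wick, wickBound]
  | 1, l, hl, _ => by
    obtain ⟨f, rfl⟩ := List.length_eq_one_iff.1 hl
    simp [wick_cons, wickBound]
  | n + 2, [], hl, _ => by simp at hl
  | n + 2, f :: l, hl, h => by
    have hl' : l.length = n + 1 := by simpa using hl
    rw [wick_cons]
    refine (norm_sum_le _ _).trans ?_
    calc ∑ i : Fin l.length, ‖W f (l.get i) * wick W (l.eraseIdx i)‖
        ≤ ∑ i : Fin l.length, C * wickBound C n := by
          refine Finset.sum_le_sum fun i _ => ?_
          rw [norm_mul]
          have hmem : ∀ g ∈ l.eraseIdx i, g ∈ l := fun g hg => List.mem_of_mem_eraseIdx hg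
          refine mul_le_mul (h _ (by simp) _ (by simp)) ?_ (norm_nonneg _) hC
          refine norm_wick_le W hC n _ ?_ fun u hu v hv =>
            h _ (List.mem_cons_of_mem _ (hmem u hu)) _ (List.mem_cons_of_mem _ (hmem v hv))
          rw [List.length_eraseIdx, if_pos i.2, hl']; rfl
      _ = _ := by simp [hl', wickBound]

theorem continuousOn_wick : ∀ (n : ℕ) (l : List TestFn), l.length = n →
    ContinuousOn (fun β => wick (kmsForm β) l) forwardCone
  | 0, l, hl => by
    rw [List.length_eq_zero_iff] at hl
    subst hl
    simp only [wick]
    exact continuousOn_const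
  | n + 1, [], hl => by simp at hl
  | n + 1, f :: l, hl => by
    have hl' : l.length = n := by simpa using hl
    simp only [wick_cons]
    refine continuousOn_finsetSum _ fun i _ => (continuousOn_kmsForm _ _).mul ?_
    refine continuousOn_wick (n - 1) _ ?_
    rw [List.length_eraseIdx, if_pos i.2, hl']
termination_by n => n
decreasing_by
  have := i.2
  omega

theorem translT_zero (f : TestFn) : translT 0 f = f := by
  apply Subtype.ext; funext x; simp [translT]

theorem exists_kmsForm_list_bound {B : Set Spacetime} (hB : IsCompact B) (hBV : B ⊆ forwardCone)
    (l : List TestFn) : ∃ C, 0 ≤ C ∧ ∀ β ∈ B, ∀ u ∈ l, ∀ v ∈ l, ∀ a b : Spacetime,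
      ‖kmsForm β (translT a u) (translT b v)‖ ≤ C := by
  classical
  choose D hD using fun u v => exists_kmsForm_bound hB hBV u v
  refine ⟨∑ u ∈ l.toFinset, ∑ v ∈ l.toFinset, |D u v|, by positivity,
    fun β hβ u hu v hv a b => (hD u v β hβ a b).trans ((le_abs_self _).trans ?_)⟩
  refine le_trans ?_ (Finset.single_le_sum (f := fun u => ∑ v ∈ l.toFinset, |D u v|)
    (fun i _ => by positivity) (List.mem_toFinset.2 hu))
  exact Finset.single_le_sum (f := fun v => |D u v|) (fun i _ => by positivity)
    (List.mem_toFinset.2 hv)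

theorem exists_wick_bound {B : Set Spacetime} (hB : IsCompact B) (hBV : B ⊆ forwardCone)
    (l : List TestFn) : ∃ C : ℕ → ℝ, ∀ β ∈ B, ∀ l' : List TestFn,
      (∀ u ∈ l', ∃ a, ∃ u' ∈ l, u = translT a u') → ‖wick (kmsForm β) l'‖ ≤ C l'.length := by
  obtain ⟨C, hC0, hC⟩ := exists_kmsForm_list_bound hB hBV l
  refine ⟨wickBound C, fun β hβ l' hl' => norm_wick_le _ hC0 _ _ rfl fun u hu v hv => ?_⟩
  obtain ⟨a, u', hu', rfl⟩ := hl' u hu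
  obtain ⟨b, v', hv', rfl⟩ := hl' v hv
  exact hC β hβ u' hu' v' hv' a b

/-- Far away translates of two fields decouple from the remaining fields. -/
theorem tendsto_wick_transl {β : Spacetime} (hβ : β ∈ forwardCone) (f g : TestFn)
    (l : List TestFn) :
    Tendsto (fun n : ℕ => wick (kmsForm β) (translT ((n : ℝ) • basisVec 1) f ::
      translT ((n : ℝ) • basisVec 1) g :: l)) atTop (𝓝 (kmsForm β f g * wick (kmsForm β) l)) := by
  obtain ⟨C, hC⟩ := exists_wick_bound (B := {β}) isCompact_singleton (by simpa using hβ) (g :: l)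
  -- The pairing of the two shifted fields with each other is independent of the shift. In every
  -- other term the first shifted field meets an unshifted one, so a factor tending to zero
  -- multiplies a bounded Wick sum.
  simp only [wick_cons_cons, kmsForm_transl]
  conv => enter [3, 1]; rw [← add_zero (kmsForm β f g * wick (kmsForm β) l)]
  refine tendsto_const_nhds.add ?_
  rw [← Finset.sum_const_zero (s := (Finset.univ : Finset (Fin l.length)))]
  refine tendsto_finsetSum _ fun i _ => ?_
  refine (tendsto_kmsForm_transl hβ f (l.get i)).zero_mul_isBoundedUnder_le
    ⟨C (l.length - 1 + 1), ?_⟩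
  rw [eventually_map]
  refine Eventually.of_forall fun n => ?_
  refine (hC β rfl _ fun u hu => ?_).trans_eq ?_
  · rcases List.mem_cons.1 hu with rfl | hu
    · exact ⟨_, g, by simp, rfl⟩
    · exact ⟨0, u, List.mem_cons_of_mem _ (List.mem_of_mem_eraseIdx hu), (translT_zero u).symm⟩
  · rw [List.length_cons, List.length_eraseIdx, if_pos i.2]

/-! ### Fourier transforms of densities on the mass shell -/

/-- The Fourier transform of a density on the mass shell. -/
def shellTransform (s : ℝ) (D : Space → ℝ) (ζ : Spacetime) : ℂ :=
  ∫ q, exp (((s * mink ζ (shell q) : ℝ) : ℂ) * I) * (D q : ℂ)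

open FourierTransform

/-- The bilinear form in the exponent. -/
def phaseForm (s : ℝ) : Spacetime →L[ℝ] Spacetime →L[ℝ] ℝ := (-(s / (2 * Real.pi))) • minkL

theorem phaseForm_apply (s : ℝ) (p ζ : Spacetime) :
    (phaseForm s).toLinearMap₁₂ p ζ = -(s / (2 * Real.pi)) * mink ζ p := by
  rw [mink_comm]; rfl

theorem phaseForm_apply' (s : ℝ) (p ζ : Spacetime) :
    phaseForm s p ζ = -(s / (2 * Real.pi)) * mink ζ p := phaseForm_apply s p ζ

/-- Viewed as a Fourier integral over the push-forward of Lebesgue measure to the shell, the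
transform falls under the general differentiation theorem. The density is continued off the shell
through `spatial`, a left inverse of `shell`. -/
theorem shellTransform_eq {D : Space → ℝ} (hD : Measurable D) (s : ℝ) :
    shellTransform s D = VectorFourier.fourierIntegral 𝐞 (volume.map shell)
      (phaseForm s).toLinearMap₁₂ (fun p => (D (spatial p) : ℂ)) := by
  funext ζ
  rw [VectorFourier.fourierIntegral, integral_map continuous_shell.aemeasurable]
  · unfold shellTransform
    congr 1
    funext q
    rw [spatial_shell, Circle.smul_def, smul_eq_mul, Real.fourierChar_apply]
    congr 3
    rw [phaseForm_apply]
    field_simp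
  · refine Measurable.aestronglyMeasurable ?_
    simp only [Circle.smul_def, smul_eq_mul, Real.fourierChar_apply, phaseForm_apply]
    have h1 : Continuous fun p => mink ζ p := by fun_prop
    have := h1.measurable
    fun_prop

/-- Exponentially decaying densities on the mass shell with an integrable singularity. -/
def IsShellDensity (D : Space → ℝ) : Prop :=
  Measurable D ∧ ∃ C c, 0 < c ∧ ∀ q, |D q| ≤ C * (‖q‖⁻¹ ^ 2 * Real.exp (-(c * ‖q‖)))

theorem IsShellDensity.integrable_pow {D : Space → ℝ} (hD : IsShellDensity D) (n : ℕ) :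
    Integrable fun q => ‖q‖ ^ n * |D q| := by
  obtain ⟨hm, C, c, hc, hC⟩ := hD
  refine ((integrable_radial_exp hc n).const_mul C).mono' ?_ (Eventually.of_forall fun q => ?_)
  · exact Measurable.aestronglyMeasurable (by fun_prop)
  · rw [Real.norm_of_nonneg (by positivity)]
    calc ‖q‖ ^ n * |D q| ≤ ‖q‖ ^ n * (C * (‖q‖⁻¹ ^ 2 * Real.exp (-(c * ‖q‖)))) := by
          gcongr; exact hC q
      _ = _ := by ring

theorem IsShellDensity.integrable {D : Space → ℝ} (hD : IsShellDensity D) : Integrable D := by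
  have := hD.integrable_pow 0
  simp only [pow_zero, one_mul] at this
  exact (integrable_norm_iff hD.1.aestronglyMeasurable).1 this

theorem IsShellDensity.integrable_map {D : Space → ℝ} (hD : IsShellDensity D) (n : ℕ) :
    Integrable (fun p => ‖p‖ ^ n * ‖(D (spatial p) : ℂ)‖) (volume.map shell) := by
  have hm := hD.1
  rw [integrable_map_measure (Measurable.aestronglyMeasurable (by fun_prop))
    continuous_shell.aemeasurable]
  refine ((hD.integrable_pow n).const_mul (2 ^ n)).mono' ?_ (Eventually.of_forall fun q => ?_)
  · refine Measurable.aestronglyMeasurable ?_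
    have := continuous_shell.measurable
    simp only [Function.comp_def, spatial_shell]
    fun_prop
  · simp only [Function.comp_def, spatial_shell, Complex.norm_real, Real.norm_eq_abs]
    rw [abs_of_nonneg (by positivity), ← mul_assoc, ← mul_pow]
    gcongr
    exact norm_shell_le q

theorem IsShellDensity.aestronglyMeasurable_map {D : Space → ℝ} (hD : IsShellDensity D) :
    AEStronglyMeasurable (fun p => (D (spatial p) : ℂ)) (volume.map shell) := by
  have hm := hD.1
  exact Measurable.aestronglyMeasurable (by fun_prop)

theorem contDiff_shellTransform {D : Space → ℝ} (hD : IsShellDensity D) (s : ℝ) :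
    ContDiff ℝ (⊤ : ℕ∞) (shellTransform s D) := by
  rw [shellTransform_eq hD.1]
  exact VectorFourier.contDiff_fourierIntegral _ fun n _ => hD.integrable_map n

theorem iteratedFDeriv_shellTransform {D : Space → ℝ} (hD : IsShellDensity D) (s : ℝ) (m : ℕ) :
    iteratedFDeriv ℝ m (shellTransform s D) = VectorFourier.fourierIntegral 𝐞 (volume.map shell)
      (phaseForm s).toLinearMap₁₂
      (fun p => VectorFourier.fourierPowSMulRight (phaseForm s) (fun p => (D (spatial p) : ℂ)) p m) := by
  rw [shellTransform_eq hD.1]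
  exact VectorFourier.iteratedFDeriv_fourierIntegral (N := ⊤) _ (fun n _ => hD.integrable_map n)
    hD.aestronglyMeasurable_map le_top

theorem exists_norm_iteratedFDeriv_shellTransform_le {D : Space → ℝ} (hD : IsShellDensity D)
    (s : ℝ) (m : ℕ) : ∃ C, ∀ ζ, ‖iteratedFDeriv ℝ m (shellTransform s D) ζ‖ ≤ C := by
  rw [iteratedFDeriv_shellTransform hD]
  exact ⟨_, fun ζ => VectorFourier.norm_fourierIntegral_le_integral_norm _ _ _ _ _⟩

/-- Each derivative along `v i` brings down the factor `i s` times the Lorentz product of `v i` with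
the momentum; at the origin the phase is `1`. -/
theorem iteratedFDeriv_shellTransform_zero {D : Space → ℝ} (hD : IsShellDensity D) (s : ℝ) (m : ℕ)
    (v : Fin m → Spacetime) :
    iteratedFDeriv ℝ m (shellTransform s D) 0 v =
      (s * I) ^ m * ((∫ q, (∏ i, mink (v i) (shell q)) * D q : ℝ) : ℂ) := by
  rw [iteratedFDeriv_shellTransform hD, VectorFourier.fourierIntegral]
  simp only [map_zero, neg_zero, AddChar.map_zero_eq_one, one_smul]
  have hint := VectorFourier.integrable_fourierPowSMulRight (phaseForm s) (hD.integrable_map m)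
    hD.aestronglyMeasurable_map
  rw [ContinuousMultilinearMap.integral_apply hint, integral_map continuous_shell.aemeasurable]
  · rw [← integral_complex_ofReal, ← integral_const_mul]
    congr 1
    funext q
    rw [VectorFourier.fourierPowSMulRight_apply, spatial_shell]
    simp only [phaseForm_apply', smul_eq_mul, Complex.real_smul, Finset.prod_mul_distrib, Finset.prod_const, Finset.card_univ,
      Fintype.card_fin]
    push_cast
    rw [← mul_assoc, ← mul_assoc, ← mul_assoc, ← mul_pow]
    congr 3
    have : (Real.pi : ℂ) ≠ 0 := by exact_mod_cast Real.pi_ne_zero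
    field_simp
  · exact (ContinuousMultilinearMap.apply ℝ _ ℂ v).continuous.comp_aestronglyMeasurable hint.1

/-! ### The kernel of a reference state -/

/-- A finite measure on temperature vectors with support in the compact set `B ⊆ V₊`. -/
structure SupportedIn (ρ : Measure Spacetime) (B : Set Spacetime) : Prop where
  finite : IsFiniteMeasure ρ
  compact : IsCompact B
  subset : B ⊆ forwardCone
  null : ρ Bᶜ = 0

theorem SupportedIn.ae_mem {ρ : Measure Spacetime} {B : Set Spacetime} (h : SupportedIn ρ B) :
    ∀ᵐ β ∂ρ, β ∈ B := h.null

theorem SupportedIn.restrict {ρ : Measure Spacetime} {B : Set Spacetime} (h : SupportedIn ρ B) :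
    ρ.restrict B = ρ := Measure.restrict_eq_self_of_ae_mem h.ae_mem

theorem SupportedIn.integrable {E : Type*} [NormedAddCommGroup E] {ρ : Measure Spacetime}
    {B : Set Spacetime} (h : SupportedIn ρ B) {ψ : Spacetime → E} (hψ : ContinuousOn ψ forwardCone) :
    Integrable ψ ρ := by
  have := h.finite
  rw [← h.restrict]
  exact (hψ.mono h.subset).integrableOn_compact h.compact

/-- The momentum density of the normal ordered two-point function of a reference state. -/
def refDensity (ρ : Measure Spacetime) (q : Space) : ℝ :=
  (2 * Real.pi)⁻¹ ^ 3 * ((2 * ‖q‖)⁻¹ * ∫ β, bose (mink β (shell q)) ∂ρ)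

@[fun_prop]
theorem measurable_bose : Measurable bose := by unfold bose; fun_prop

theorem measurable_bose_mink :
    Measurable fun z : Spacetime × Space => bose (mink z.1 (shell z.2)) := by
  have h : Continuous fun z : Spacetime × Space => mink z.1 (shell z.2) := by fun_prop
  exact measurable_bose.comp h.measurable

theorem bose_mink_le {c : ℝ} (hc : 0 < c) {β : Spacetime} {q : Space} (hq : q ≠ 0)
    (h : c * ‖q‖ ≤ mink β (shell q)) :
    bose (mink β (shell q)) ≤ c⁻¹ * (‖q‖⁻¹ * Real.exp (-(c / 2 * ‖q‖))) := by
  have hq0 : 0 < ‖q‖ := norm_pos_iff.2 hq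
  refine (bose_le (mul_pos hc hq0) h).trans_eq ?_
  rw [mul_inv, mul_assoc]
  congr 4
  ring

/-- One factor `|q|⁻¹` stems from the invariant measure on the shell, the other one and the
exponential from the Bose function. -/
theorem SupportedIn.isShellDensity {ρ : Measure Spacetime} {B : Set Spacetime}
    (h : SupportedIn ρ B) : IsShellDensity (refDensity ρ) := by
  have := h.finite
  obtain ⟨c, hc, hcB⟩ := exists_cone_bound h.compact h.subset
  constructor
  · have := (measurable_bose_mink.stronglyMeasurable.integral_prod_left' (μ := ρ)).measurable
    unfold refDensity
    fun_prop
  · refine ⟨(2 * Real.pi)⁻¹ ^ 3 * (2⁻¹ * (c⁻¹ * ρ.real univ)), c / 2, by positivity, fun q => ?_⟩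
    rcases eq_or_ne q 0 with rfl | hq
    · simp [refDensity]
    have hq0 : 0 < ‖q‖ := norm_pos_iff.2 hq
    have h1 : |∫ β, bose (mink β (shell q)) ∂ρ| ≤
        c⁻¹ * (‖q‖⁻¹ * Real.exp (-(c / 2 * ‖q‖))) * ρ.real univ := by
      have hle : ∀ᵐ β ∂ρ, ‖bose (mink β (shell q))‖ ≤
          c⁻¹ * (‖q‖⁻¹ * Real.exp (-(c / 2 * ‖q‖))) := by
        filter_upwards [h.ae_mem] with β hβ
        rw [Real.norm_of_nonneg (bose_nonneg (mink_shell_pos (h.subset hβ) hq).le)]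
        exact bose_mink_le hc hq (hcB β hβ q)
      exact norm_integral_le_of_norm_le_const hle
    rw [refDensity, abs_mul, abs_of_nonneg (by positivity), abs_mul, abs_of_nonneg (by positivity)]
    calc _ ≤ (2 * Real.pi)⁻¹ ^ 3 * ((2 * ‖q‖)⁻¹ *
          (c⁻¹ * (‖q‖⁻¹ * Real.exp (-(c / 2 * ‖q‖))) * ρ.real univ)) := by gcongr
      _ = _ := by rw [mul_inv]; ring

/-- The kernel of the normal ordered two-point function of a reference state, as a function of
half the difference of the arguments. -/
def refKernel (ρ : Measure Spacetime) (ζ : Spacetime) : ℂ :=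
  shellTransform 2 (refDensity ρ) ζ + shellTransform (-2) (refDensity ρ) ζ

theorem SupportedIn.contDiff_refKernel {ρ : Measure Spacetime} {B : Set Spacetime}
    (h : SupportedIn ρ B) : ContDiff ℝ (⊤ : ℕ∞) (refKernel ρ) :=
  (contDiff_shellTransform h.isShellDensity 2).add (contDiff_shellTransform h.isShellDensity (-2))

theorem SupportedIn.iteratedFDeriv_refKernel {ρ : Measure Spacetime} {B : Set Spacetime}
    (h : SupportedIn ρ B) (m : ℕ) (ζ : Spacetime) : iteratedFDeriv ℝ m (refKernel ρ) ζ =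
      iteratedFDeriv ℝ m (shellTransform 2 (refDensity ρ)) ζ +
        iteratedFDeriv ℝ m (shellTransform (-2) (refDensity ρ)) ζ := by
  have h1 := contDiff_shellTransform h.isShellDensity 2
  have h2 := contDiff_shellTransform h.isShellDensity (-2)
  have hm : (m : WithTop ℕ∞) ≤ ((⊤ : ℕ∞) : WithTop ℕ∞) := by exact_mod_cast le_top
  exact iteratedFDeriv_add_apply (h1.of_le hm).contDiffAt (h2.of_le hm).contDiffAt

theorem SupportedIn.exists_bound_refKernel {ρ : Measure Spacetime} {B : Set Spacetime}
    (h : SupportedIn ρ B) (m : ℕ) : ∃ C, ∀ ζ, ‖iteratedFDeriv ℝ m (refKernel ρ) ζ‖ ≤ C := by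
  obtain ⟨C, hC⟩ := exists_norm_iteratedFDeriv_shellTransform_le h.isShellDensity 2 m
  obtain ⟨D, hD⟩ := exists_norm_iteratedFDeriv_shellTransform_le h.isShellDensity (-2) m
  refine ⟨C + D, fun ζ => ?_⟩
  rw [h.iteratedFDeriv_refKernel]
  exact (norm_add_le _ _).trans (add_le_add (hC ζ) (hD ζ))

/-- The expectation values of the balanced derivatives in a reference state. -/
def refTheta (ρ : Measure Spacetime) {m : ℕ} (v : Fin m → Spacetime) : ℂ :=
  iteratedFDeriv ℝ m (refKernel ρ) 0 v

/-- The two frequency parts of the kernel contribute with opposite signs of `i`, so odd orders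
cancel. -/
theorem SupportedIn.refTheta_eq {ρ : Measure Spacetime} {B : Set Spacetime}
    (h : SupportedIn ρ B) {m : ℕ} (v : Fin m → Spacetime) :
    refTheta ρ v = ((2 * I) ^ m + (-2 * I) ^ m) *
      ((∫ q, (∏ i, mink (v i) (shell q)) * refDensity ρ q : ℝ) : ℂ) := by
  rw [refTheta, h.iteratedFDeriv_refKernel, _root_.add_apply,
    iteratedFDeriv_shellTransform_zero h.isShellDensity,
    iteratedFDeriv_shellTransform_zero h.isShellDensity, ← add_mul]
  push_cast
  rfl

/-- The two test functions in a reference two-point function, in momentum space. -/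
def pairFT (f g : TestFn) (q : Space) : ℂ :=
  minkFT f (shell q) * minkFT g (-shell q) + minkFT f (-shell q) * minkFT g (shell q)

theorem continuous_pairFT (f g : TestFn) : Continuous (pairFT f g) := by
  unfold pairFT; fun_prop

theorem exists_pairFT_bound (f g : TestFn) : ∃ C, ∀ q, ‖pairFT f g q‖ ≤ C := by
  obtain ⟨C, hC0, hC⟩ := exists_minkFT_bound f 0
  obtain ⟨D, hD0, hD⟩ := exists_minkFT_bound g 0
  simp only [pow_zero, inv_one, mul_one] at hC hD
  refine ⟨C * D + C * D, fun q => (norm_add_le _ _).trans ?_⟩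
  rw [norm_mul, norm_mul]
  gcongr <;> first | exact hC _ | exact hD _

/-- The Bose function enters the positive energy half with sign `+` and the negative energy half
with sign `-`; the minus sign in `shellForm` makes both contributions add up. -/
theorem kmsForm_sub_vacForm {β : Spacetime} (hβ : β ∈ forwardCone) (f g : TestFn) :
    kmsForm β f g - vacForm f g = ((2 * Real.pi : ℝ) : ℂ)⁻¹ ^ 3 *
      ∫ q : Space, (((2 * ‖q‖)⁻¹ * bose (mink β (shell q)) : ℝ) : ℂ) * pairFT f g q := by
  obtain ⟨c, hc, hcB⟩ := exists_cone_bound (B := {β}) isCompact_singleton (by simpa using hβ)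
  have hsm : Measurable shell := continuous_shell.measurable
  have hI : ∀ {P : Space → Spacetime}, Measurable P →
      (∀ q, P q = shell q ∨ P q = -shell q) → Integrable fun q => formHalf (kmsFactor β) f g q (P q) :=
    fun hPm hP => integrable_formHalf (measurable_kmsFactor β) f g hPm hP
      fun q hq => norm_kmsFactor_le hc hq (hcB β rfl q) (hP q)
  have hJ : ∀ {P : Space → Spacetime}, Measurable P →
      (∀ q, P q = shell q ∨ P q = -shell q) → Integrable fun q => formHalf vacFactor f g q (P q) :=
    fun hPm hP => integrable_formHalf measurable_vacFactor f g hPm hP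
      fun q hq => norm_vacFactor_le _ q
  rw [kmsForm_eq, vacForm_eq, shellForm_eq_half, shellForm_eq_half, ← mul_sub,
    ← integral_sub]
  · congr 2
    funext q
    rcases eq_or_ne q 0 with rfl | hq
    · simp [formHalf]
    have hq0 : 0 < ‖q‖ := norm_pos_iff.2 hq
    have hs := mink_shell_pos hβ hq
    have h1 : kmsFactor β (shell q) = 1 + (bose (mink β (shell q)) : ℂ) := kms_factor_shell hs
    have h2 : kmsFactor β (-shell q) = -(bose (mink β (shell q)) : ℂ) := by
      rw [kmsFactor, mink_neg_right, Complex.ofReal_neg, neg_neg, kms_factor_neg_shell]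
    have h3 : vacFactor (shell q) = 1 := by
      rw [vacFactor, if_pos]; exact hq0
    have h4 : vacFactor (-shell q) = 0 := by
      rw [vacFactor, if_neg]
      simp
    simp only [formHalf, h1, h2, h3, h4, pairFT, neg_neg]
    push_cast
    ring
  · exact (hI hsm fun q => Or.inl rfl).sub (hI (P := fun q => -shell q) hsm.neg fun q => Or.inr rfl)
  · exact (hJ hsm fun q => Or.inl rfl).sub (hJ (P := fun q => -shell q) hsm.neg fun q => Or.inr rfl)

theorem SupportedIn.refNPoint_sub_vacForm {ρ : Measure Spacetime} {B : Set Spacetime}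
    (h : SupportedIn ρ B) [IsProbabilityMeasure ρ] (f g : TestFn) :
    refNPoint ρ [f, g] - vacForm f g = ∫ q, (refDensity ρ q : ℂ) * pairFT f g q := by
  obtain ⟨c, hc, hcB⟩ := exists_cone_bound h.compact h.subset
  obtain ⟨A, hA⟩ := exists_pairFT_bound f g
  have hA0 : 0 ≤ A := (norm_nonneg _).trans (hA 0)
  have hint : Integrable (fun z : Spacetime × Space =>
      (((2 * ‖z.2‖)⁻¹ * bose (mink z.1 (shell z.2)) : ℝ) : ℂ) * pairFT f g z.2)
      (ρ.prod volume) := by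
    -- On the support of `ρ` the integrand is bounded by `|q|⁻²` times an exponential, uniformly in
    -- `β`; with `ρ` finite this justifies Fubini.
    have hdom := ((integrable_radial_exp (half_pos hc) 0).const_mul (c⁻¹ * A)).comp_snd ρ
    refine hdom.mono' ?_ ?_
    · refine Measurable.aestronglyMeasurable ?_
      have h1 := measurable_bose_mink
      have h2 := (continuous_pairFT f g).measurable
      fun_prop
    · have := (Measure.quasiMeasurePreserving_fst (μ := ρ) (ν := (volume : Measure Space))).ae h.ae_mem
      filter_upwards [this] with z hz
      rcases eq_or_ne z.2 0 with hq | hq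
      · simp [hq]
      have hq0 : 0 < ‖z.2‖ := norm_pos_iff.2 hq
      have hb := bose_nonneg (mink_shell_pos (h.subset hz) hq).le
      rw [norm_mul, Complex.norm_real, Real.norm_of_nonneg (by positivity)]
      calc _ ≤ (‖z.2‖⁻¹ * (c⁻¹ * (‖z.2‖⁻¹ * Real.exp (-(c / 2 * ‖z.2‖))))) * A := by
            gcongr
            · linarith
            · exact bose_mink_le hc hq (hcB _ hz _)
            · exact hA _
        _ = _ := by ring
  have hvac : ∫ _, vacForm f g ∂ρ = vacForm f g := by simp
  simp only [refNPoint, wick_pair]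
  rw [← hvac, ← integral_sub (h.integrable (continuousOn_kmsForm f g)) (integrable_const _)]
  have : ∀ᵐ β ∂ρ, kmsForm β f g - vacForm f g = ((2 * Real.pi : ℝ) : ℂ)⁻¹ ^ 3 *
      ∫ q : Space, (((2 * ‖q‖)⁻¹ * bose (mink β (shell q)) : ℝ) : ℂ) * pairFT f g q := by
    filter_upwards [h.ae_mem] with β hβ using kmsForm_sub_vacForm (h.subset hβ) f g
  rw [integral_congr_ae this, integral_const_mul, integral_integral_swap hint,
    ← integral_const_mul]
  congr 1
  funext q
  rw [integral_mul_const, integral_complex_ofReal, integral_const_mul, refDensity]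
  push_cast
  ring

theorem integrable_phase {f : TestFn} (p : Spacetime) :
    Integrable fun x => f.1 x * exp (-I * (mink x p : ℂ)) := by
  have hc : Continuous fun x => f.1 x * exp (-I * (mink x p : ℂ)) := by
    have := f.2.1.continuous
    fun_prop
  exact hc.integrable_of_hasCompactSupport f.2.2.mul_right

theorem integrable_test (f : TestFn) : Integrable f.1 :=
  f.2.1.continuous.integrable_of_hasCompactSupport f.2.2

theorem norm_phase (t : ℝ) : ‖exp ((t : ℂ) * I)‖ = 1 := Complex.norm_exp_ofReal_mul_I t

/-- The integrand of the kernel of a reference state. -/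
def kernelIntegrand (D : Space → ℝ) (ζ : Spacetime) (q : Space) : ℂ :=
  exp (((2 * mink ζ (shell q) : ℝ) : ℂ) * I) * (D q : ℂ) +
    exp (((-2 * mink ζ (shell q) : ℝ) : ℂ) * I) * (D q : ℂ)

theorem measurable_kernelIntegrand {D : Space → ℝ} (hD : Measurable D) :
    Measurable (Function.uncurry (kernelIntegrand D)) := by
  have : Continuous fun z : Spacetime × Space => mink z.1 (shell z.2) := by fun_prop
  have := this.measurable
  simp only [kernelIntegrand, Function.uncurry_def]
  fun_prop

theorem norm_kernelIntegrand_le (D : Space → ℝ) (ζ : Spacetime) (q : Space) :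
    ‖kernelIntegrand D ζ q‖ ≤ 2 * |D q| := by
  refine (norm_add_le _ _).trans ?_
  rw [norm_mul, norm_mul, norm_phase, norm_phase, Complex.norm_real, Real.norm_eq_abs]
  linarith

theorem integral_kernelIntegrand {D : Space → ℝ} (hD : IsShellDensity D) (ζ : Spacetime) :
    ∫ q, kernelIntegrand D ζ q = shellTransform 2 D ζ + shellTransform (-2) D ζ := by
  have hDm := hD.1
  have hEi : ∀ s : ℝ, Integrable fun q => exp (((s * mink ζ (shell q) : ℝ) : ℂ) * I) *
      (D q : ℂ) := by
    intro s
    refine hD.integrable.norm.mono' ?_ (Eventually.of_forall fun q => ?_)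
    · have : Continuous fun q => mink ζ (shell q) := by fun_prop
      have := this.measurable
      exact Measurable.aestronglyMeasurable (by fun_prop)
    · rw [norm_mul, norm_phase, one_mul, Complex.norm_real]
  exact integral_add (hEi 2) (hEi (-2))

/-- The factor `2` in the exponent undoes the half in `ζ`, and the wave splits into plane waves in
`x₁` and `x₂`, which become Fourier transforms of the test functions. -/
theorem kernelIntegrand_half_sub (D : Space → ℝ) (x₁ x₂ : Spacetime) (q : Space) :
    kernelIntegrand D ((1 / 2 : ℝ) • (x₁ - x₂)) q = (D q : ℂ) *
      (exp (-I * (mink x₁ (-shell q) : ℂ)) * exp (-I * (mink x₂ (shell q) : ℂ)) +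
        exp (-I * (mink x₁ (shell q) : ℂ)) * exp (-I * (mink x₂ (-shell q) : ℂ))) := by
  have e1 : exp (((2 * mink ((1 / 2 : ℝ) • (x₁ - x₂)) (shell q) : ℝ) : ℂ) * I) =
      exp (-I * (mink x₁ (-shell q) : ℂ)) * exp (-I * (mink x₂ (shell q) : ℂ)) := by
    rw [← Complex.exp_add, mink_smul_left, mink_sub_left, mink_neg_right]
    congr 1; push_cast; ring
  have e2 : exp (((-2 * mink ((1 / 2 : ℝ) • (x₁ - x₂)) (shell q) : ℝ) : ℂ) * I) =
      exp (-I * (mink x₁ (shell q) : ℂ)) * exp (-I * (mink x₂ (-shell q) : ℂ)) := by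
    rw [← Complex.exp_add, mink_smul_left, mink_sub_left, mink_neg_right]
    congr 1; push_cast; ring
  rw [kernelIntegrand, e1, e2]
  ring

theorem integral_test_kernelIntegrand (D : Space → ℝ) (c : ℂ) (g : TestFn) (x₁ : Spacetime)
    (q : Space) : ∫ x₂, c * g.1 x₂ * kernelIntegrand D ((1 / 2 : ℝ) • (x₁ - x₂)) q =
      (D q : ℂ) * (c * exp (-I * (mink x₁ (shell q) : ℂ)) * minkFT g (-shell q) +
        c * exp (-I * (mink x₁ (-shell q) : ℂ)) * minkFT g (shell q)) := by
  have hpt : ∀ x₂, c * g.1 x₂ * kernelIntegrand D ((1 / 2 : ℝ) • (x₁ - x₂)) q =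
      ((D q : ℂ) * (c * exp (-I * (mink x₁ (-shell q) : ℂ)))) *
        (g.1 x₂ * exp (-I * (mink x₂ (shell q) : ℂ))) +
      ((D q : ℂ) * (c * exp (-I * (mink x₁ (shell q) : ℂ)))) *
        (g.1 x₂ * exp (-I * (mink x₂ (-shell q) : ℂ))) := by
    intro x₂
    rw [kernelIntegrand_half_sub]
    ring
  simp only [hpt]
  rw [integral_add ((integrable_phase _).const_mul _) ((integrable_phase _).const_mul _),
    integral_const_mul, integral_const_mul, minkFT, minkFT]
  ring

theorem integrable_test_kernelIntegrand {D : Space → ℝ} (hD : IsShellDensity D) (c : ℂ)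
    (g : TestFn) (x₁ : Spacetime) :
    Integrable (Function.uncurry fun (x₂ : Spacetime) (q : Space) =>
      c * g.1 x₂ * kernelIntegrand D ((1 / 2 : ℝ) • (x₁ - x₂)) q) (volume.prod volume) := by
  have hgc := g.2.1.continuous
  refine ((((integrable_test g).norm.const_mul ‖c‖).mul_prod (hD.integrable.norm.const_mul 2))).mono'
    ?_ (Eventually.of_forall fun z => ?_)
  · have h0 : Measurable fun z : Spacetime × Space => ((1 / 2 : ℝ) • (x₁ - z.1), z.2) := by
      fun_prop
    have h1 := (measurable_kernelIntegrand hD.1).comp h0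
    have h2 : Measurable fun z : Spacetime × Space => c * g.1 z.1 :=
      (hgc.measurable.comp measurable_fst).const_mul c
    exact (h2.mul h1).aestronglyMeasurable
  · simp only [Function.uncurry_def, norm_mul]
    exact mul_le_mul_of_nonneg_left (norm_kernelIntegrand_le _ _ _) (by positivity)

theorem integrable_test_minkFT {D : Space → ℝ} (hD : IsShellDensity D) (f g : TestFn) :
    Integrable (Function.uncurry fun (x : Spacetime) (q : Space) =>
      (D q : ℂ) * (f.1 x * exp (-I * (mink x (shell q) : ℂ)) * minkFT g (-shell q) +
        f.1 x * exp (-I * (mink x (-shell q) : ℂ)) * minkFT g (shell q)))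
      (volume.prod volume) := by
  have hDm := hD.1
  have hfc := f.2.1.continuous
  obtain ⟨A, hA0, hAb⟩ := exists_minkFT_bound g 0
  simp only [pow_zero, inv_one, mul_one] at hAb
  refine (((integrable_test f).norm.mul_prod (hD.integrable.norm.const_mul (2 * A)))).mono' ?_
    (Eventually.of_forall fun z => ?_)
  · have h1 : Continuous fun z : Spacetime × Space => f.1 z.1 *
        exp (-I * (mink z.1 (shell z.2) : ℂ)) * minkFT g (-shell z.2) +
        f.1 z.1 * exp (-I * (mink z.1 (-shell z.2) : ℂ)) * minkFT g (shell z.2) := by fun_prop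
    have h3 : Measurable fun z : Spacetime × Space => (D z.2 : ℂ) := by fun_prop
    exact (h3.mul h1.measurable).aestronglyMeasurable
  · have hph : ∀ p : Spacetime, ‖exp (-I * (mink z.1 p : ℂ))‖ = 1 := fun p => by
      rw [show -I * (mink z.1 p : ℂ) = ((-mink z.1 p : ℝ) : ℂ) * I by push_cast; ring, norm_phase]
    simp only [Function.uncurry_def]
    rw [norm_mul, Complex.norm_real, Real.norm_eq_abs]
    calc |D z.2| * _ ≤ |D z.2| * (‖f.1 z.1‖ * A + ‖f.1 z.1‖ * A) := by
          gcongr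
          refine (norm_add_le _ _).trans ?_
          simp only [norm_mul, hph, mul_one]
          gcongr <;> exact hAb _
      _ = _ := by ring

/-- Two exchanges of integrals, first with `x₂` and then with `x₁`, move the momentum integral
outside, where the test functions appear through their Fourier transforms. -/
theorem SupportedIn.refNPoint_kernel {ρ : Measure Spacetime} {B : Set Spacetime}
    (h : SupportedIn ρ B) [IsProbabilityMeasure ρ] (f g : TestFn) :
    refNPoint ρ [f, g] - vacForm f g =
      ∫ x₁, ∫ x₂, f.1 x₁ * g.1 x₂ * refKernel ρ ((1 / 2 : ℝ) • (x₁ - x₂)) := by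
  have hD := h.isShellDensity
  simp only [refKernel, ← integral_kernelIntegrand hD, ← integral_const_mul]
  simp only [fun x₁ => integral_integral_swap (integrable_test_kernelIntegrand hD (f.1 x₁) g x₁),
    integral_test_kernelIntegrand]
  rw [integral_integral_swap (integrable_test_minkFT hD f g), h.refNPoint_sub_vacForm]
  congr 1
  funext q
  rw [integral_const_mul, integral_add ((integrable_phase _).mul_const _)
    ((integrable_phase _).mul_const _), integral_mul_const, integral_mul_const]
  rfl

/-- A reference state is in the domain of all balanced derivatives. -/
theorem SupportedIn.hasThetaValue {ρ : Measure Spacetime} {B : Set Spacetime}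
    (h : SupportedIn ρ B) [IsProbabilityMeasure ρ] (x : Spacetime) {m : ℕ} (μ : Fin m → Fin 4) :
    HasThetaValue (fun f g => refNPoint ρ [f, g]) x μ
      (refTheta ρ fun i => eta (μ i) • basisVec (μ i)) := by
  have hs := h.contDiff_refKernel
  have hcont : ∀ m : ℕ, Continuous (iteratedFDeriv ℝ m (refKernel ρ)) := fun m =>
    hs.continuous_iteratedFDeriv (by exact_mod_cast le_top)
  refine ⟨univ, fun _ => refKernel ρ, isOpen_univ, mem_univ _, ⟨fun _ _ _ _ => hs.contDiffAt,
    fun m => ?_, fun f g _ => h.refNPoint_kernel f g⟩, ?_, ?_⟩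
  · exact ((hcont m).comp continuous_snd).continuousOn
  · obtain ⟨C, hC⟩ := h.exists_bound_refKernel m
    exact ⟨C, fun q _ _ => hC _⟩
  · have := ((ContinuousMultilinearMap.apply ℝ (fun _ : Fin m => Spacetime) ℂ
      fun i => eta (μ i) • basisVec (μ i)).continuous.comp (hcont m)).tendsto 0
    exact this.mono_left nhdsWithin_le_nhds

/-! ### Polar coordinates on the mass shell -/

/-- The unit sphere of directions. -/
abbrev Sphere : Type := Metric.sphere (0 : Space) 1

/-- The surface measure. -/
abbrev sphereMeasure : Measure Sphere := (volume : Measure Space).toSphere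

/-- The light-like vector `(1, 𝐧)`. -/
def ray (n : Sphere) : Spacetime := shell n

@[fun_prop]
theorem continuous_ray : Continuous ray := continuous_shell.comp continuous_subtype_val

theorem sphere_ne_zero (n : Sphere) : (n : Space) ≠ 0 := ne_zero_of_mem_unit_sphere n

theorem norm_sphere (n : Sphere) : ‖(n : Space)‖ = 1 := norm_eq_of_mem_sphere n

theorem mink_ray_pos {β : Spacetime} (h : β ∈ forwardCone) (n : Sphere) : 0 < mink β (ray n) :=
  mink_shell_pos h (sphere_ne_zero n)

theorem shell_eq_ray {q : Space} (hq : q ≠ 0) :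
    ∃ n : Sphere, shell q = ‖q‖ • ray n := by
  have hq0 : 0 < ‖q‖ := norm_pos_iff.2 hq
  refine ⟨⟨‖q‖⁻¹ • q, by simp [norm_smul, hq0.ne']⟩, ?_⟩
  rw [ray, ← shell_smul hq0.le, smul_smul, mul_inv_cancel₀ hq0.ne', one_smul]

/-- The origin is a null set, and the punctured space is homeomorphic to sphere times half-line; the
radial measure has density `r²`. -/
theorem integral_polar {F : Space → ℝ} (hF : Integrable F) :
    ∫ q, F q = ∫ n : Sphere, ∫ r in Ioi (0 : ℝ), r ^ 2 * F (r • (n : Space)) ∂volume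
      ∂sphereMeasure := by
  have hmp := (volume : Measure Space).measurePreserving_homeomorphUnitSphereProd
  have hdim : Module.finrank ℝ Space - 1 = 2 := by simp
  rw [hdim] at hmp
  have hemb := (homeomorphUnitSphereProd Space).measurableEmbedding
  have hc : ∀ q : ({0}ᶜ : Set Space), F q = (fun z : Sphere × Ioi (0 : ℝ) =>
      F (z.2.1 • (z.1 : Space))) (homeomorphUnitSphereProd Space q) := by
    intro q
    have : (q : Space) = (homeomorphUnitSphereProd Space).symm
      (homeomorphUnitSphereProd Space q) := by simp
    conv_lhs => rw [this]
    rw [homeomorphUnitSphereProd_symm_apply_coe]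
  have h1 : ∫ q, F q = ∫ q : ({0}ᶜ : Set Space), F q ∂(volume.comap Subtype.val) := by
    rw [integral_subtype_comap (measurableSet_singleton _).compl F, restrict_compl_singleton]
  have hint : Integrable (fun z : Sphere × Ioi (0 : ℝ) => F (z.2.1 • (z.1 : Space)))
      (sphereMeasure.prod (Measure.volumeIoiPow 2)) := by
    rw [← hmp.integrable_comp_emb hemb]
    have h2 : IntegrableOn F ({0}ᶜ : Set Space) := hF.integrableOn
    rw [integrableOn_iff_comap_subtypeVal (measurableSet_singleton _).compl] at h2
    exact h2.congr (Eventually.of_forall hc)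
  rw [h1, integral_congr_ae (Eventually.of_forall hc)]
  refine (hmp.integral_comp hemb (fun z : Sphere × Ioi (0 : ℝ) =>
    F (z.2.1 • (z.1 : Space)))).trans ?_
  rw [integral_prod _ hint]
  congr 1
  funext n
  rw [Measure.volumeIoiPow, integral_withDensity_eq_integral_toReal_smul (by fun_prop)
    (Eventually.of_forall fun _ => ENNReal.ofReal_lt_top),
    ← integral_subtype_comap measurableSet_Ioi (fun r : ℝ => r ^ 2 * F (r • (n : Space)))]
  congr 1
  funext r
  rw [ENNReal.toReal_ofReal (by positivity), smul_eq_mul]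

/-- The radial integral of the Bose-Einstein function. -/
def boseMoment (m : ℕ) : ℝ := ∫ r in Ioi (0 : ℝ), r ^ (m + 1) * bose r

theorem integrableOn_boseMoment (m : ℕ) :
    IntegrableOn (fun r => r ^ (m + 1) * bose r) (Ioi (0 : ℝ)) := by
  have h := integrableOn_rpow_mul_exp_neg_mul_rpow (s := m) (p := 1) (b := 1 / 2) (by
    have : (0 : ℝ) ≤ m := by positivity
    linarith) one_pos (by norm_num)
  refine h.mono' (Measurable.aestronglyMeasurable (by fun_prop)) ?_
  filter_upwards [ae_restrict_mem measurableSet_Ioi] with r hr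
  have hr : 0 < r := hr
  have := bose_nonneg hr.le
  rw [Real.norm_of_nonneg (by positivity), Real.rpow_natCast, Real.rpow_one]
  calc r ^ (m + 1) * bose r ≤ r ^ (m + 1) * (r⁻¹ * Real.exp (-(r / 2))) := by
        gcongr; exact bose_le hr le_rfl
    _ = r ^ m * Real.exp (-(1 / 2) * r) := by
        rw [pow_succ, show -(1 / 2) * r = -(r / 2) by ring]; field_simp

theorem boseMoment_pos (m : ℕ) : 0 < boseMoment m := by
  refine (setIntegral_pos_iff_support_of_nonneg_ae ?_ (integrableOn_boseMoment m)).2 ?_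
  · filter_upwards [ae_restrict_mem measurableSet_Ioi] with r hr
    have hr : 0 < r := hr
    have := bose_nonneg hr.le
    simp only [Pi.zero_apply]
    positivity
  · have : Ioi (0 : ℝ) ⊆ Function.support (fun r => r ^ (m + 1) * bose r) ∩ Ioi 0 := fun r hr =>
      ⟨(mul_pos (pow_pos hr _) (bose_pos hr)).ne', hr⟩
    refine lt_of_lt_of_le ?_ (measure_mono this)
    simp

/-- Substitution of `r s` for `r`; the whole dependence on the temperature is a power of `s`. -/
theorem integral_bose_scaled (m : ℕ) {s : ℝ} (hs : 0 < s) :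
    ∫ r in Ioi (0 : ℝ), r ^ (m + 1) * bose (r * s) = boseMoment m * (s ^ (m + 2))⁻¹ := by
  have h := integral_comp_mul_right_Ioi (fun r => r ^ (m + 1) * bose r) 0 hs
  simp only [zero_mul, smul_eq_mul, mul_pow] at h
  have h2 : ∀ r : ℝ, r ^ (m + 1) * bose (r * s) =
      (s ^ (m + 1))⁻¹ * (r ^ (m + 1) * s ^ (m + 1) * bose (r * s)) := by
    intro r; field_simp
  simp only [h2]
  rw [integral_const_mul, h, boseMoment, pow_succ s (m + 1), mul_inv]
  ring

/-- The spherical average that represents the thermal functions of the balanced derivatives. -/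
def sphereMoment {m : ℕ} (v : Fin m → Spacetime) (β : Spacetime) : ℝ :=
  ∫ n : Sphere, (∏ i, mink (v i) (ray n)) * (mink β (ray n) ^ (m + 2))⁻¹ ∂sphereMeasure

theorem abs_prod_mink_shell_le {m : ℕ} (v : Fin m → Spacetime) (q : Space) :
    |∏ i, mink (v i) (shell q)| ≤ (∏ i, ‖minkL‖ * ‖v i‖ * 2) * ‖q‖ ^ m := by
  rw [Finset.abs_prod]
  calc ∏ i, |mink (v i) (shell q)| ≤ ∏ i, (‖minkL‖ * ‖v i‖ * 2 * ‖q‖) := by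
        refine Finset.prod_le_prod (fun _ _ => abs_nonneg _) fun i _ => ?_
        refine (abs_mink_le _ _).trans ?_
        rw [mul_assoc _ 2]
        gcongr
        exact norm_shell_le q
    _ = _ := by rw [Finset.prod_mul_distrib]; simp

/-- By homogeneity the powers of `r` are `r²` from the volume, `r^m` from the product and `r⁻¹` from
the density, which leaves `r^(m+1)` against the Bose function of `r βn`. -/
theorem integral_shell_moment {m : ℕ} (v : Fin m → Spacetime) {β : Spacetime}
    (hβ : β ∈ forwardCone) :
    ∫ q : Space, (∏ i, mink (v i) (shell q)) * (‖q‖⁻¹ * bose (mink β (shell q))) =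
      boseMoment m * sphereMoment v β := by
  obtain ⟨c, hc, hcB⟩ := exists_cone_bound (B := {β}) isCompact_singleton (by simpa using hβ)
  rw [integral_polar, sphereMoment, ← integral_const_mul]
  · congr 1
    funext n
    have hs := mink_ray_pos hβ n
    have : ∀ r ∈ Ioi (0 : ℝ), r ^ 2 * ((∏ i, mink (v i) (shell (r • (n : Space)))) *
        (‖r • (n : Space)‖⁻¹ * bose (mink β (shell (r • (n : Space)))))) =
        (∏ i, mink (v i) (ray n)) * (r ^ (m + 1) * bose (r * mink β (ray n))) := by
      intro r hr
      have hr : 0 < r := hr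
      rw [shell_smul hr.le, norm_smul, norm_sphere, Real.norm_of_nonneg hr.le, mink_smul_right]
      simp only [mink_smul_right, Finset.prod_mul_distrib, Finset.prod_const, Finset.card_univ,
        Fintype.card_fin]
      rw [ray]
      field_simp
      ring
    rw [setIntegral_congr_fun measurableSet_Ioi this, integral_const_mul,
      integral_bose_scaled m hs]
    ring
  · refine ((integrable_radial_exp (half_pos hc) m).const_mul
      ((∏ i, ‖minkL‖ * ‖v i‖ * 2) * c⁻¹)).mono' ?_ (Eventually.of_forall fun q => ?_)
    · have h1 : Continuous fun q => ∏ i, mink (v i) (shell q) := by fun_prop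
      have h2 : Continuous fun q => mink β (shell q) := by fun_prop
      have := h1.measurable
      have := h2.measurable
      exact Measurable.aestronglyMeasurable (by fun_prop)
    · rcases eq_or_ne q 0 with rfl | hq
      · simp
      have hq0 : 0 < ‖q‖ := norm_pos_iff.2 hq
      have hb := bose_nonneg (mink_shell_pos hβ hq).le
      rw [norm_mul, Real.norm_eq_abs, Real.norm_of_nonneg (by positivity)]
      calc _ ≤ ((∏ i, ‖minkL‖ * ‖v i‖ * 2) * ‖q‖ ^ m) *
            (‖q‖⁻¹ * (c⁻¹ * (‖q‖⁻¹ * Real.exp (-(c / 2 * ‖q‖))))) := by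
            gcongr
            · exact abs_prod_mink_shell_le v q
            · exact bose_mink_le hc hq (hcB _ rfl _)
        _ = _ := by ring

/-- The numerical factor in the thermal functions. -/
def thetaConst (m : ℕ) : ℂ :=
  ((2 * I) ^ m + (-2 * I) ^ m) * (((2 * Real.pi)⁻¹ ^ 3 * (2⁻¹ * boseMoment m) : ℝ) : ℂ)

/-- Even orders are thus available for recovering moments; odd orders are useless since the constant
is zero there. -/
theorem thetaConst_ne_zero (k : ℕ) : thetaConst (2 * k) ≠ 0 := by
  have hb := boseMoment_pos (2 * k)
  have h1 : (2 * I) ^ (2 * k) + (-2 * I) ^ (2 * k) = 2 * (-4 : ℂ) ^ k := by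
    have e1 : (2 * I) ^ 2 = -4 := by rw [mul_pow, I_sq]; norm_num
    have e2 : (-2 * I) ^ 2 = -4 := by rw [mul_pow, I_sq]; norm_num
    rw [pow_mul, pow_mul, e1, e2]
    ring
  rw [thetaConst, h1]
  refine mul_ne_zero (mul_ne_zero two_ne_zero (pow_ne_zero _ (by norm_num))) ?_
  exact_mod_cast (by positivity : 0 < (2 * Real.pi)⁻¹ ^ 3 * (2⁻¹ * boseMoment (2 * k))).ne'

theorem SupportedIn.refTheta_eq_integral {ρ : Measure Spacetime} {B : Set Spacetime}
    (h : SupportedIn ρ B) {m : ℕ} (v : Fin m → Spacetime) :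
    refTheta ρ v = thetaConst m * ((∫ β, sphereMoment v β ∂ρ : ℝ) : ℂ) := by
  have := h.finite
  obtain ⟨c, hc, hcB⟩ := exists_cone_bound h.compact h.subset
  rw [h.refTheta_eq, thetaConst, mul_assoc, ← Complex.ofReal_mul]
  congr 2
  have hint : Integrable (Function.uncurry fun (β : Spacetime) (q : Space) =>
      (∏ i, mink (v i) (shell q)) * (‖q‖⁻¹ * bose (mink β (shell q)))) (ρ.prod volume) := by
    refine (((integrable_radial_exp (half_pos hc) m).const_mul
      ((∏ i, ‖minkL‖ * ‖v i‖ * 2) * c⁻¹)).comp_snd ρ).mono' ?_ ?_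
    · have h1 : Continuous fun q => ∏ i, mink (v i) (shell q) := by fun_prop
      have h2 := measurable_bose_mink
      have := h1.measurable
      refine Measurable.aestronglyMeasurable ?_
      simp only [Function.uncurry_def]
      fun_prop
    · have := (Measure.quasiMeasurePreserving_fst (μ := ρ) (ν := (volume : Measure Space))).ae
        h.ae_mem
      filter_upwards [this] with z hz
      simp only [Function.uncurry_def]
      rcases eq_or_ne z.2 0 with hq | hq
      · simp [hq]
      have hq0 : 0 < ‖z.2‖ := norm_pos_iff.2 hq
      have hb := bose_nonneg (mink_shell_pos (h.subset hz) hq).le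
      rw [norm_mul, Real.norm_eq_abs, Real.norm_of_nonneg (by positivity)]
      calc _ ≤ ((∏ i, ‖minkL‖ * ‖v i‖ * 2) * ‖z.2‖ ^ m) *
            (‖z.2‖⁻¹ * (c⁻¹ * (‖z.2‖⁻¹ * Real.exp (-(c / 2 * ‖z.2‖))))) := by
            gcongr
            · exact abs_prod_mink_shell_le v _
            · exact bose_mink_le hc hq (hcB _ hz _)
        _ = _ := by ring
  have h1 : ∫ β, boseMoment m * sphereMoment v β ∂ρ =
      ∫ β, (∫ q : Space, (∏ i, mink (v i) (shell q)) * (‖q‖⁻¹ * bose (mink β (shell q)))) ∂ρ := by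
    refine integral_congr_ae ?_
    filter_upwards [h.ae_mem] with β hβ using (integral_shell_moment v (h.subset hβ)).symm
  rw [mul_assoc, mul_assoc, ← integral_const_mul (boseMoment m), h1, integral_integral_swap hint,
    ← integral_const_mul, ← integral_const_mul]
  congr 1
  funext q
  rw [integral_const_mul, integral_const_mul, refDensity, mul_inv]
  ring

/-! ### Functionals on light-like directions -/

theorem integral_continuous_mul_sub {a : Sphere → ℝ} (ha : Continuous a) {u : Sphere → ℝ}
    (hu : Continuous u) : Integrable (fun n => a n * u n) sphereMeasure :=
  (ha.mul hu).integrable_of_hasCompactSupport (HasCompactSupport.of_compactSpace _)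

/-- A continuous function on the sphere that is orthogonal to all products of the functions
`n ↦ ray n μ` vanishes. -/
theorem eq_zero_of_integral_prod_eq_zero {u : Sphere → ℝ} (hu : Continuous u)
    (h : ∀ (d : ℕ) (v : ℕ → Fin 4),
      ∫ n, (∏ i ∈ Finset.range d, ray n (v i)) * u n ∂sphereMeasure = 0) :
    ∀ n, u n = 0 := by
  -- The span of the products is the algebra generated by the coordinates of `ray n`. The spatial
  -- coordinates separate points, so Stone-Weierstrass makes this algebra dense.
  let gen : Set C(Sphere, ℝ) := range fun μ : Fin 4 => ⟨fun n => ray n μ, by fun_prop⟩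
  have hmono : ∀ a ∈ Submonoid.closure gen, ∃ (d : ℕ) (v : ℕ → Fin 4),
      ∀ n, a n = ∏ i ∈ Finset.range d, ray n (v i) := by
    intro a ha
    induction ha using Submonoid.closure_induction with
    | mem a ha =>
      obtain ⟨v, rfl⟩ := ha
      exact ⟨1, fun _ => v, fun n => by simp; rfl⟩
    | one => exact ⟨0, fun _ => 0, fun n => by simp⟩
    | mul a b _ _ ha hb =>
      obtain ⟨d, v, hv⟩ := ha
      obtain ⟨e, w, hw⟩ := hb
      refine ⟨d + e, fun i => if i < d then v i else w (i - d), fun n => ?_⟩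
      rw [Finset.prod_range_add, ContinuousMap.mul_apply, hv, hw]
      congr 1
      · exact Finset.prod_congr rfl fun i hi => by simp [Finset.mem_range.1 hi]
      · exact Finset.prod_congr rfl fun i _ => by simp
  have hspan : ∀ a ∈ Algebra.adjoin ℝ gen, ∫ n, a n * u n ∂sphereMeasure = 0 := by
    intro a ha
    rw [← Subalgebra.mem_toSubmodule, Algebra.adjoin_eq_span] at ha
    induction ha using Submodule.span_induction with
    | mem a ha =>
      obtain ⟨d, v, hv⟩ := hmono a ha
      simp only [hv, h]
    | zero => simp
    | add a b _ _ ha hb =>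
      simp only [ContinuousMap.add_apply, add_mul]
      rw [integral_add (integral_continuous_mul_sub a.continuous hu)
        (integral_continuous_mul_sub b.continuous hu), ha, hb, add_zero]
    | smul c a _ ha =>
      simp only [ContinuousMap.smul_apply, smul_eq_mul, mul_assoc]
      rw [integral_const_mul, ha, mul_zero]
  have hsep : (Algebra.adjoin ℝ gen).SeparatesPoints := by
    intro n n' hne
    by_contra hcon
    push Not at hcon
    refine hne (Subtype.ext ?_)
    have hv : ∀ μ, ray n μ = ray n' μ := fun μ =>
      hcon (fun n => ray n μ) ⟨⟨fun n => ray n μ, by fun_prop⟩,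
        Algebra.subset_adjoin ⟨μ, rfl⟩, rfl⟩
    ext i
    have := hv i.succ
    rwa [ray, ray, shell_succ, shell_succ] at this
  have htop := ContinuousMap.subalgebra_topologicalClosure_eq_top_of_separatesPoints _ hsep
  let U : C(Sphere, ℝ) := ⟨u, hu⟩
  have hU : U ∈ (Algebra.adjoin ℝ gen).topologicalClosure := by rw [htop]; trivial
  have hclosed : IsClosed {a : C(Sphere, ℝ) | ∫ n, a n * u n ∂sphereMeasure = 0} := by
    refine isClosed_eq ?_ continuous_const
    refine continuous_iff_continuousAt.2 fun a₀ => ?_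
    refine continuousAt_of_dominated (bound := fun n => (‖a₀‖ + 1) * |u n|) ?_ ?_ ?_ ?_
    · exact Eventually.of_forall fun a => (integral_continuous_mul_sub a.continuous hu).1
    · have : ∀ᶠ a in 𝓝 a₀, ‖a‖ < ‖a₀‖ + 1 :=
        continuous_norm.continuousAt.eventually (gt_mem_nhds (lt_add_one _))
      filter_upwards [this] with a ha
      refine Eventually.of_forall fun n => ?_
      rw [norm_mul, Real.norm_eq_abs (u n)]
      gcongr
      exact (a.norm_coe_le_norm n).trans ha.le
    · exact ((continuous_abs.comp hu).const_mul _).integrable_of_hasCompactSupport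
        (HasCompactSupport.of_compactSpace _)
    · refine Eventually.of_forall fun n => ?_
      exact ((continuous_eval_const n).mul continuous_const).continuousAt
  -- By density `u` is orthogonal to itself; continuity and positivity of the surface measure on
  -- open sets then give `u = 0` everywhere.
  have hz : ∫ n, u n * u n ∂sphereMeasure = 0 := by
    have hsub : ((Algebra.adjoin ℝ gen).topologicalClosure : Set C(Sphere, ℝ)) ⊆
        {a : C(Sphere, ℝ) | ∫ n, a n * u n ∂sphereMeasure = 0} := by
      rw [Subalgebra.topologicalClosure_coe]
      exact closure_minimal hspan hclosed
    exact hsub hU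
  have h0 : (fun n => u n * u n) =ᵐ[sphereMeasure] 0 :=
    (integral_eq_zero_iff_of_nonneg (fun n => mul_self_nonneg _)
      (integral_continuous_mul_sub hu hu)).1 hz
  have h1 := (Continuous.ae_eq_iff_eq sphereMeasure (hu.mul hu) continuous_zero).1 h0
  intro n
  exact mul_self_eq_zero.1 (congrFun h1 n)

/-- Linear functionals on functions of `β n`, with `n` a light-like direction, that vanish on the
thermal functions of the balanced derivatives, vanish. -/
theorem functional_eq_zero {a b : ℝ} (ha : 0 < a) (hab : a ≤ b) (Λ : (ℝ → ℝ) → Sphere → ℝ) (C : ℝ)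
    (hadd : ∀ φ χ, ContinuousOn φ (Ioi 0) → ContinuousOn χ (Ioi 0) →
      ∀ n, Λ (fun s => φ s + χ s) n = Λ φ n + Λ χ n)
    (hsmul : ∀ φ, ContinuousOn φ (Ioi 0) → ∀ (c : ℝ) n, Λ (fun s => c * φ s) n = c * Λ φ n)
    (hbound : ∀ φ, ContinuousOn φ (Ioi 0) → ∀ ε, (∀ s ∈ Icc a b, |φ s| ≤ ε) →
      ∀ n, |Λ φ n| ≤ C * ε)
    (hcont : ∀ φ, ContinuousOn φ (Ioi 0) → Continuous (Λ φ))
    (hzero : ∀ (k : ℕ) (v : ℕ → Fin 4),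
      ∫ n, (∏ i ∈ Finset.range (2 * k + 1), ray n (v i)) *
        Λ (fun s => (s ^ (2 * k + 4))⁻¹) n ∂sphereMeasure = 0)
    {φ : ℝ → ℝ} (hφ : ContinuousOn φ (Ioi 0)) (n : Sphere) : Λ φ n = 0 := by
  revert n
  refine eq_zero_of_integral_prod_eq_zero (hcont φ hφ) fun d v => ?_
  set P : Sphere → ℝ := fun n => ∏ i ∈ Finset.range d, ray n (v i) with hP
  have hPc : Continuous P := by fun_prop
  have hpow : ∀ j : ℕ, ContinuousOn (fun s : ℝ => (s ^ j)⁻¹) (Ioi 0) := fun j =>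
    (continuous_pow j).continuousOn.inv₀ fun s hs => (pow_pos (show (0 : ℝ) < s from hs) j).ne'
  -- The hypothesis is used with `2 (d + i) + 1 ≥ d` indices. The surplus ones are set to zero and
  -- contribute the time component `1` of `ray n`, so the same monomial `P` occurs with all these
  -- powers.
  have hmom : ∀ i : ℕ, ∫ n, P n * Λ (fun s => (s ^ (2 * (d + i) + 4))⁻¹) n ∂sphereMeasure = 0 := by
    intro i
    have := hzero (d + i) fun j => if j < d then v j else 0
    rw [← this]
    congr 1
    funext n
    congr 1
    rw [show 2 * (d + i) + 1 = d + (d + 2 * i + 1) by ring, Finset.prod_range_add]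
    have h1 : ∏ j ∈ Finset.range (d + 2 * i + 1),
        ray n (if d + j < d then v (d + j) else 0) = 1 := by
      refine Finset.prod_eq_one fun j _ => ?_
      rw [if_neg (by omega), ray, shell_zero_coord, norm_sphere]
    rw [h1, mul_one]
    exact Finset.prod_congr rfl fun j hj => by rw [if_pos (Finset.mem_range.1 hj)]
  have hsum : ∀ (c : ℕ → ℝ) (t : Finset ℕ),
      ContinuousOn (fun s => ∑ i ∈ t, c i * (s ^ (2 * (d + i) + 4))⁻¹) (Ioi 0) ∧
      ∫ n, P n * Λ (fun s => ∑ i ∈ t, c i * (s ^ (2 * (d + i) + 4))⁻¹) n ∂sphereMeasure = 0 := by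
    intro c t
    induction t using Finset.induction_on with
    | empty =>
      refine ⟨by simpa using continuousOn_const, ?_⟩
      have : ∀ n, Λ (fun _ => 0) n = 0 := fun n => by
        have := hsmul (fun _ => 0) continuousOn_const 0 n
        simpa using this
      simp [this]
    | insert i t hi ih =>
      simp only [Finset.sum_insert hi]
      have hc1 : ContinuousOn (fun s : ℝ => c i * (s ^ (2 * (d + i) + 4))⁻¹) (Ioi 0) :=
        continuousOn_const.mul (hpow _)
      refine ⟨hc1.add ih.1, ?_⟩
      have e : ∀ n, P n * Λ (fun s => c i * (s ^ (2 * (d + i) + 4))⁻¹ +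
          ∑ x ∈ t, c x * (s ^ (2 * (d + x) + 4))⁻¹) n =
          c i * (P n * Λ (fun s => (s ^ (2 * (d + i) + 4))⁻¹) n) +
            P n * Λ (fun s => ∑ x ∈ t, c x * (s ^ (2 * (d + x) + 4))⁻¹) n := fun n => by
        rw [hadd _ _ hc1 ih.1 n, hsmul _ (hpow _)]; ring
      rw [integral_congr_ae (Eventually.of_forall e), integral_add, ih.2, add_zero,
        integral_const_mul, hmom, mul_zero]
      · exact (integral_continuous_mul_sub hPc (hcont _ (hpow _))).const_mul _
      · exact integral_continuous_mul_sub hPc (hcont _ ih.1)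
  have hb : 0 < b := ha.trans_le hab
  by_contra hne
  set J := |∫ n, P n * Λ φ n ∂sphereMeasure|
  have hJ : 0 < J := abs_pos.2 hne
  set M := |C| * (a ^ (2 * d + 4))⁻¹ * ∫ n, |P n| ∂sphereMeasure
  have hM : 0 ≤ M := by positivity
  -- With this choice `M ε ≤ J / 2`, which will contradict `J ≤ M ε`. The summand `1` guards against
  -- `M = 0`.
  set ε := J / (2 * (M + 1))
  have hε : 0 < ε := by positivity
  -- In the variable `t = s⁻²` the available powers are `t^(d+2)` times `t^i`. The function
  -- approximated by polynomials is therefore `φ` divided by `t^(d+2)`.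
  have hrt : ContinuousOn (fun t : ℝ => φ ((√t)⁻¹) * (t ^ (d + 2))⁻¹)
      (Icc ((b ^ 2)⁻¹) ((a ^ 2)⁻¹)) := by
    have hpos : ∀ t ∈ Icc ((b ^ 2)⁻¹) ((a ^ 2)⁻¹), 0 < t := fun t ht =>
      (by positivity : 0 < (b ^ 2)⁻¹).trans_le ht.1
    refine (hφ.comp ?_ fun t ht => ?_).mul ?_
    · exact Real.continuous_sqrt.continuousOn.inv₀ fun t ht => (Real.sqrt_pos.2 (hpos t ht)).ne'
    · exact inv_pos.2 (Real.sqrt_pos.2 (hpos t ht))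
    · exact (continuous_pow _).continuousOn.inv₀ fun t ht => (pow_pos (hpos t ht) _).ne'
  obtain ⟨p, hp⟩ := exists_polynomial_near_of_continuousOn _ _ _ hrt ε hε
  set χ : ℝ → ℝ := fun s => ∑ i ∈ Finset.range (p.natDegree + 1),
    p.coeff i * (s ^ (2 * (d + i) + 4))⁻¹ with hχ
  obtain ⟨hχc, hχ0⟩ := hsum p.coeff (Finset.range (p.natDegree + 1))
  have hclose : ∀ s ∈ Icc a b, |φ s + -1 * χ s| ≤ (a ^ (2 * d + 4))⁻¹ * ε := by
    intro s hs
    have hs0 : 0 < s := ha.trans_le hs.1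
    have ht : (s ^ 2)⁻¹ ∈ Icc ((b ^ 2)⁻¹) ((a ^ 2)⁻¹) :=
      ⟨inv_anti₀ (by positivity) (pow_le_pow_left₀ hs0.le hs.2 2),
        inv_anti₀ (by positivity) (pow_le_pow_left₀ ha.le hs.1 2)⟩
    have h1 := (hp _ ht).le
    rw [Real.sqrt_inv, Real.sqrt_sq hs0.le, inv_inv] at h1
    have h2 : χ s = (s ^ (2 * d + 4))⁻¹ * p.eval ((s ^ 2)⁻¹) := by
      rw [hχ, Polynomial.eval_eq_sum_range, Finset.mul_sum]
      refine Finset.sum_congr rfl fun i _ => ?_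
      rw [← inv_pow, ← inv_pow, ← inv_pow]
      ring
    have h3 : φ s + -1 * χ s = -((s ^ (2 * d + 4))⁻¹ *
        (p.eval ((s ^ 2)⁻¹) - φ s * ((s ^ 2)⁻¹ ^ (d + 2))⁻¹)) := by
      rw [h2]
      have : ((s ^ 2)⁻¹ ^ (d + 2))⁻¹ = s ^ (2 * d + 4) := by
        rw [inv_pow, inv_inv, ← pow_mul]; congr 1
      rw [this]
      field_simp
      ring
    rw [h3, abs_neg, abs_mul, abs_of_pos (by positivity)]
    gcongr
    exact hs.1
  have hχ1 : ContinuousOn (fun s => -1 * χ s) (Ioi 0) := continuousOn_const.mul hχc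
  have hdiff : ∫ n, P n * Λ φ n ∂sphereMeasure =
      ∫ n, P n * Λ (fun s => φ s + -1 * χ s) n ∂sphereMeasure := by
    have e : ∀ n, P n * Λ (fun s => φ s + -1 * χ s) n = P n * Λ φ n + -1 * (P n * Λ χ n) :=
      fun n => by rw [hadd _ _ hφ hχ1 n, hsmul _ hχc]; ring
    rw [integral_congr_ae (Eventually.of_forall e), integral_add, integral_const_mul, hχ0,
      mul_zero, add_zero]
    · exact integral_continuous_mul_sub hPc (hcont _ hφ)
    · exact (integral_continuous_mul_sub hPc (hcont _ hχc)).const_mul _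
  have hle : J ≤ M * ε := by
    change ‖∫ n, P n * Λ φ n ∂sphereMeasure‖ ≤ _
    rw [hdiff]
    calc _ ≤ ∫ n, |P n| * (|C| * ((a ^ (2 * d + 4))⁻¹ * ε)) ∂sphereMeasure := by
          refine norm_integral_le_of_norm_le ?_ (Eventually.of_forall fun n => ?_)
          · exact integral_continuous_mul_sub (continuous_abs.comp hPc) continuous_const
          · rw [norm_mul, Real.norm_eq_abs, Real.norm_eq_abs]
            gcongr
            refine (hbound _ (hφ.add hχ1) _ hclose n).trans ?_
            gcongr
            exact le_abs_self C
      _ = M * ε := by rw [integral_mul_const]; ring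
  have h4 : (M + 1) * ε = J / 2 := by
    change (M + 1) * (J / (2 * (M + 1))) = J / 2
    field_simp
  nlinarith

/-! ### Functionals given by measures -/

/-- The numbers `βn` stay in a compact interval of positive numbers, on which the approximation by
powers takes place. -/
theorem exists_ray_bounds {B : Set Spacetime} (hB : IsCompact B) (hBV : B ⊆ forwardCone) :
    ∃ a b, 0 < a ∧ a ≤ b ∧ ∀ β ∈ B, ∀ n, mink β (ray n) ∈ Icc a b := by
  obtain ⟨c, hc, hcB⟩ := exists_cone_bound hB hBV
  obtain ⟨R, hR⟩ := hB.isBounded.exists_norm_le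
  refine ⟨c, max c (‖minkL‖ * R * 2), hc, le_max_left _ _, fun β hβ n => ⟨?_, ?_⟩⟩
  · have := hcB β hβ n
    rwa [norm_sphere, mul_one] at this
  · refine le_trans ((le_abs_self _).trans (abs_mink_le _ _)) (le_trans ?_ (le_max_right _ _))
    have h1 := norm_shell_le (n : Space)
    rw [norm_sphere, mul_one] at h1
    have h2 := (norm_nonneg β).trans (hR β hβ)
    exact mul_le_mul (mul_le_mul_of_nonneg_left (hR β hβ) (norm_nonneg minkL)) h1
      (norm_nonneg (ray n)) (by positivity)

theorem continuousOn_comp_ray {φ : ℝ → ℝ} (hφ : ContinuousOn φ (Ioi 0)) :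
    ContinuousOn (fun z : Spacetime × Sphere => φ (mink z.1 (ray z.2))) (forwardCone ×ˢ univ) :=
  hφ.comp (by fun_prop : Continuous fun z : Spacetime × Sphere => mink z.1 (ray z.2)).continuousOn
    fun z hz => mink_ray_pos hz.1 z.2

theorem continuousOn_comp_mink_ray {φ : ℝ → ℝ} (hφ : ContinuousOn φ (Ioi 0)) (n : Sphere) :
    ContinuousOn (fun β => φ (mink β (ray n))) forwardCone :=
  hφ.comp (by fun_prop : Continuous fun β => mink β (ray n)).continuousOn
    fun _ hβ => mink_ray_pos hβ n

theorem SupportedIn.abs_integral_ray_le {σ : Measure Spacetime} {B : Set Spacetime}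
    (h : SupportedIn σ B) {a b : ℝ} (hab : ∀ β ∈ B, ∀ n, mink β (ray n) ∈ Icc a b) {φ : ℝ → ℝ}
    {ε : ℝ} (hε : ∀ s ∈ Icc a b, |φ s| ≤ ε) (n : Sphere) :
    |∫ β, φ (mink β (ray n)) ∂σ| ≤ ε * σ.real univ := by
  have := h.finite
  have hle : ∀ᵐ β ∂σ, ‖φ (mink β (ray n))‖ ≤ ε := by
    filter_upwards [h.ae_mem] with β hβ using hε _ (hab β hβ n)
  exact norm_integral_le_of_norm_le_const hle

theorem SupportedIn.continuous_integral_ray {σ : Measure Spacetime} {B : Set Spacetime}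
    (h : SupportedIn σ B) {φ : ℝ → ℝ} (hφ : ContinuousOn φ (Ioi 0)) :
    Continuous fun n => ∫ β, φ (mink β (ray n)) ∂σ := by
  have := h.finite
  obtain ⟨a, b, ha, _, hab⟩ := exists_ray_bounds h.compact h.subset
  obtain ⟨C, hC⟩ := isCompact_Icc.exists_bound_of_continuousOn
    (hφ.mono fun s (hs : s ∈ Icc a b) => ha.trans_le hs.1)
  refine continuous_of_dominated (bound := fun _ => C)
    (fun n => (h.integrable (continuousOn_comp_mink_ray hφ n)).1) (fun n => ?_)
    (integrable_const C) ?_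
  · filter_upwards [h.ae_mem] with β hβ using hC _ (hab β hβ n)
  · filter_upwards [h.ae_mem] with β hβ
    have hc : Continuous fun n => mink β (ray n) := by fun_prop
    exact hφ.comp_continuous hc fun n => mink_ray_pos (h.subset hβ) n

/-- Fubini applies because the integrand is continuous on the compact set `B × S²`, which carries
the product measure. -/
theorem SupportedIn.integral_sphere_swap {σ : Measure Spacetime} {B : Set Spacetime}
    (h : SupportedIn σ B) {φ : ℝ → ℝ} (hφ : ContinuousOn φ (Ioi 0)) {A : Sphere → ℝ}
    (hA : Continuous A) :
    ∫ n, A n * ∫ β, φ (mink β (ray n)) ∂σ ∂sphereMeasure =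
      ∫ β, (∫ n, A n * φ (mink β (ray n)) ∂sphereMeasure) ∂σ := by
  have := h.finite
  have hint : Integrable (Function.uncurry fun (β : Spacetime) (n : Sphere) =>
      A n * φ (mink β (ray n))) (σ.prod sphereMeasure) := by
    have hr : (σ.prod sphereMeasure).restrict (B ×ˢ univ) = σ.prod sphereMeasure := by
      rw [← Measure.prod_restrict, h.restrict, Measure.restrict_univ]
    rw [← hr]
    refine ContinuousOn.integrableOn_compact (h.compact.prod isCompact_univ) ?_
    exact (hA.comp continuous_snd).continuousOn.mul
      ((continuousOn_comp_ray hφ).mono (prod_mono h.subset subset_rfl))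
  rw [integral_integral_swap hint]
  simp only [integral_const_mul]

/-- The density argument for the functional `Λ φ n = ∑ cᵢ(n) ∫ φ(βn) dσᵢ`. Direction-dependent
coefficients are admitted so that contractions with `n` itself, as in the transport equation, are
covered. -/
theorem measures_functional_eq_zero {ι : Type*} [Fintype ι] {σ : ι → Measure Spacetime}
    {B : Set Spacetime} (h : ∀ i, SupportedIn (σ i) B) {c : ι → Sphere → ℝ}
    (hc : ∀ i, Continuous (c i))
    (hzero : ∀ (k : ℕ) (v : ℕ → Fin 4),
      ∑ i, ∫ β, (∫ n, (∏ j ∈ Finset.range (2 * k + 1), ray n (v j)) * c i n *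
        (mink β (ray n) ^ (2 * k + 4))⁻¹ ∂sphereMeasure) ∂σ i = 0)
    {φ : ℝ → ℝ} (hφ : ContinuousOn φ (Ioi 0)) (n : Sphere) :
    ∑ i, c i n * ∫ β, φ (mink β (ray n)) ∂σ i = 0 := by
  by_cases hι : IsEmpty ι
  · simp
  rw [not_isEmpty_iff] at hι
  obtain ⟨i₀⟩ := hι
  obtain ⟨a, b, ha, hab, hB⟩ := exists_ray_bounds (h i₀).compact (h i₀).subset
  have hcb : ∀ i, ∃ C, ∀ n, |c i n| ≤ C := fun i => by
    obtain ⟨C, hC⟩ := isCompact_univ.exists_bound_of_continuousOn (hc i).continuousOn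
    exact ⟨C, fun n => hC n trivial⟩
  choose D hD using hcb
  have hI : ∀ φ, ContinuousOn φ (Ioi 0) → ∀ i n,
      Integrable (fun β => φ (mink β (ray n))) (σ i) := fun φ hφ i n =>
    (h i).integrable (continuousOn_comp_mink_ray hφ n)
  refine functional_eq_zero ha hab (fun φ n => ∑ i, c i n * ∫ β, φ (mink β (ray n)) ∂σ i)
    (∑ i, D i * (σ i).real univ) ?_ ?_ ?_ ?_ ?_ hφ n
  · intro φ χ hφ hχ n
    simp only [integral_add (hI φ hφ _ n) (hI χ hχ _ n), mul_add, Finset.sum_add_distrib]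
  · intro φ _ r n
    simp only [integral_const_mul, Finset.mul_sum]
    exact Finset.sum_congr rfl fun i _ => by ring
  · intro φ hφ ε hε n
    refine (Finset.abs_sum_le_sum_abs _ _).trans ?_
    rw [Finset.sum_mul]
    refine Finset.sum_le_sum fun i _ => ?_
    rw [abs_mul, mul_assoc, mul_comm _ ε]
    exact mul_le_mul (hD i n) ((h i).abs_integral_ray_le hB hε n) (abs_nonneg _)
      ((abs_nonneg _).trans (hD i n))
  · intro φ hφ
    exact continuous_finsetSum _ fun i _ => (hc i).mul ((h i).continuous_integral_ray hφ)
  · intro k v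
    have hpow : ContinuousOn (fun s : ℝ => (s ^ (2 * k + 4))⁻¹) (Ioi 0) :=
      (continuous_pow _).continuousOn.inv₀ fun s hs => (pow_pos (show (0 : ℝ) < s from hs) _).ne'
    rw [← hzero k v]
    simp only [Finset.mul_sum, ← mul_assoc]
    have hP : ∀ i, Continuous fun n =>
        (∏ j ∈ Finset.range (2 * k + 1), ray n (v j)) * c i n := fun i => by
      have := hc i
      fun_prop
    rw [integral_finsetSum _ fun i _ => integral_continuous_mul_sub (hP i)
      ((h i).continuous_integral_ray hpow)]
    exact Finset.sum_congr rfl fun i _ => (h i).integral_sphere_swap hpow (hP i)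

/-! ### Reference states with the same expectation values -/

/-- The vectors along which the balanced derivatives are taken. -/
def upVec (μ : Fin 4) : Spacetime := eta μ • basisVec μ

theorem mink_upVec_left (μ : Fin 4) (p : Spacetime) : mink (upVec μ) p = p μ := by
  rw [upVec, mink_smul_left, mink_basisVec_left, ← mul_assoc, eta_mul_eta, one_mul]

/-- Up to a factor, the thermal functions of the balanced derivatives. -/
def thetaFn {m : ℕ} (μ : Fin m → Fin 4) (β : Spacetime) : ℝ :=
  ∫ n, (∏ i, ray n (μ i)) * (mink β (ray n) ^ (m + 2))⁻¹ ∂sphereMeasure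

theorem SupportedIn.refTheta_upVec {ρ : Measure Spacetime} {B : Set Spacetime}
    (h : SupportedIn ρ B) {m : ℕ} (μ : Fin m → Fin 4) :
    refTheta ρ (fun i => upVec (μ i)) = thetaConst m * ((∫ β, thetaFn μ β ∂ρ : ℝ) : ℂ) := by
  rw [h.refTheta_eq_integral]
  simp only [sphereMoment, mink_upVec_left, thetaFn]

theorem prod_snoc_zero {k : ℕ} (v : ℕ → Fin 4) (n : Sphere) :
    ∏ i : Fin (2 * k + 2), ray n (if (i : ℕ) < 2 * k + 1 then v i else 0) =
      ∏ j ∈ Finset.range (2 * k + 1), ray n (v j) := by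
  rw [← Finset.prod_range (fun j => ray n (if j < 2 * k + 1 then v j else 0)),
    Finset.prod_range_succ, if_neg (lt_irrefl _), ray, shell_zero_coord, norm_sphere, mul_one]
  exact Finset.prod_congr rfl fun j hj => by rw [if_pos (Finset.mem_range.1 hj)]

/-- The signed combination `ρ - ρ'` is a two-term functional with coefficients `1` and `-1`.
Agreement on the balanced derivatives of even order `2k + 2` makes its moments vanish. -/
theorem SupportedIn.integral_ray_eq {ρ ρ' : Measure Spacetime} {B B' : Set Spacetime}
    (h : SupportedIn ρ B) (h' : SupportedIn ρ' B')
    (heq : ∀ (m : ℕ) (μ : Fin m → Fin 4), refTheta ρ (fun i => upVec (μ i)) =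
      refTheta ρ' (fun i => upVec (μ i))) {φ : ℝ → ℝ} (hφ : ContinuousOn φ (Ioi 0)) (n : Sphere) :
    ∫ β, φ (mink β (ray n)) ∂ρ = ∫ β, φ (mink β (ray n)) ∂ρ' := by
  have hs : ∀ i : Bool, SupportedIn (if i then ρ else ρ') (B ∪ B') := by
    have hU := h.compact.union h'.compact
    have hV : B ∪ B' ⊆ forwardCone := union_subset h.subset h'.subset
    rintro (_ | _)
    · exact ⟨h'.finite, hU, hV, measure_mono_null (compl_subset_compl.2 subset_union_right) h'.null⟩
    · exact ⟨h.finite, hU, hV, measure_mono_null (compl_subset_compl.2 subset_union_left) h.null⟩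
  have := measures_functional_eq_zero (σ := fun i : Bool => if i then ρ else ρ') hs
    (c := fun i _ => if i then 1 else -1) (fun i => continuous_const) ?_ hφ n
  · simp only [Fintype.sum_bool, if_true, one_mul, Bool.false_eq_true, if_false] at this
    linarith
  · intro k v
    -- One zero index is appended to the `2k + 1` given ones, so that the order is even and the
    -- numerical factor can be cancelled.
    have hk := heq (2 * k + 2) fun i => if (i : ℕ) < 2 * k + 1 then v i else 0
    rw [h.refTheta_upVec, h'.refTheta_upVec] at hk
    have hk2 := mul_left_cancel₀ (thetaConst_ne_zero (k + 1)) hk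
    have hk3 : ∫ β, thetaFn (fun i : Fin (2 * k + 2) => if (i : ℕ) < 2 * k + 1 then v i else 0) β ∂ρ
        = ∫ β, thetaFn (fun i : Fin (2 * k + 2) => if (i : ℕ) < 2 * k + 1 then v i else 0) β ∂ρ' := by
      exact_mod_cast hk2
    simp only [thetaFn, prod_snoc_zero] at hk3
    simp only [Fintype.sum_bool, if_true, mul_one, Bool.false_eq_true, if_false, mul_neg, neg_mul,
      integral_neg]
    rw [hk3]
    exact add_neg_cancel _

/-! ### Kernels of two-point functions -/

theorem tsupport_mul_prod_subset {f g : Spacetime → ℂ} :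
    tsupport (fun z : Spacetime × Spacetime => f z.1 * g z.2) ⊆ tsupport f ×ˢ tsupport g := by
  have h : Function.support (fun z : Spacetime × Spacetime => f z.1 * g z.2) ⊆
      tsupport f ×ˢ tsupport g := fun z hz =>
    ⟨subset_tsupport _ (left_ne_zero_of_mul hz), subset_tsupport _ (right_ne_zero_of_mul hz)⟩
  exact closure_minimal h ((isClosed_tsupport _).prod (isClosed_tsupport _))

/-- A kernel, tested with two test functions whose supports are in its domain, is continuous with
compact support. -/
theorem continuous_test_kernel {f g : Spacetime → ℂ} (hf : Continuous f) (hg : Continuous g)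
    (hfc : HasCompactSupport f) (hgc : HasCompactSupport g)
    {Q : Spacetime → Spacetime → ℂ} {Ω : Set (Spacetime × Spacetime)} (hΩ : IsOpen Ω)
    (hQ : ContinuousOn (Function.uncurry Q) Ω) (hfg : tsupport f ×ˢ tsupport g ⊆ Ω) :
    Continuous (fun z : Spacetime × Spacetime => f z.1 * g z.2 * Q z.1 z.2) ∧
    HasCompactSupport (fun z : Spacetime × Spacetime => f z.1 * g z.2 * Q z.1 z.2) := by
  have hsub : tsupport (fun z : Spacetime × Spacetime => f z.1 * g z.2 * Q z.1 z.2) ⊆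
      tsupport f ×ˢ tsupport g :=
    (tsupport_mul_subset_left (f := fun z : Spacetime × Spacetime => f z.1 * g z.2)).trans
      tsupport_mul_prod_subset
  constructor
  · refine ContinuousOn.continuous_of_tsupport_subset ?_ hΩ (hsub.trans hfg)
    exact (by fun_prop : Continuous fun z : Spacetime × Spacetime => f z.1 * g z.2).continuousOn.mul
      hQ
  · exact (hfc.prod hgc).of_isClosed_subset (isClosed_tsupport _) hsub

theorem integral_test_kernel (f g : TestFn) {Q : Spacetime → Spacetime → ℂ}
    {Ω : Set (Spacetime × Spacetime)} (hΩ : IsOpen Ω) (hQ : ContinuousOn (Function.uncurry Q) Ω)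
    (hfg : tsupport f.1 ×ˢ tsupport g.1 ⊆ Ω) :
    Integrable (fun z : Spacetime × Spacetime => f.1 z.1 * g.1 z.2 * Q z.1 z.2) ∧
    ∫ x₁, ∫ x₂, f.1 x₁ * g.1 x₂ * Q x₁ x₂ =
      ∫ z : Spacetime × Spacetime, f.1 z.1 * g.1 z.2 * Q z.1 z.2 := by
  obtain ⟨h1, h2⟩ := continuous_test_kernel f.2.1.continuous g.2.1.continuous f.2.2 g.2.2 hΩ hQ hfg
  have h3 := h1.integrable_of_hasCompactSupport h2 (μ := volume)
  exact ⟨h3, (integral_prod _ h3).symm⟩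

/-- A normalized bump function as a test function. -/
def bumpT {c : Spacetime} (φ : ContDiffBump c) : TestFn :=
  ⟨fun x => (φ.normed volume x : ℂ), Complex.ofRealCLM.contDiff.comp φ.contDiff_normed,
    φ.hasCompactSupport_normed.comp_left Complex.ofReal_zero⟩

theorem tsupport_bumpT {c : Spacetime} (φ : ContDiffBump c) :
    tsupport (bumpT φ).1 = Metric.closedBall c φ.rOut := by
  rw [← φ.tsupport_normed_eq (μ := volume)]
  unfold tsupport
  congr 1
  ext x
  simp [bumpT, Function.mem_support]

/-- If the continuous difference were nonzero at `(a, b)`, its average with a product of normalized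
bump functions near `a` and `b` would be within half its modulus of that value, yet the average
vanishes. -/
theorem kernel_eq_of_test_eq {Q₁ Q₂ : Spacetime → Spacetime → ℂ} {Ω : Set (Spacetime × Spacetime)}
    (hΩ : IsOpen Ω) (h₁ : ContinuousOn (Function.uncurry Q₁) Ω)
    (h₂ : ContinuousOn (Function.uncurry Q₂) Ω)
    (h : ∀ f g : TestFn, tsupport f.1 ×ˢ tsupport g.1 ⊆ Ω →
      ∫ x₁, ∫ x₂, f.1 x₁ * g.1 x₂ * Q₁ x₁ x₂ = ∫ x₁, ∫ x₂, f.1 x₁ * g.1 x₂ * Q₂ x₁ x₂)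
    {a b : Spacetime} (hab : (a, b) ∈ Ω) : Q₁ a b = Q₂ a b := by
  by_contra hne
  set D : Spacetime × Spacetime → ℂ := fun z => Q₁ z.1 z.2 - Q₂ z.1 z.2 with hD
  have hDc : ContinuousOn D Ω := h₁.sub h₂
  set ε := ‖D (a, b)‖ / 2
  have hD0 : 0 < ‖D (a, b)‖ := norm_pos_iff.2 (sub_ne_zero.2 hne)
  have hε : 0 < ε := by positivity
  have hnhds : ∀ᶠ z in 𝓝 (a, b), z ∈ Ω ∧ ‖D z - D (a, b)‖ < ε := by
    refine (hΩ.eventually_mem hab).and ?_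
    have := (hDc.continuousAt (hΩ.mem_nhds hab)).eventually (Metric.ball_mem_nhds _ hε)
    simpa [dist_eq_norm] using this
  obtain ⟨δ, hδ, hball⟩ := Metric.eventually_nhds_iff_ball.1 hnhds
  let φ : ContDiffBump a := ⟨δ / 4, δ / 2, by positivity, by linarith⟩
  let χ : ContDiffBump b := ⟨δ / 4, δ / 2, by positivity, by linarith⟩
  have hmem : ∀ z ∈ tsupport (bumpT φ).1 ×ˢ tsupport (bumpT χ).1, z ∈ Metric.ball (a, b) δ := by
    intro z hz
    rw [tsupport_bumpT, tsupport_bumpT] at hz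
    rw [← ball_prod_same]
    exact ⟨Metric.closedBall_subset_ball (by change δ / 2 < δ; linarith) hz.1,
      Metric.closedBall_subset_ball (by change δ / 2 < δ; linarith) hz.2⟩
  have hfg : tsupport (bumpT φ).1 ×ˢ tsupport (bumpT χ).1 ⊆ Ω := fun z hz =>
    (hball z (hmem z hz)).1
  obtain ⟨i1, e1⟩ := integral_test_kernel _ _ hΩ h₁ hfg
  obtain ⟨i2, e2⟩ := integral_test_kernel _ _ hΩ h₂ hfg
  have hz := h _ _ hfg
  rw [e1, e2, ← sub_eq_zero, ← integral_sub i1 i2] at hz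
  simp only [← mul_sub] at hz
  set w : Spacetime × Spacetime → ℝ := fun z => φ.normed volume z.1 * χ.normed volume z.2 with hw
  have hwint : Integrable w := by
    have h1 := (φ.integrable_normed (μ := volume)).mul_prod (χ.integrable_normed (μ := volume))
    exact h1
  have hw1 : ∫ z, w z = 1 := by
    have := integral_prod_mul (μ := volume) (ν := volume) (φ.normed volume) (χ.normed volume)
    rw [φ.integral_normed, χ.integral_normed, mul_one] at this
    exact this
  have hw0 : ∀ z, 0 ≤ w z := fun z => mul_nonneg (φ.nonneg_normed _) (χ.nonneg_normed _)
  have hbw : ∀ z : Spacetime × Spacetime, (bumpT φ).1 z.1 * (bumpT χ).1 z.2 = (w z : ℂ) :=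
    fun z => by simp [bumpT, hw]
  simp only [hbw] at hz
  have hint1 : Integrable fun z => (w z : ℂ) * D z := by
    have := i1.sub i2
    refine this.congr (Eventually.of_forall fun z => ?_)
    simp only [Pi.sub_apply, ← mul_sub, hbw, hD]
  have hint2 : Integrable fun z => (w z : ℂ) * D (a, b) := hwint.ofReal.mul_const _
  have hsplit : ∫ z, (w z : ℂ) * (D (a, b) - D z) = D (a, b) := by
    simp only [mul_sub]
    rw [integral_sub hint2 hint1, hz, integral_mul_const, integral_complex_ofReal, hw1]
    simp
  have hle : ‖∫ z, (w z : ℂ) * (D (a, b) - D z)‖ ≤ ∫ z, w z * ε := by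
    refine norm_integral_le_of_norm_le (hwint.mul_const _) (Eventually.of_forall fun z => ?_)
    rw [norm_mul, Complex.norm_real, Real.norm_of_nonneg (hw0 z)]
    by_cases hzs : z ∈ tsupport (bumpT φ).1 ×ˢ tsupport (bumpT χ).1
    · refine mul_le_mul_of_nonneg_left ?_ (hw0 z)
      rw [norm_sub_rev]
      exact (hball z (hmem z hzs)).2.le
    · have : w z = 0 := by
        have h0 : (w z : ℂ) = 0 := by
          rw [← hbw]
          by_contra hne'
          exact hzs ⟨subset_tsupport _ (left_ne_zero_of_mul hne'),
            subset_tsupport _ (right_ne_zero_of_mul hne')⟩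
        exact_mod_cast h0
      rw [this, zero_mul, zero_mul]
  rw [hsplit, integral_mul_const, hw1, one_mul] at hle
  change ‖D (a, b)‖ ≤ ‖D (a, b)‖ / 2 at hle
  linarith

/-- The midpoint and half the difference of two points. -/
def midDiff (z : Spacetime × Spacetime) : Spacetime × Spacetime :=
  ((1 / 2 : ℝ) • (z.1 + z.2), (1 / 2 : ℝ) • (z.1 - z.2))

@[fun_prop]
theorem continuous_midDiff : Continuous midDiff := by unfold midDiff; fun_prop

theorem midDiff_add_sub (x ζ : Spacetime) : midDiff (x + ζ, x - ζ) = (x, ζ) := by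
  ext1
  · simp only [midDiff]; module
  · simp only [midDiff]; module

/-- The pairs of points whose midpoint and difference are in `U`, with space-like separation. -/
def pairDomain (U : Set (Spacetime × Spacetime)) : Set (Spacetime × Spacetime) :=
  {z | midDiff z ∈ U ∧ (midDiff z).2 ∈ spacelike}

theorem isOpen_pairDomain {U : Set (Spacetime × Spacetime)} (hU : IsOpen U) :
    IsOpen (pairDomain U) :=
  (hU.preimage continuous_midDiff).inter
    (isOpen_spacelike.preimage (continuous_snd.comp continuous_midDiff))

/-! ### Uniqueness of kernels and the canonical kernel -/

section kernel

variable {G : TestFn → TestFn → ℂ} {U V : Set (Spacetime × Spacetime)}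
  {w w' : Spacetime → Spacetime → ℂ}

theorem IsKernelOn.continuousOn (h : IsKernelOn G U w) :
    ContinuousOn (fun q : Spacetime × Spacetime => w q.1 q.2) {q | q ∈ U ∧ q.2 ∈ spacelike} := by
  have := (ContinuousMultilinearMap.apply ℝ (fun _ : Fin 0 => Spacetime) ℂ
    0).continuous.comp_continuousOn (h.cont 0)
  exact this

theorem IsKernelOn.continuousOn_pair (h : IsKernelOn G U w) :
    ContinuousOn (Function.uncurry fun x₁ x₂ =>
      w ((1 / 2 : ℝ) • (x₁ + x₂)) ((1 / 2 : ℝ) • (x₁ - x₂))) (pairDomain U) :=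
  h.continuousOn.comp continuous_midDiff.continuousOn fun _ hz => hz

theorem IsKernelOn.mono (h : IsKernelOn G U w) (hVU : V ⊆ U) : IsKernelOn G V w :=
  ⟨fun x ζ hx => h.smooth x ζ (hVU hx), fun m => (h.cont m).mono fun _ hq => ⟨hVU hq.1, hq.2⟩,
    fun f g hfg => h.kernel f g fun x₁ h₁ x₂ h₂ => ⟨hVU (hfg x₁ h₁ x₂ h₂).1, (hfg x₁ h₁ x₂ h₂).2⟩⟩

/-- Kernels are unique. -/
theorem IsKernelOn.eq (hU : IsOpen U) (hV : IsOpen V) (h : IsKernelOn G U w)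
    (h' : IsKernelOn G V w') {x ζ : Spacetime} (hxU : (x, ζ) ∈ U) (hxV : (x, ζ) ∈ V)
    (hζ : ζ ∈ spacelike) : w x ζ = w' x ζ := by
  have hk := h.mono (V := U ∩ V) inter_subset_left
  have hk' := h'.mono (V := U ∩ V) inter_subset_right
  have := kernel_eq_of_test_eq (isOpen_pairDomain (hU.inter hV)) hk.continuousOn_pair
    hk'.continuousOn_pair (fun f g hfg => ?_) (a := x + ζ) (b := x - ζ) ?_
  · have hm := midDiff_add_sub x ζ
    simp only [midDiff, Prod.mk.injEq] at hm
    rwa [hm.1, hm.2] at this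
  · rw [← hk.kernel f g fun x₁ h₁ x₂ h₂ => hfg (mk_mem_prod h₁ h₂),
      ← hk'.kernel f g fun x₁ h₁ x₂ h₂ => hfg (mk_mem_prod h₁ h₂)]
  · change midDiff (x + ζ, x - ζ) ∈ U ∩ V ∧ (midDiff (x + ζ, x - ζ)).2 ∈ spacelike
    rw [midDiff_add_sub]
    exact ⟨⟨hxU, hxV⟩, hζ⟩

/-- The points near which a kernel exists. -/
def kernelDomain (G : TestFn → TestFn → ℂ) : Set (Spacetime × Spacetime) :=
  {q | q.2 ∈ spacelike ∧ ∃ U w, IsOpen U ∧ q ∈ U ∧ IsKernelOn G U w}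

open Classical in
/-- The kernel of the normal ordered two-point function, wherever it exists. -/
def theKernel (G : TestFn → TestFn → ℂ) (x ζ : Spacetime) : ℂ :=
  if h : (x, ζ) ∈ kernelDomain G then h.2.choose_spec.choose x ζ else 0

/-- The choice made at each point is harmless by uniqueness. A single kernel thus serves all points
and all orders, although the definition of a balanced derivative allows a new kernel and domain each
time. -/
theorem IsKernelOn.theKernel_eq (hU : IsOpen U) (h : IsKernelOn G U w) {x ζ : Spacetime}
    (hx : (x, ζ) ∈ U) (hζ : ζ ∈ spacelike) : theKernel G x ζ = w x ζ := by
  have hd : (x, ζ) ∈ kernelDomain G := ⟨hζ, U, w, hU, hx, h⟩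
  rw [theKernel, dif_pos hd]
  obtain ⟨hU', hx', h'⟩ := hd.2.choose_spec.choose_spec
  exact IsKernelOn.eq hU' hU h' h hx' hx hζ

theorem IsKernelOn.theKernel_eventuallyEq (hU : IsOpen U) (h : IsKernelOn G U w)
    {x ζ : Spacetime} (hx : (x, ζ) ∈ U) (hζ : ζ ∈ spacelike) :
    theKernel G x =ᶠ[𝓝 ζ] w x := by
  have h1 : ∀ᶠ ζ' in 𝓝 ζ, (x, ζ') ∈ U :=
    (hU.preimage (by fun_prop : Continuous fun ζ' : Spacetime => (x, ζ'))).eventually_mem hx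
  filter_upwards [h1, isOpen_spacelike.eventually_mem hζ] with ζ' hx' hζ'
  exact h.theKernel_eq hU hx' hζ'

theorem IsKernelOn.iteratedFDeriv_theKernel (hU : IsOpen U) (h : IsKernelOn G U w)
    {x ζ : Spacetime} (hx : (x, ζ) ∈ U) (hζ : ζ ∈ spacelike) (m : ℕ) :
    iteratedFDeriv ℝ m (theKernel G x) ζ = iteratedFDeriv ℝ m (w x) ζ :=
  ((h.theKernel_eventuallyEq hU hx hζ).iteratedFDeriv ℝ m).eq_of_nhds

theorem IsKernelOn.theKernel (hU : IsOpen U) (h : IsKernelOn G U w) :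
    IsKernelOn G U (theKernel G) where
  smooth x ζ hx hζ := (h.smooth x ζ hx hζ).congr_of_eventuallyEq
    (h.theKernel_eventuallyEq hU hx hζ)
  cont m := (h.cont m).congr fun q hq => h.iteratedFDeriv_theKernel hU hq.1 hq.2 m
  kernel f g hfg := by
    rw [h.kernel f g hfg]
    congr 1
    funext x₁
    congr 1
    funext x₂
    by_cases h1 : x₁ ∈ tsupport f.1
    · by_cases h2 : x₂ ∈ tsupport g.1
      · rw [h.theKernel_eq hU (hfg x₁ h1 x₂ h2).1 (hfg x₁ h1 x₂ h2).2]
      · simp [image_eq_zero_of_notMem_tsupport h2]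
    · simp [image_eq_zero_of_notMem_tsupport h1]

theorem HasThetaValue.theKernel {x : Spacetime} {m : ℕ} {μ : Fin m → Fin 4} {t : ℂ}
    (h : HasThetaValue G x μ t) : ∃ U, IsOpen U ∧ (x, (0 : Spacetime)) ∈ U ∧
      IsKernelOn G U (theKernel G) ∧
      (∃ C : ℝ, ∀ q ∈ U, q.2 ∈ spacelike → ‖iteratedFDeriv ℝ m (theKernel G q.1) q.2‖ ≤ C) ∧
      Tendsto (fun ζ => iteratedFDeriv ℝ m (LocalEq.theKernel G x) ζ (fun i => upVec (μ i)))
        (𝓝[spacelike] 0) (𝓝 t) := by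
  obtain ⟨U, w, hU, hx, hk, ⟨C, hC⟩, ht⟩ := h
  refine ⟨U, hU, hx, hk.theKernel hU, ⟨C, fun q hq hs => ?_⟩, ht.congr' ?_⟩
  · rw [hk.iteratedFDeriv_theKernel hU hq hs]
    exact hC q hq hs
  · have h1 : ∀ᶠ ζ' in 𝓝[spacelike] (0 : Spacetime), (x, ζ') ∈ U :=
      nhdsWithin_le_nhds ((hU.preimage (by fun_prop : Continuous fun ζ' : Spacetime =>
        (x, ζ'))).eventually_mem hx)
    filter_upwards [h1, self_mem_nhdsWithin] with ζ hζU hζ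
    rw [hk.iteratedFDeriv_theKernel hU hζU hζ]
    rfl

theorem HasThetaValue.unique {x : Spacetime} {m : ℕ} {μ : Fin m → Fin 4} {t t' : ℂ}
    (h : HasThetaValue G x μ t) (h' : HasThetaValue G x μ t') : t = t' := by
  obtain ⟨_, _, _, _, _, ht⟩ := h.theKernel
  obtain ⟨_, _, _, _, _, ht'⟩ := h'.theKernel
  have := nhdsWithin_spacelike_neBot
  exact tendsto_nhds_unique ht ht'

end kernel

theorem IsThermalAt.supportedIn {ω : State} {x : Spacetime} {ρ : Measure Spacetime}
    (h : IsThermalAt ω x ρ) : ∃ B, SupportedIn ρ B := by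
  obtain ⟨hp, ⟨B, hB, hBV, h0⟩, _⟩ := h
  exact ⟨B, inferInstance, hB, hBV, h0⟩

/-- The common value in the definition of thermality is identified through uniqueness with the
explicit value in the reference state. -/
theorem IsThermalAt.hasThetaValue {ω : State} {x : Spacetime} {ρ : Measure Spacetime}
    (h : IsThermalAt ω x ρ) {m : ℕ} (μ : Fin m → Fin 4) :
    HasThetaValue ω.twoPoint x μ (refTheta ρ fun i => upVec (μ i)) := by
  obtain ⟨B, hB⟩ := h.supportedIn
  obtain ⟨hp, _, hθ⟩ := h
  obtain ⟨t, h1, h2⟩ := hθ m μ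
  rwa [h2.unique (hB.hasThetaValue x μ)] at h1

/-- Reference states that agree with the same state on the local observables have the same
expectation values of the functions of `β n`, with `n` light-like. -/
theorem IsThermalAt.integral_eq {ω : State} {x : Spacetime} {ρ ρ' : Measure Spacetime}
    (h : IsThermalAt ω x ρ) (h' : IsThermalAt ω x ρ') {φ : ℝ → ℝ} (hφ : ContinuousOn φ (Ioi 0))
    {q : Space} (hq : q ≠ 0) :
    ∫ β, φ (mink β (shell q)) ∂ρ = ∫ β, φ (mink β (shell q)) ∂ρ' := by
  obtain ⟨B, hB⟩ := h.supportedIn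
  obtain ⟨B', hB'⟩ := h'.supportedIn
  obtain ⟨n, hn⟩ := shell_eq_ray hq
  have hq0 : 0 < ‖q‖ := norm_pos_iff.2 hq
  simp only [hn, mink_smul_right]
  -- The momentum is `‖q‖` times a ray, so the scale is absorbed into `φ`.
  refine hB.integral_ray_eq hB' (fun m μ => (h.hasThetaValue μ).unique (h'.hasThetaValue μ))
    (φ := fun s => φ (‖q‖ * s)) (hφ.comp (by fun_prop) fun s hs => ?_) n
  exact mul_pos hq0 hs

open scoped CompactlySupported

/-! ### Families of reference states -/

/-- A family of reference probability measures on a compact set of space-time points, with common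
temperature support and measurable expectation values. -/
structure ThermalFamily (ρ : Spacetime → Measure Spacetime) (K B : Set Spacetime) : Prop where
  compact : IsCompact K
  prob : ∀ z ∈ K, IsProbabilityMeasure (ρ z)
  supp : ∀ z ∈ K, SupportedIn (ρ z) B
  compactB : IsCompact B
  subsetB : B ⊆ forwardCone
  meas : ∀ l, AEStronglyMeasurable (fun z => refNPoint (ρ z) l) (volume.restrict K)

/-- Closure under conjugation is what the complex form of Stone-Weierstrass demands of the thermal
two-point functions. -/
theorem kmsForm_conj (β : Spacetime) (f g : TestFn) :
    (starRingEnd ℂ) (kmsForm β f g) = kmsForm β (conjT g) (conjT f) := by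
  simp only [kmsForm, shellForm, map_mul, map_pow, map_inv₀, Complex.conj_ofReal, ← integral_conj,
    map_sub, minkFT_conj, neg_neg, map_one, ← Complex.exp_conj, map_neg]
  congr 2
  funext q
  ring

/-- The directions `± e_i` give `β⁰ ∓ β^i`, hence all components. -/
theorem eq_of_forall_mink_ray {β β' : Spacetime} (h : ∀ n, mink β (ray n) = mink β' (ray n)) :
    β = β' := by
  have key : ∀ (i : Fin 3) (s : ℝ), |s| = 1 → β 0 - s * β i.succ = β' 0 - s * β' i.succ := by
    intro i s hs
    have hmem : (EuclideanSpace.single i s : Space) ∈ Metric.sphere (0 : Space) 1 := by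
      simp [hs]
    have := h ⟨_, hmem⟩
    simp only [mink_eq_spatial, ray, shell_zero_coord, spatial_shell] at this
    simpa [hs, spatial, EuclideanSpace.inner_single_right] using this
  have h0 : ∀ i : Fin 3, β 0 = β' 0 ∧ β i.succ = β' i.succ := fun i => by
    have h1 := key i 1 (by simp)
    have h2 := key i (-1) (by simp)
    constructor <;> linarith
  ext j
  refine Fin.cases (h0 0).1 (fun i => (h0 i).2) j

theorem supportedIn_dirac {β : Spacetime} (hβ : β ∈ forwardCone) :
    SupportedIn (Measure.dirac β) {β} :=
  ⟨inferInstance, isCompact_singleton, by simpa using hβ, by simp⟩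

/-- The equilibrium two-point functions separate the temperature vectors. -/
theorem eq_of_kmsForm_eq {β β' : Spacetime} (hβ : β ∈ forwardCone) (hβ' : β' ∈ forwardCone)
    (h : ∀ f g, kmsForm β f g = kmsForm β' f g) : β = β' := by
  refine eq_of_forall_mink_ray fun n => ?_
  -- Point masses are reference states. If their two-point functions coincide, so do their balanced
  -- derivatives, and then the numbers `βn`.
  have h1 := supportedIn_dirac hβ
  have h2 := supportedIn_dirac hβ'
  have heq : (fun f g => refNPoint (Measure.dirac β) [f, g]) =
      fun f g => refNPoint (Measure.dirac β') [f, g] := by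
    funext f g
    simp [refNPoint, wick_pair, h f g]
  have := h1.integral_ray_eq h2 (φ := id) (fun m μ => ?_) continuousOn_id n
  · simpa using this
  · have t1 := h1.hasThetaValue 0 μ
    have t2 := h2.hasThetaValue 0 μ
    rw [heq] at t1
    exact t1.unique t2

namespace ThermalFamily

variable {ρ : Spacetime → Measure Spacetime} {K B : Set Spacetime}

/-- Induction over the split-off pairs: a further factor is the clustering limit of Wick sums with
one more pair of fields, shifted to spatial infinity. The expectation values converge pointwise in
`z` by dominated convergence, so measurability persists. -/
theorem aestronglyMeasurable_prod_wick (h : ThermalFamily ρ K B) (P : List (TestFn × TestFn)) :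
    ∀ l : List TestFn, AEStronglyMeasurable
      (fun z => ∫ β, (P.map fun p => kmsForm β p.1 p.2).prod * wick (kmsForm β) l ∂ρ z)
      (volume.restrict K) := by
  have hcontP : ∀ P : List (TestFn × TestFn),
      ContinuousOn (fun β => (P.map fun p => kmsForm β p.1 p.2).prod) forwardCone := by
    intro P
    induction P with
    | nil => simpa using continuousOn_const
    | cons p P ih =>
      simp only [List.map_cons, List.prod_cons]
      exact (continuousOn_kmsForm _ _).mul ih
  induction P with
  | nil => intro l; simpa [refNPoint] using h.meas l
  | cons p P ih =>
    intro l
    refine aestronglyMeasurable_of_tendsto_ae atTop (fun n : ℕ =>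
      ih (translT ((n : ℝ) • basisVec 1) p.1 :: translT ((n : ℝ) • basisVec 1) p.2 :: l)) ?_
    rw [ae_restrict_iff' h.compact.measurableSet]
    refine Eventually.of_forall fun z hz => ?_
    have hs := h.supp z hz
    have := hs.finite
    obtain ⟨C, hC⟩ := exists_wick_bound h.compactB h.subsetB (p.1 :: p.2 :: l)
    obtain ⟨D, hD⟩ := h.compactB.exists_bound_of_continuousOn ((hcontP P).mono h.subsetB)
    -- The bound on the Wick sum depends only on the unshifted test functions, hence not on `n`.
    refine tendsto_integral_of_dominated_convergence (fun _ => D * C (l.length + 1 + 1))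
      (fun n => ?_) (integrable_const _) (fun n => ?_) ?_
    · exact (hs.integrable ((hcontP P).mul (continuousOn_wick _ _ rfl))).1
    · filter_upwards [hs.ae_mem] with β hβ
      rw [norm_mul]
      have h1 := hD β hβ
      have h2 := hC β hβ (translT ((n : ℝ) • basisVec 1) p.1 ::
        translT ((n : ℝ) • basisVec 1) p.2 :: l) (by
          intro u hu
          rcases List.mem_cons.1 hu with rfl | hu
          · exact ⟨_, p.1, by simp, rfl⟩
          rcases List.mem_cons.1 hu with rfl | hu
          · exact ⟨_, p.2, by simp, rfl⟩
          · exact ⟨0, u, by simp [hu], (translT_zero u).symm⟩)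
      exact mul_le_mul h1 h2 (norm_nonneg _) ((norm_nonneg _).trans h1)
    · filter_upwards [hs.ae_mem] with β hβ
      have := (tendsto_wick_transl (h.subsetB hβ) p.1 p.2 l).const_mul
        ((P.map fun p => kmsForm β p.1 p.2).prod)
      simp only [List.map_cons, List.prod_cons]
      convert this using 2
      ring

/-- The equilibrium two-point functions as continuous functions of the temperature vector. -/
def kmsGen (B : Set Spacetime) (hBV : B ⊆ forwardCone) (p : TestFn × TestFn) : C(B, ℂ) :=
  ⟨fun β => kmsForm β p.1 p.2,
    continuousOn_iff_continuous_domRestrict.1 ((continuousOn_kmsForm p.1 p.2).mono hBV)⟩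

theorem exists_list_of_mem_closure_kmsGen (hBV : B ⊆ forwardCone) {a : C(B, ℂ)}
    (ha : a ∈ Submonoid.closure (range (kmsGen B hBV) ∪ star (range (kmsGen B hBV)))) :
    ∃ P : List (TestFn × TestFn), ∀ β : B, a β = (P.map fun p => kmsForm β p.1 p.2).prod := by
  induction ha using Submonoid.closure_induction with
  | mem a ha =>
    rcases ha with ⟨p, rfl⟩ | ha
    · exact ⟨[p], fun β => by rw [List.map_singleton, List.prod_singleton]; rfl⟩
    · obtain ⟨p, hp⟩ := Set.mem_star.1 ha
      refine ⟨[(conjT p.2, conjT p.1)], fun β => ?_⟩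
      rw [← star_star a, ← hp]
      rw [List.map_singleton, List.prod_singleton]
      exact kmsForm_conj β p.1 p.2
  | one => exact ⟨[], fun β => by simp⟩
  | mul a b _ _ iha ihb =>
    obtain ⟨P, hP⟩ := iha
    obtain ⟨Q, hQ⟩ := ihb
    exact ⟨P ++ Q, fun β => by simp [hP, hQ]⟩

theorem integral_subtype (h : ThermalFamily ρ K B) {z : Spacetime} (hz : z ∈ K)
    (ψ : Spacetime → ℂ) :
    ∫ β : B, ψ β ∂((ρ z).comap Subtype.val) = ∫ β, ψ β ∂ρ z := by
  rw [integral_subtype_comap h.compactB.measurableSet, (h.supp z hz).restrict]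

theorem isFiniteMeasure_comap (h : ThermalFamily ρ K B) {z : Spacetime} (hz : z ∈ K) :
    IsFiniteMeasure ((ρ z).comap (Subtype.val : B → Spacetime)) := by
  have := (h.supp z hz).finite
  infer_instance

/-- The thermal two-point functions separate the points of `B`, so their products span a dense
subspace of the continuous functions; uniform limits preserve measurability of the expectation
values. -/
theorem aestronglyMeasurable_integral_continuousMap (h : ThermalFamily ρ K B) (a : C(B, ℂ)) :
    AEStronglyMeasurable (fun z => ∫ β, a β ∂((ρ z).comap (Subtype.val : B → Spacetime)))
      (volume.restrict K) := by
  have hBc : CompactSpace B := isCompact_iff_compactSpace.1 h.compactB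
  have hint : ∀ (a : C(B, ℂ)) z, z ∈ K →
      Integrable (fun β => a β) ((ρ z).comap (Subtype.val : B → Spacetime)) := fun a z hz => by
    have := h.isFiniteMeasure_comap hz
    exact (map_continuous a).integrable_of_hasCompactSupport (HasCompactSupport.of_compactSpace _)
  set gen := range (kmsGen B h.subsetB) with hgen
  have hmono : ∀ a ∈ Submonoid.closure (gen ∪ star gen),
      AEStronglyMeasurable (fun z => ∫ β, a β ∂((ρ z).comap (Subtype.val : B → Spacetime)))
        (volume.restrict K) := fun a ha => by
    obtain ⟨P, hP⟩ := exists_list_of_mem_closure_kmsGen h.subsetB ha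
    refine (h.aestronglyMeasurable_prod_wick P []).congr ?_
    rw [EventuallyEq, ae_restrict_iff' h.compact.measurableSet]
    refine Eventually.of_forall fun z hz => ?_
    simp only [hP]
    rw [← h.integral_subtype hz]
    simp [wick]
  have hadj : ∀ a ∈ StarAlgebra.adjoin ℂ gen,
      AEStronglyMeasurable (fun z => ∫ β, a β ∂((ρ z).comap (Subtype.val : B → Spacetime)))
        (volume.restrict K) := fun a ha => by
    have ha' : a ∈ Submodule.span ℂ (Submonoid.closure (gen ∪ star gen) : Set C(B, ℂ)) := by
      rw [← StarAlgebra.adjoin_eq_span]; exact ha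
    clear ha
    induction ha' using Submodule.span_induction with
    | mem a ha => exact hmono a ha
    | zero => simpa using aestronglyMeasurable_const
    | add a b _ _ iha ihb =>
      refine (iha.add ihb).congr ?_
      rw [EventuallyEq, ae_restrict_iff' h.compact.measurableSet]
      refine Eventually.of_forall fun z hz => ?_
      exact (integral_add (hint a z hz) (hint b z hz)).symm
    | smul c a _ iha =>
      refine (iha.const_smul c).congr ?_
      rw [EventuallyEq, ae_restrict_iff' h.compact.measurableSet]
      refine Eventually.of_forall fun z hz => ?_
      exact (integral_smul c _).symm
  have hdense : a ∈ closure (StarAlgebra.adjoin ℂ gen : Set C(B, ℂ)) := by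
    have := ContinuousMap.starSubalgebra_topologicalClosure_eq_top_of_separatesPoints
      (StarAlgebra.adjoin ℂ gen) ?_
    · rw [← StarSubalgebra.topologicalClosure_coe, this]; trivial
    · intro β β' hne
      by_contra hcon
      push Not at hcon
      refine hne (Subtype.ext (eq_of_kmsForm_eq (h.subsetB β.2) (h.subsetB β'.2) fun f g => ?_))
      exact hcon _ ⟨kmsGen B h.subsetB (f, g),
        StarAlgebra.subset_adjoin ℂ _ ⟨(f, g), rfl⟩, rfl⟩
  obtain ⟨u, hu, hlim⟩ := mem_closure_iff_seq_limit.1 hdense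
  refine aestronglyMeasurable_of_tendsto_ae atTop (fun n => hadj (u n) (hu n)) ?_
  rw [ae_restrict_iff' h.compact.measurableSet]
  refine Eventually.of_forall fun z hz => ?_
  have := h.isFiniteMeasure_comap hz
  obtain ⟨M, hM⟩ := hlim.norm.bddAbove_range
  refine tendsto_integral_of_dominated_convergence (fun _ => M)
    (fun n => (hint (u n) z hz).1) (integrable_const _)
    (fun n => Eventually.of_forall fun β => ?_) (Eventually.of_forall fun β => ?_)
  · exact ((u n).norm_coe_le_norm β).trans (hM ⟨n, rfl⟩)
  · exact ((continuous_eval_const β).tendsto a).comp hlim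

theorem aestronglyMeasurable_integral (h : ThermalFamily ρ K B) {ψ : Spacetime → ℂ}
    (hψ : ContinuousOn ψ B) :
    AEStronglyMeasurable (fun z => ∫ β, ψ β ∂ρ z) (volume.restrict K) := by
  have hc := continuousOn_iff_continuous_domRestrict.1 hψ
  refine (h.aestronglyMeasurable_integral_continuousMap ⟨_, hc⟩).congr ?_
  rw [EventuallyEq, ae_restrict_iff' h.compact.measurableSet]
  exact Eventually.of_forall fun z hz => h.integral_subtype hz ψ

theorem norm_integral_le (h : ThermalFamily ρ K B) {E : Type*} [NormedAddCommGroup E]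
    [NormedSpace ℝ E] {ψ : Spacetime → E} {C : ℝ}
    (hC : ∀ β ∈ B, ‖ψ β‖ ≤ C) {z : Spacetime} (hz : z ∈ K) : ‖∫ β, ψ β ∂ρ z‖ ≤ C := by
  have := h.prob z hz
  have := norm_integral_le_of_norm_le_const (μ := ρ z) (f := ψ) (C := C)
    ((h.supp z hz).ae_mem.mono hC)
  simpa using this

/-- The averages of the expectation values exist. -/
theorem integrable_mul (h : ThermalFamily ρ K B) {g : Spacetime → ℂ} (hg : Continuous g)
    (hgc : HasCompactSupport g) (hgK : tsupport g ⊆ K) {ψ : Spacetime → ℂ}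
    (hψ : ContinuousOn ψ B) : Integrable fun z => g z * ∫ β, ψ β ∂ρ z := by
  obtain ⟨C, hC⟩ := h.compactB.exists_bound_of_continuousOn hψ
  have h1 : Integrable (fun z => g z * ∫ β, ψ β ∂ρ z) (volume.restrict K) :=
    ((hg.integrable_of_hasCompactSupport hgc).restrict).mul_bdd
      (h.aestronglyMeasurable_integral hψ) (by
        rw [ae_restrict_iff' h.compact.measurableSet]
        exact Eventually.of_forall fun z hz => h.norm_integral_le hC hz)
  refine (integrableOn_iff_integrable_of_support_subset fun z hz => hgK ?_).1 h1
  exact subset_tsupport _ (left_ne_zero_of_mul hz)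

theorem integrable_mul_real (h : ThermalFamily ρ K B) {g : Spacetime → ℝ} (hg : Continuous g)
    (hgc : HasCompactSupport g) (hgK : tsupport g ⊆ K) {ψ : Spacetime → ℝ}
    (hψ : ContinuousOn ψ B) : Integrable fun z => g z * ∫ β, ψ β ∂ρ z := by
  have h1 := h.integrable_mul (g := fun z => (g z : ℂ)) (by fun_prop)
    (hgc.comp_left Complex.ofReal_zero)
    ((closure_mono fun z hz => by simpa using hz).trans hgK)
    (ψ := fun β => (ψ β : ℂ)) (Complex.continuous_ofReal.comp_continuousOn hψ)
  have := h1.re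
  simpa only [integral_complex_ofReal, ← Complex.ofReal_mul, RCLike.re_to_complex,
    Complex.ofReal_re] using this

/-- The average of a family of reference states with a non-negative weight is a reference state. -/
theorem exists_average (h : ThermalFamily ρ K B) {g : Spacetime → ℝ} (hg : Continuous g)
    (hgc : HasCompactSupport g) (hgK : tsupport g ⊆ K) (hg0 : ∀ z, 0 ≤ g z) :
    ∃ σ, SupportedIn σ B ∧ ∀ ψ : Spacetime → ℂ, ContinuousOn ψ B →
      ∫ β, ψ β ∂σ = ∫ z, (g z : ℂ) * ∫ β, ψ β ∂ρ z := by
  have hBc : CompactSpace B := isCompact_iff_compactSpace.1 h.compactB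
  have hBm := h.compactB.measurableSet
  have hint : ∀ a : C_c(B, ℝ), Integrable fun z =>
      g z * ∫ β, a β ∂((ρ z).comap (Subtype.val : B → Spacetime)) := fun a => by
    have hext : ∀ β : B, Function.extend Subtype.val a 0 (β : Spacetime) = a β := fun β =>
      Subtype.val_injective.extend_apply _ _ _
    have hcont : ContinuousOn (Function.extend Subtype.val a 0 : Spacetime → ℝ) B := by
      rw [continuousOn_iff_continuous_domRestrict]
      exact (map_continuous a).congr fun β => (hext β).symm
    refine (h.integrable_mul_real hg hgc hgK hcont).congr (Eventually.of_forall fun z => ?_)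
    by_cases hz : z ∈ K
    · simp only [← hext]
      rw [integral_subtype_comap hBm, (h.supp z hz).restrict]
    · simp [image_eq_zero_of_notMem_tsupport fun hz' => hz (hgK hz')]
  have hbi : ∀ (a : C_c(B, ℝ)) (z : Spacetime), z ∈ K →
      Integrable (fun β => a β) ((ρ z).comap (Subtype.val : B → Spacetime)) := fun a z hz => by
    have := h.isFiniteMeasure_comap hz
    exact (map_continuous a).integrable_of_hasCompactSupport (HasCompactSupport.of_compactSpace _)
  let Λ₀ : C_c(B, ℝ) →ₗ[ℝ] ℝ :=
    { toFun := fun a => ∫ z, g z * ∫ β, a β ∂((ρ z).comap (Subtype.val : B → Spacetime))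
      map_add' := fun a b => by
        rw [← integral_add (hint a) (hint b)]
        refine integral_congr_ae (Eventually.of_forall fun z => ?_)
        by_cases hz : z ∈ K
        · simp only [CompactlySupportedContinuousMap.coe_add, Pi.add_apply]
          rw [integral_add (hbi a z hz) (hbi b z hz), mul_add]
        · simp [image_eq_zero_of_notMem_tsupport fun hz' => hz (hgK hz')]
      map_smul' := fun c a => by
        rw [RingHom.id_apply, smul_eq_mul, ← integral_const_mul]
        congr 1
        funext z
        simp only [CompactlySupportedContinuousMap.coe_smul, Pi.smul_apply, smul_eq_mul,
          integral_const_mul]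
        ring }
  -- Non-negativity of the weight makes the averaged expectation value a positive functional, and
  -- its Riesz measure, pushed forward to spacetime, is the average.
  let Λ : C_c(B, ℝ) →ₚ[ℝ] ℝ := PositiveLinearMap.mk₀ Λ₀ fun a ha =>
    integral_nonneg fun z => mul_nonneg (hg0 z) (integral_nonneg fun β => ha β)
  have hreal : ∀ ψ : Spacetime → ℝ, ContinuousOn ψ B →
      ∫ β, ψ β ∂((RealRMK.rieszMeasure Λ).map Subtype.val) = ∫ z, g z * ∫ β, ψ β ∂ρ z := by
    intro ψ hψ
    have hc := continuousOn_iff_continuous_domRestrict.1 hψ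
    rw [(MeasurableEmbedding.subtype_coe hBm).integral_map]
    refine (RealRMK.integral_rieszMeasure Λ ⟨⟨_, hc⟩, HasCompactSupport.of_compactSpace _⟩).trans ?_
    refine integral_congr_ae (Eventually.of_forall fun z => ?_)
    by_cases hz : z ∈ K
    · change g z * ∫ β : B, ψ β ∂((ρ z).comap Subtype.val) = _
      rw [integral_subtype_comap hBm, (h.supp z hz).restrict]
    · simp [image_eq_zero_of_notMem_tsupport fun hz' => hz (hgK hz')]
  have hsupp : SupportedIn ((RealRMK.rieszMeasure Λ).map Subtype.val) B := by
    refine ⟨inferInstance, h.compactB, h.subsetB, ?_⟩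
    rw [Measure.map_apply measurable_subtype_coe hBm.compl]
    simp
  refine ⟨_, hsupp, fun ψ hψ => ?_⟩
  have hre : ContinuousOn (fun β => (ψ β).re) B := Complex.continuous_re.comp_continuousOn hψ
  have him : ContinuousOn (fun β => (ψ β).im) B := Complex.continuous_im.comp_continuousOn hψ
  have hψi : ∀ z ∈ K, Integrable ψ (ρ z) := fun z hz => by
    have := (h.supp z hz).finite
    rw [← (h.supp z hz).restrict]
    exact hψ.integrableOn_compact h.compactB
  have hψσ : Integrable ψ ((RealRMK.rieszMeasure Λ).map Subtype.val) := by
    have := hsupp.finite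
    rw [← hsupp.restrict]
    exact hψ.integrableOn_compact h.compactB
  -- The complex identity is tested with the real and the imaginary part.
  have key : ∀ L : ℂ →L[ℝ] ℝ, ContinuousOn (fun β => L (ψ β)) B →
      L (∫ β, ψ β ∂((RealRMK.rieszMeasure Λ).map Subtype.val)) =
        L (∫ z, (g z : ℂ) * ∫ β, ψ β ∂ρ z) := by
    intro L hL
    rw [← L.integral_comp_comm hψσ, hreal _ hL,
      ← L.integral_comp_comm (h.integrable_mul (g := fun z => (g z : ℂ)) (by fun_prop)
        (hgc.comp_left Complex.ofReal_zero)
        ((closure_mono fun z hz => by simpa using hz).trans hgK) hψ)]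
    refine integral_congr_ae (Eventually.of_forall fun z => ?_)
    by_cases hz : z ∈ K
    · simp only [← Complex.real_smul, map_smul, smul_eq_mul]
      rw [← L.integral_comp_comm (hψi z hz)]
    · simp [image_eq_zero_of_notMem_tsupport fun hz' => hz (hgK hz')]
  exact Complex.ext (key Complex.reCLM hre) (key Complex.imCLM him)

end ThermalFamily

/-! ### Integrals with parameters over a compact set -/

section parameter

variable {P E : Type*} [NormedAddCommGroup E]

/-- A kernel need only be regular for `z` in the open set `Z`. As the weight vanishes off the closed
set `K ⊆ Z`, the product is continuous for all `z`. -/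
theorem continuousOn_prod_univ [TopologicalSpace P] {Ψ : P → Spacetime → E} {T : Set P} {Z K : Set Spacetime}
    (hZ : IsOpen Z) (hK : IsClosed K) (hKZ : K ⊆ Z)
    (h : ContinuousOn (Function.uncurry Ψ) (T ×ˢ Z)) (h0 : ∀ p ∈ T, ∀ z, z ∉ K → Ψ p z = 0) :
    ContinuousOn (Function.uncurry Ψ) (T ×ˢ univ) := by
  rintro ⟨p, z⟩ ⟨hp, -⟩
  by_cases hz : z ∈ Z
  · refine (h (p, z) ⟨hp, hz⟩).mono_of_mem_nhdsWithin ?_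
    have : T ×ˢ Z = (T ×ˢ univ) ∩ Prod.snd ⁻¹' Z := by ext; simp
    rw [this]
    exact inter_mem_nhdsWithin _ ((hZ.preimage continuous_snd).mem_nhds hz)
  · have hzK : z ∉ K := fun h' => hz (hKZ h')
    have hev : Function.uncurry Ψ =ᶠ[𝓝[T ×ˢ univ] (p, z)] fun _ => 0 := by
      have h1 : ∀ᶠ q : P × Spacetime in 𝓝[T ×ˢ univ] (p, z), q.2 ∉ K :=
        nhdsWithin_le_nhds ((hK.isOpen_compl.preimage continuous_snd).mem_nhds hzK)
      filter_upwards [h1, self_mem_nhdsWithin] with q hq hqT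
      exact h0 q.1 hqT.1 q.2 hq
    exact continuousWithinAt_const.congr_of_eventuallyEq hev (h0 p hp z hzK)

theorem integrable_section [TopologicalSpace P] {Ψ : P → Spacetime → E} {T : Set P} {K : Set Spacetime}
    (hK : IsCompact K) (h : ContinuousOn (Function.uncurry Ψ) (T ×ˢ univ))
    (h0 : ∀ p ∈ T, ∀ z, z ∉ K → Ψ p z = 0) {p : P} (hp : p ∈ T) :
    Continuous (Ψ p) ∧ Integrable (Ψ p) := by
  have hc : Continuous (Ψ p) := by
    rw [← continuousOn_univ]
    exact h.comp (f := fun z => (p, z)) (by fun_prop) fun z _ => ⟨hp, trivial⟩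
  exact ⟨hc, hc.integrable_of_hasCompactSupport (HasCompactSupport.intro hK (h0 p hp))⟩

/-- Near `p` the derivative is bounded on a compact set of parameters times `K`, and it vanishes off
`K`; this is an integrable bound. -/
theorem hasFDerivAt_integral_of_isCompact [NormedAddCommGroup P] [NormedSpace ℝ P]
    [ProperSpace P] [NormedSpace ℝ E] {Ψ : P → Spacetime → E}
    {Ψ' : P → Spacetime → P →L[ℝ] E} {T : Set P} (hT : IsOpen T) {K : Set Spacetime}
    (hK : IsCompact K) (h : ContinuousOn (Function.uncurry Ψ) (T ×ˢ univ))
    (h' : ContinuousOn (Function.uncurry Ψ') (T ×ˢ univ))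
    (h0 : ∀ p ∈ T, ∀ z, z ∉ K → Ψ p z = 0) (h0' : ∀ p ∈ T, ∀ z, z ∉ K → Ψ' p z = 0)
    (hd : ∀ p ∈ T, ∀ z, HasFDerivAt (fun p => Ψ p z) (Ψ' p z) p) {p : P} (hp : p ∈ T) :
    HasFDerivAt (fun p => ∫ z, Ψ p z) (∫ z, Ψ' p z) p := by
  obtain ⟨N, hN, hNT, hNc⟩ := local_compact_nhds (hT.mem_nhds hp)
  obtain ⟨C, hC⟩ := (hNc.prod hK).exists_bound_of_continuousOn
    (h'.mono (prod_mono hNT (subset_univ _)))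
  refine hasFDerivAt_integral_of_dominated_of_fderiv_le (s := N) (bound := K.indicator fun _ => C)
    hN ?_ (integrable_section hK h h0 hp).2 (integrable_section hK h' h0' hp).2.1 ?_ ?_ ?_
  · filter_upwards [hT.mem_nhds hp] with q hq
    exact (integrable_section hK h h0 hq).2.1
  · refine Eventually.of_forall fun z q hq => ?_
    by_cases hz : z ∈ K
    · rw [indicator_of_mem hz]; exact hC (q, z) ⟨hq, hz⟩
    · rw [indicator_of_notMem hz, h0' q (hNT hq) z hz, norm_zero]
  · exact (integrable_indicator_iff hK.measurableSet).2 (integrableOn_const hK.measure_lt_top.ne)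
  · exact Eventually.of_forall fun z q hq => hd q (hNT hq) z

theorem continuousOn_integral_of_isCompact [TopologicalSpace P] [NormedSpace ℝ E]
    {Ψ : P → Spacetime → E} {T : Set P} {K : Set Spacetime}
    (hK : IsCompact K) (h : ContinuousOn (Function.uncurry Ψ) (T ×ˢ univ))
    (h0 : ∀ p ∈ T, ∀ z, z ∉ K → Ψ p z = 0) : ContinuousOn (fun p => ∫ z, Ψ p z) T :=
  continuousOn_integral_of_compact_support hK h fun p z hp hz => h0 p hp z hz

end parameter

/-! ### Averages of kernels -/

/-- The average of the derivatives of a family of kernels. -/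
def kernelAvg (w : Spacetime → Spacetime → ℂ) (h : Spacetime → ℂ) (m : ℕ) (x ζ : Spacetime) :
    Spacetime [×m]→L[ℝ] ℂ :=
  ∫ z, h (z - x) • iteratedFDeriv ℝ m (w z) ζ

/-- A family of kernels `w z`, smooth on the open set `S` for `z ∈ Z`, with a compact subset `K` of
`Z`, which contains all points `x + y` with `x ∈ T` and `y` in the support of a weight. -/
structure KernelFamily (w : Spacetime → Spacetime → ℂ) (Z S K T : Set Spacetime) : Prop where
  isOpenZ : IsOpen Z
  isOpenS : IsOpen S
  isOpenT : IsOpen T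
  compact : IsCompact K
  subset : K ⊆ Z
  smooth : ∀ z ∈ Z, ∀ ζ ∈ S, ContDiffAt ℝ (⊤ : ℕ∞) (w z) ζ
  cont : ∀ m : ℕ, ContinuousOn (fun q : Spacetime × Spacetime => iteratedFDeriv ℝ m (w q.1) q.2)
    (Z ×ˢ S)

/-- Smooth weights with support in `K - T`. -/
structure IsWeight (h : Spacetime → ℂ) (K T : Set Spacetime) : Prop where
  smooth : ContDiff ℝ (⊤ : ℕ∞) h
  mem : ∀ x ∈ T, ∀ y ∈ tsupport h, x + y ∈ K

/-- The directional derivative. -/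
def dirDeriv (e : Spacetime) (h : Spacetime → ℂ) (y : Spacetime) : ℂ := fderiv ℝ h y e

theorem IsWeight.dirDeriv {h : Spacetime → ℂ} {K T : Set Spacetime} (hh : IsWeight h K T)
    (e : Spacetime) : IsWeight (dirDeriv e h) K T where
  smooth := (hh.smooth.fderiv_right (by exact_mod_cast le_top)).clm_apply contDiff_const
  mem x hx y hy := hh.mem x hx y (tsupport_fderiv_apply_subset ℝ e hy)

theorem IsWeight.eq_zero {h : Spacetime → ℂ} {K T : Set Spacetime} (hh : IsWeight h K T)
    {x z : Spacetime} (hx : x ∈ T) (hz : z ∉ K) : h (z - x) = 0 :=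
  image_eq_zero_of_notMem_tsupport fun hy => hz (by simpa using hh.mem x hx _ hy)

theorem IsWeight.fderiv_eq_zero {h : Spacetime → ℂ} {K T : Set Spacetime} (hh : IsWeight h K T)
    {x z : Spacetime} (hx : x ∈ T) (hz : z ∉ K) : fderiv ℝ h (z - x) = 0 := by
  ext e
  exact (hh.dirDeriv e).eq_zero hx hz

namespace KernelFamily

variable {w : Spacetime → Spacetime → ℂ} {Z S K T : Set Spacetime} {h : Spacetime → ℂ}

theorem hasFDerivAt (hw : KernelFamily w Z S K T) (m : ℕ) {z ζ : Spacetime} (hz : z ∈ Z)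
    (hζ : ζ ∈ S) : HasFDerivAt (iteratedFDeriv ℝ m (w z))
      (iteratedFDeriv ℝ (m + 1) (w z) ζ).curryLeft ζ := by
  have h1 := (hw.smooth z hz ζ hζ).differentiableAt_iteratedFDeriv (m := m)
    (by exact_mod_cast ENat.natCast_lt_top m)
  have h2 := h1.hasFDerivAt
  rw [fderiv_iteratedFDeriv] at h2
  exact h2

/-- The integrand of an average. -/
def integrand (w : Spacetime → Spacetime → ℂ) (h : Spacetime → ℂ) (m : ℕ)
    (q : Spacetime × Spacetime) (z : Spacetime) : Spacetime [×m]→L[ℝ] ℂ :=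
  h (z - q.1) • iteratedFDeriv ℝ m (w z) q.2

/-- The derivative of the integrand of an average. -/
def integrandDeriv (w : Spacetime → Spacetime → ℂ) (h : Spacetime → ℂ) (m : ℕ)
    (q : Spacetime × Spacetime) (z : Spacetime) :
    Spacetime × Spacetime →L[ℝ] Spacetime [×m]→L[ℝ] ℂ :=
  h (z - q.1) • ((iteratedFDeriv ℝ (m + 1) (w z) q.2).curryLeft ∘L
      ContinuousLinearMap.snd ℝ Spacetime Spacetime) +
    (-(fderiv ℝ h (z - q.1) ∘L ContinuousLinearMap.fst ℝ Spacetime Spacetime)).smulRight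
      (iteratedFDeriv ℝ m (w z) q.2)

theorem integrand_eq_zero (hh : IsWeight h K T) (m : ℕ) (q : Spacetime × Spacetime)
    (hq : q ∈ T ×ˢ S) (z : Spacetime) (hz : z ∉ K) : integrand w h m q z = 0 := by
  rw [integrand, hh.eq_zero hq.1 hz, zero_smul]

theorem integrandDeriv_eq_zero (hh : IsWeight h K T) (m : ℕ) (q : Spacetime × Spacetime)
    (hq : q ∈ T ×ˢ S) (z : Spacetime) (hz : z ∉ K) : integrandDeriv w h m q z = 0 := by
  rw [integrandDeriv, hh.eq_zero hq.1 hz, hh.fderiv_eq_zero hq.1 hz]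
  refine ContinuousLinearMap.ext fun e => ContinuousMultilinearMap.ext fun v => ?_
  simp

theorem continuousOn_comp (hw : KernelFamily w Z S K T) (m : ℕ) :
    ContinuousOn (fun r : (Spacetime × Spacetime) × Spacetime =>
      iteratedFDeriv ℝ m (w r.2) r.1.2) ((T ×ˢ S) ×ˢ Z) :=
  (hw.cont m).comp (f := fun r : (Spacetime × Spacetime) × Spacetime => (r.2, r.1.2))
    (by fun_prop) fun r hr => ⟨hr.2, hr.1.2⟩

theorem continuousOn_integrand (hw : KernelFamily w Z S K T) (hh : IsWeight h K T) (m : ℕ) :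
    ContinuousOn (Function.uncurry (integrand w h m)) ((T ×ˢ S) ×ˢ univ) := by
  refine continuousOn_prod_univ hw.isOpenZ hw.compact.isClosed hw.subset ?_
    (integrand_eq_zero hh m)
  have := hh.smooth.continuous
  exact (by fun_prop : Continuous fun r : (Spacetime × Spacetime) × Spacetime =>
    h (r.2 - r.1.1)).continuousOn.smul (hw.continuousOn_comp m)

theorem continuousOn_integrandDeriv (hw : KernelFamily w Z S K T) (hh : IsWeight h K T) (m : ℕ) :
    ContinuousOn (Function.uncurry (integrandDeriv w h m)) ((T ×ˢ S) ×ˢ univ) := by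
  refine continuousOn_prod_univ (Ψ := integrandDeriv w h m) hw.isOpenZ hw.compact.isClosed hw.subset ?_
    (integrandDeriv_eq_zero hh m)
  have h1 := hh.smooth.continuous
  have h2 : Continuous (fderiv ℝ h) := hh.smooth.continuous_fderiv (by simp)
  have h3 : ContinuousOn (fun r : (Spacetime × Spacetime) × Spacetime =>
      (iteratedFDeriv ℝ (m + 1) (w r.2) r.1.2).curryLeft) ((T ×ˢ S) ×ˢ Z) :=
    (continuousMultilinearCurryLeftEquiv ℝ (fun _ : Fin (m + 1) => Spacetime)
      ℂ).continuous.comp_continuousOn (hw.continuousOn_comp (m + 1))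
  have h4 : Continuous fun r : (Spacetime × Spacetime) × Spacetime => h (r.2 - r.1.1) := by
    fun_prop
  have h5 : Continuous fun r : (Spacetime × Spacetime) × Spacetime =>
      -(fderiv ℝ h (r.2 - r.1.1) ∘L ContinuousLinearMap.fst ℝ Spacetime Spacetime) := by
    fun_prop
  exact (h4.continuousOn.smul (h3.clm_comp continuousOn_const)).add
    (((ContinuousLinearMap.lsmul ℝ ℂ (E := Spacetime [×m]→L[ℝ] ℂ)).flip.continuous.comp_continuousOn
      (hw.continuousOn_comp m)).clm_comp h5.continuousOn)

theorem hasFDerivAt_integrand (hw : KernelFamily w Z S K T) (hh : IsWeight h K T) (m : ℕ)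
    (q : Spacetime × Spacetime) (hq : q ∈ T ×ˢ S) (z : Spacetime) :
    HasFDerivAt (fun q => integrand w h m q z) (integrandDeriv w h m q z) q := by
  by_cases hz : z ∈ K
  · have h1 : HasFDerivAt (fun q : Spacetime × Spacetime => h (z - q.1))
        (-(fderiv ℝ h (z - q.1) ∘L ContinuousLinearMap.fst ℝ Spacetime Spacetime)) q := by
      have ha := (hh.smooth.differentiable (by simp) (z - q.1)).hasFDerivAt
      have hb := ha.comp q ((hasFDerivAt_fst (𝕜 := ℝ) (p := q)).const_sub z)
      rw [← ContinuousLinearMap.comp_neg]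
      exact hb
    have h2 := (hw.hasFDerivAt m (hw.subset hz) hq.2).comp q (hasFDerivAt_snd (𝕜 := ℝ) (p := q))
    exact h1.smul h2
  · rw [integrandDeriv_eq_zero hh m q hq z hz]
    refine (hasFDerivAt_const (0 : Spacetime [×m]→L[ℝ] ℂ) q).congr_of_eventuallyEq ?_
    filter_upwards [(hw.isOpenT.prod hw.isOpenS).mem_nhds hq] with q' hq'
    exact integrand_eq_zero hh m q' hq' z hz

theorem integrable_integrand (hw : KernelFamily w Z S K T) (hh : IsWeight h K T) (m : ℕ)
    {x ζ : Spacetime} (hx : x ∈ T) (hζ : ζ ∈ S) :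
    Integrable fun z => h (z - x) • iteratedFDeriv ℝ m (w z) ζ :=
  (integrable_section hw.compact (hw.continuousOn_integrand hh m) (integrand_eq_zero hh m)
    (p := (x, ζ)) ⟨hx, hζ⟩).2

theorem continuousOn_kernelAvg (hw : KernelFamily w Z S K T) (hh : IsWeight h K T) (m : ℕ) :
    ContinuousOn (fun q : Spacetime × Spacetime => kernelAvg w h m q.1 q.2) (T ×ˢ S) :=
  continuousOn_integral_of_isCompact hw.compact (hw.continuousOn_integrand hh m)
    (integrand_eq_zero hh m)

theorem kernelAvg_apply (hw : KernelFamily w Z S K T) (hh : IsWeight h K T) {m : ℕ}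
    {x ζ : Spacetime} (hx : x ∈ T) (hζ : ζ ∈ S) (v : Fin m → Spacetime) :
    kernelAvg w h m x ζ v = ∫ z, h (z - x) * iteratedFDeriv ℝ m (w z) ζ v := by
  rw [kernelAvg, ContinuousMultilinearMap.integral_apply (hw.integrable_integrand hh m hx hζ)]
  rfl

/-- The variable `x` occurs in the weight only. Its derivatives fall on `h`, with a minus sign, so
averaging makes the kernel smooth in `x` although the original kernel is merely continuous there. -/
theorem exists_hasFDerivAt_kernelAvg (hw : KernelFamily w Z S K T) (hh : IsWeight h K T) (m : ℕ)
    {x ζ : Spacetime} (hx : x ∈ T) (hζ : ζ ∈ S) :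
    ∃ L : Spacetime × Spacetime →L[ℝ] Spacetime [×m]→L[ℝ] ℂ,
      HasFDerivAt (fun q : Spacetime × Spacetime => kernelAvg w h m q.1 q.2) L (x, ζ) ∧
      ∀ e e', L (e, e') = (kernelAvg w h (m + 1) x ζ).curryLeft e' -
        kernelAvg w (dirDeriv e h) m x ζ := by
  have hq : (x, ζ) ∈ T ×ˢ S := ⟨hx, hζ⟩
  have hT := hw.isOpenT.prod hw.isOpenS
  refine ⟨_, hasFDerivAt_integral_of_isCompact hT hw.compact (hw.continuousOn_integrand hh m)
    (hw.continuousOn_integrandDeriv hh m) (integrand_eq_zero hh m) (integrandDeriv_eq_zero hh m)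
    (hw.hasFDerivAt_integrand hh m) hq, fun e e' => ?_⟩
  have hi' := (integrable_section (Ψ := integrandDeriv w h m) hw.compact
    (hw.continuousOn_integrandDeriv hh m)
    (integrandDeriv_eq_zero hh m) hq).2
  rw [ContinuousLinearMap.integral_apply hi']
  let A : (Spacetime [×(m + 1)]→L[ℝ] ℂ) →L[ℝ] (Spacetime [×m]→L[ℝ] ℂ) :=
    (ContinuousLinearMap.apply ℝ (Spacetime [×m]→L[ℝ] ℂ) e') ∘L
      ((continuousMultilinearCurryLeftEquiv ℝ (fun _ : Fin (m + 1) => Spacetime)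
        ℂ).toContinuousLinearEquiv : _ →L[ℝ] _)
  have hA : ∀ u, A u = u.curryLeft e' := fun u => rfl
  have hi1 := hw.integrable_integrand hh (m + 1) hx hζ
  have hi2 := hw.integrable_integrand (hh.dirDeriv e) m hx hζ
  rw [← hA, kernelAvg, ← A.integral_comp_comm hi1, kernelAvg,
    ← integral_sub (A.integrable_comp hi1) hi2]
  congr 1
  funext z
  rw [hA]
  ext v
  simp [integrandDeriv, LocalEq.dirDeriv, sub_eq_add_neg]

end KernelFamily

/-- The average of a family of kernels. -/
def avg (w : Spacetime → Spacetime → ℂ) (h : Spacetime → ℂ) (x ζ : Spacetime) : ℂ :=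
  ∫ z, h (z - x) * w z ζ

namespace KernelFamily

variable {w : Spacetime → Spacetime → ℂ} {Z S K T : Set Spacetime} {h : Spacetime → ℂ}

theorem kernelAvg_zero (hw : KernelFamily w Z S K T) (hh : IsWeight h K T) {x ζ : Spacetime}
    (hx : x ∈ T) (hζ : ζ ∈ S) (v : Fin 0 → Spacetime) : kernelAvg w h 0 x ζ v = avg w h x ζ := by
  rw [hw.kernelAvg_apply hh hx hζ]
  rfl

theorem hasFDerivAt_kernelAvg (hw : KernelFamily w Z S K T) (hh : IsWeight h K T) (m : ℕ)
    {x ζ : Spacetime} (hx : x ∈ T) (hζ : ζ ∈ S) :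
    HasFDerivAt (kernelAvg w h m x) (kernelAvg w h (m + 1) x ζ).curryLeft ζ := by
  obtain ⟨L, hL, hLe⟩ := hw.exists_hasFDerivAt_kernelAvg hh m hx hζ
  have h1 := hL.comp ζ (hasFDerivAt_prodMk_right (𝕜 := ℝ) x ζ)
  have h3 : kernelAvg w (LocalEq.dirDeriv 0 h) m x ζ = 0 := by
    simp [kernelAvg, LocalEq.dirDeriv]
  have h4 : (kernelAvg w h (m + 1) x ζ).curryLeft =
      L ∘L ContinuousLinearMap.inr ℝ Spacetime Spacetime := by
    refine ContinuousLinearMap.ext fun e' => ?_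
    have h2 := hLe 0 e'
    rw [h3, sub_zero] at h2
    exact h2.symm
  rw [h4]
  exact h1

theorem hasFTaylorSeriesUpToOn (hw : KernelFamily w Z S K T) (hh : IsWeight h K T) {x : Spacetime}
    (hx : x ∈ T) : HasFTaylorSeriesUpToOn (⊤ : ℕ∞) (avg w h x) (fun ζ m => kernelAvg w h m x ζ) S where
  zero_eq ζ hζ := hw.kernelAvg_zero hh hx hζ _
  fderivWithin m _ ζ hζ := (hw.hasFDerivAt_kernelAvg hh m hx hζ).hasFDerivWithinAt
  cont m _ := (hw.continuousOn_kernelAvg hh m).comp (f := fun ζ => (x, ζ)) (by fun_prop)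
    fun ζ hζ => ⟨hx, hζ⟩

theorem contDiffAt_avg (hw : KernelFamily w Z S K T) (hh : IsWeight h K T) {x ζ : Spacetime}
    (hx : x ∈ T) (hζ : ζ ∈ S) : ContDiffAt ℝ (⊤ : ℕ∞) (avg w h x) ζ :=
  (hw.hasFTaylorSeriesUpToOn hh hx).contDiffOn.contDiffAt (hw.isOpenS.mem_nhds hζ)

theorem iteratedFDeriv_avg (hw : KernelFamily w Z S K T) (hh : IsWeight h K T) {x ζ : Spacetime}
    (hx : x ∈ T) (hζ : ζ ∈ S) (m : ℕ) :
    iteratedFDeriv ℝ m (avg w h x) ζ = kernelAvg w h m x ζ := by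
  rw [← iteratedFDerivWithin_of_isOpen m hw.isOpenS hζ]
  exact ((hw.hasFTaylorSeriesUpToOn hh hx).eq_iteratedFDerivWithin_of_uniqueDiffOn
    (by exact_mod_cast le_top) hw.isOpenS.uniqueDiffOn hζ).symm

theorem continuousOn_avg (hw : KernelFamily w Z S K T) (hh : IsWeight h K T) :
    ContinuousOn (fun q : Spacetime × Spacetime => avg w h q.1 q.2) (T ×ˢ S) := by
  refine ((ContinuousMultilinearMap.apply ℝ (fun _ : Fin 0 => Spacetime) ℂ
    0).continuous.comp_continuousOn (hw.continuousOn_kernelAvg hh 0)).congr fun q hq => ?_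
  exact (hw.kernelAvg_zero hh hq.1 hq.2 0).symm

end KernelFamily

/-! ### The two-point function of a regularized state -/

theorem State.twoPoint_translation (ω : State) (y : Spacetime) (f g : TestFn) :
    ω.toLin (translation y (field f * field g)) = ω.twoPoint (translT y f) (translT y g) := by
  rw [map_mul, translation, liftField_field, liftField_field]
  rfl

theorem tsupport_translT (y : Spacetime) (f : TestFn) {x : Spacetime}
    (hx : x ∈ tsupport (translT y f).1) : x - y ∈ tsupport f.1 := by
  have h : tsupport (translT y f).1 ⊆ (fun x => x - y) ⁻¹' tsupport f.1 :=
    closure_minimal (fun z hz => subset_tsupport _ hz)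
      ((isClosed_tsupport _).preimage (by fun_prop))
  exact h hx

theorem tsupport_ofReal_comp (f : Spacetime → ℝ) : tsupport (fun y => (f y : ℂ)) = tsupport f := by
  unfold tsupport
  congr 1
  ext x
  simp

/-- A common translation of both arguments shifts the midpoint and leaves the difference and the
vacuum term unchanged. -/
theorem kernel_transl {ω : State} {w : Spacetime → Spacetime → ℂ} {U : Set (Spacetime × Spacetime)}
    (hk : IsKernelOn ω.twoPoint U w) (y : Spacetime) (f g : TestFn)
    (hfg : ∀ x₁ ∈ tsupport f.1, ∀ x₂ ∈ tsupport g.1,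
      ((1 / 2 : ℝ) • (x₁ + x₂) + y, (1 / 2 : ℝ) • (x₁ - x₂)) ∈ U ∧
        (1 / 2 : ℝ) • (x₁ - x₂) ∈ spacelike) :
    ω.twoPoint (translT y f) (translT y g) - vacForm f g = ∫ x₁, ∫ x₂, f.1 x₁ * g.1 x₂ *
      w ((1 / 2 : ℝ) • (x₁ + x₂) + y) ((1 / 2 : ℝ) • (x₁ - x₂)) := by
  have e1 : ∀ x₁ x₂ : Spacetime,
      (1 / 2 : ℝ) • ((x₁ - y) + (x₂ - y)) + y = (1 / 2 : ℝ) • (x₁ + x₂) := fun _ _ => by module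
  rw [← vacForm_transl y f g, hk.kernel _ _ fun x₁ h₁ x₂ h₂ => ?_]
  · rw [← integral_sub_right_eq_self (fun x₁ => ∫ x₂, f.1 x₁ * g.1 x₂ *
      w ((1 / 2 : ℝ) • (x₁ + x₂) + y) ((1 / 2 : ℝ) • (x₁ - x₂))) y]
    congr 1
    funext x₁
    rw [← integral_sub_right_eq_self (fun x₂ => f.1 (x₁ - y) * g.1 x₂ *
      w ((1 / 2 : ℝ) • (x₁ - y + x₂) + y) ((1 / 2 : ℝ) • (x₁ - y - x₂))) y]
    simp only [e1, sub_sub_sub_cancel_right]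
    rfl
  · have := hfg _ (tsupport_translT y f h₁) _ (tsupport_translT y g h₂)
    rwa [e1, sub_sub_sub_cancel_right] at this

/-- The kernel of the two-point function of a regularized state. -/
theorem regularized_kernel {ω ωf : State} {f : Spacetime → ℝ} (hf : IsMollifier f)
    (hreg : IsRegularization ω f ωf) {w : Spacetime → Spacetime → ℂ} {Z S K T : Set Spacetime}
    (hw : KernelFamily w Z S K T) (hS : S ⊆ spacelike) (hh : IsWeight (fun y => (f y : ℂ)) K T)
    {V : Set Spacetime}
    (hk : ∀ y ∈ tsupport f, ∃ U, IsKernelOn ω.twoPoint U w ∧ ∀ x ∈ T, ∀ ζ ∈ V, (x + y, ζ) ∈ U)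
    (hSV : S = V ∩ spacelike) (φ χ : TestFn)
    (hφχ : ∀ x₁ ∈ tsupport φ.1, ∀ x₂ ∈ tsupport χ.1,
      (1 / 2 : ℝ) • (x₁ + x₂) ∈ T ∧ (1 / 2 : ℝ) • (x₁ - x₂) ∈ S) :
    ωf.twoPoint φ χ - vacForm φ χ = ∫ x₁, ∫ x₂, φ.1 x₁ * χ.1 x₂ *
      avg w (fun y => (f y : ℂ)) ((1 / 2 : ℝ) • (x₁ + x₂)) ((1 / 2 : ℝ) • (x₁ - x₂)) := by
  have hfc : HasCompactSupport fun y => (f y : ℂ) := hf.compact.comp_left Complex.ofReal_zero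
  have hfcont : Continuous fun y => (f y : ℂ) := Complex.continuous_ofReal.comp hf.smooth.continuous
  have hwc : ContinuousOn (fun q : Spacetime × Spacetime => w q.1 q.2) (Z ×ˢ S) :=
    (ContinuousMultilinearMap.apply ℝ (fun _ : Fin 0 => Spacetime) ℂ
      0).continuous.comp_continuousOn (hw.cont 0)
  have hmem : ∀ y ∈ tsupport f, ∀ x ∈ T, x + y ∈ Z := fun y hy x hx =>
    hw.subset (hh.mem x hx y (by rwa [tsupport_ofReal_comp]))
  obtain ⟨hint, heq⟩ := hreg (field φ * field χ)
  have h1 : ∫ y, (f y : ℂ) = 1 := by rw [integral_complex_ofReal, hf.integral_eq, Complex.ofReal_one]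
  have hfi : Integrable fun y => (f y : ℂ) := hfcont.integrable_of_hasCompactSupport hfc
  -- The vacuum term may be moved under the average because the weight has integral `1`.
  have step1 : ωf.twoPoint φ χ - vacForm φ χ =
      ∫ y, (f y : ℂ) * (ω.twoPoint (translT y φ) (translT y χ) - vacForm φ χ) := by
    simp only [mul_sub, ← State.twoPoint_translation]
    rw [integral_sub hint (hfi.mul_const _), integral_mul_const, h1, one_mul, ← heq]
    rfl
  have step2 : ∀ y, (f y : ℂ) * (ω.twoPoint (translT y φ) (translT y χ) - vacForm φ χ) =
      ∫ q : Spacetime × Spacetime, (f y : ℂ) * (φ.1 q.1 * χ.1 q.2 *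
        w ((midDiff q).1 + y) (midDiff q).2) := by
    intro y
    rw [integral_const_mul]
    by_cases hy : y ∈ tsupport f
    · obtain ⟨U, hU, hmemU⟩ := hk y hy
      rw [kernel_transl hU y φ χ fun x₁ h₁ x₂ h₂ => ?_]
      · congr 1
        have hcont : Continuous fun q => ((midDiff q).1 + y, (midDiff q).2) := by fun_prop
        refine (integral_test_kernel φ χ
          (Q := fun x₁ x₂ => w ((midDiff (x₁, x₂)).1 + y) (midDiff (x₁, x₂)).2)
          (Ω := (fun q => ((midDiff q).1 + y, (midDiff q).2)) ⁻¹' (Z ×ˢ S))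
          ((hw.isOpenZ.prod hw.isOpenS).preimage hcont) ?_ ?_).2
        · exact hwc.comp hcont.continuousOn fun _ h => h
        · rintro ⟨x₁, x₂⟩ ⟨h₁, h₂⟩
          exact ⟨hmem y hy _ (hφχ x₁ h₁ x₂ h₂).1, (hφχ x₁ h₁ x₂ h₂).2⟩
      · have h3 := hφχ x₁ h₁ x₂ h₂
        exact ⟨hmemU _ h3.1 _ (hSV ▸ h3.2).1, hS h3.2⟩
    · rw [image_eq_zero_of_notMem_tsupport hy]
      simp
  have hcont2 : Continuous fun r : Spacetime × (Spacetime × Spacetime) =>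
      ((midDiff r.2).1 + r.1, (midDiff r.2).2) := by fun_prop
  have hts : tsupport (fun r : Spacetime × (Spacetime × Spacetime) =>
      (f r.1 : ℂ) * (φ.1 r.2.1 * χ.1 r.2.2 * w ((midDiff r.2).1 + r.1) (midDiff r.2).2)) ⊆
      tsupport f ×ˢ (tsupport φ.1 ×ˢ tsupport χ.1) := by
    refine closure_minimal (fun r hr => ?_) ((isClosed_tsupport _).prod
      ((isClosed_tsupport _).prod (isClosed_tsupport _)))
    have h2 := left_ne_zero_of_mul (right_ne_zero_of_mul hr)
    exact ⟨subset_tsupport _ fun h0 => left_ne_zero_of_mul hr (by simp [h0]),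
      subset_tsupport _ (left_ne_zero_of_mul h2), subset_tsupport _ (right_ne_zero_of_mul h2)⟩
  have hsub : tsupport f ×ˢ (tsupport φ.1 ×ˢ tsupport χ.1) ⊆
      (fun r : Spacetime × (Spacetime × Spacetime) =>
        ((midDiff r.2).1 + r.1, (midDiff r.2).2)) ⁻¹' (Z ×ˢ S) := by
    rintro ⟨y, x₁, x₂⟩ ⟨hy, h₁, h₂⟩
    exact ⟨hmem y hy _ (hφχ x₁ h₁ x₂ h₂).1, (hφχ x₁ h₁ x₂ h₂).2⟩
  have hcont3 : Continuous (fun r : Spacetime × (Spacetime × Spacetime) =>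
      (f r.1 : ℂ) * (φ.1 r.2.1 * χ.1 r.2.2 * w ((midDiff r.2).1 + r.1) (midDiff r.2).2)) := by
    refine ContinuousOn.continuous_of_tsupport_subset ?_
      ((hw.isOpenZ.prod hw.isOpenS).preimage hcont2) (hts.trans hsub)
    have := φ.2.1.continuous
    have := χ.2.1.continuous
    refine (hfcont.comp continuous_fst).continuousOn.mul (ContinuousOn.mul (by fun_prop) ?_)
    exact hwc.comp hcont2.continuousOn fun _ h => h
  have hcs := (hf.compact.prod (φ.2.2.prod χ.2.2)).of_isClosed_subset (isClosed_tsupport _) hts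
  rw [step1]
  simp only [step2]
  -- The integrand is continuous with compact support in all three variables; after the exchange,
  -- the inner integral over `y` is the averaged kernel once `y` plus the midpoint is the new
  -- variable.
  rw [integral_integral_swap_of_hasCompactSupport (f := fun (y : Spacetime)
    (q : Spacetime × Spacetime) => (f y : ℂ) * (φ.1 q.1 * χ.1 q.2 *
      w ((midDiff q).1 + y) (midDiff q).2)) hcont3 hcs]
  have step3 := (integral_test_kernel φ χ
    (Q := fun x₁ x₂ => avg w (fun y => (f y : ℂ)) (midDiff (x₁, x₂)).1 (midDiff (x₁, x₂)).2)
    (Ω := midDiff ⁻¹' (T ×ˢ S)) ((hw.isOpenT.prod hw.isOpenS).preimage continuous_midDiff)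
    ((hw.continuousOn_avg hh).comp continuous_midDiff.continuousOn fun _ h => h)
    (by rintro ⟨x₁, x₂⟩ ⟨h₁, h₂⟩; exact hφχ x₁ h₁ x₂ h₂)).2
  refine Eq.trans ?_ step3.symm
  congr 1
  funext q
  change _ = φ.1 q.1 * χ.1 q.2 * avg w (fun y => (f y : ℂ)) (midDiff q).1 (midDiff q).2
  rw [avg, ← integral_add_right_eq_self (fun z => (f (z - (midDiff q).1) : ℂ) * w z (midDiff q).2)
    (midDiff q).1, ← integral_const_mul]
  congr 1
  funext y
  rw [add_sub_cancel_right, add_comm y]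
  ring

/-! ### Regularized states are thermal -/

section setup

variable {ω : State} {ρ : Spacetime → Measure Spacetime} {Oω : Set Spacetime}

/-- Thermality gives a radius and a bound near each single point; compactness of `K` makes both
uniform. Without this the averages over `K` could not be dominated. -/
theorem exists_uniform_kernel (hρ : ∀ z ∈ Oω, IsThermalAt ω z (ρ z)) {K : Set Spacetime}
    (hK : IsCompact K) (hKO : K ⊆ Oω) (m : ℕ) : ∃ r > 0, ∃ C, ∀ z ∈ K,
      IsKernelOn ω.twoPoint (Metric.ball z r ×ˢ Metric.ball 0 r) (theKernel ω.twoPoint) ∧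
      ∀ z' ∈ Metric.ball z r, ∀ ζ ∈ Metric.ball (0 : Spacetime) r, ζ ∈ spacelike →
        ‖iteratedFDeriv ℝ m (theKernel ω.twoPoint z') ζ‖ ≤ C := by
  refine hK.induction_on (p := fun K => ∃ r > 0, ∃ C, ∀ z ∈ K,
      IsKernelOn ω.twoPoint (Metric.ball z r ×ˢ Metric.ball 0 r) (theKernel ω.twoPoint) ∧
      ∀ z' ∈ Metric.ball z r, ∀ ζ ∈ Metric.ball (0 : Spacetime) r, ζ ∈ spacelike →
        ‖iteratedFDeriv ℝ m (theKernel ω.twoPoint z') ζ‖ ≤ C) ?_ ?_ ?_ ?_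
  · exact ⟨1, one_pos, 0, by simp⟩
  · rintro s t hst ⟨r, hr, C, h⟩
    exact ⟨r, hr, C, fun z hz => h z (hst hz)⟩
  · rintro s t ⟨r, hr, C, h⟩ ⟨r', hr', C', h'⟩
    have h1 : ∀ c : Spacetime, Metric.ball c (min r r') ⊆ Metric.ball c r := fun c =>
      Metric.ball_subset_ball (min_le_left _ _)
    have h2 : ∀ c : Spacetime, Metric.ball c (min r r') ⊆ Metric.ball c r' := fun c =>
      Metric.ball_subset_ball (min_le_right _ _)
    refine ⟨min r r', lt_min hr hr', max C C', ?_⟩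
    rintro z (hz | hz)
    · exact ⟨(h z hz).1.mono (Set.prod_mono (h1 z) (h1 0)), fun z' hz' ζ hζ hs =>
        ((h z hz).2 z' (h1 z hz') ζ (h1 0 hζ) hs).trans (le_max_left _ _)⟩
    · exact ⟨(h' z hz).1.mono (Set.prod_mono (h2 z) (h2 0)), fun z' hz' ζ hζ hs =>
        ((h' z hz).2 z' (h2 z hz') ζ (h2 0 hζ) hs).trans (le_max_right _ _)⟩
  · intro z hz
    -- The bound concerns the full derivative of order `m`, so any multi-index of that length will
    -- do; all entries are taken to be zero.
    obtain ⟨U, hU, hzU, hk, ⟨C, hC⟩, -⟩ := ((hρ z (hKO hz)).hasThetaValue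
      (fun _ : Fin m => 0)).theKernel
    obtain ⟨r, hr, hball⟩ := Metric.isOpen_iff.1 hU _ hzU
    rw [← ball_prod_same] at hball
    have hsub : ∀ z' ∈ Metric.ball z (r / 2),
        Metric.ball z' (r / 2) ×ˢ Metric.ball (0 : Spacetime) (r / 2) ⊆ U := fun z' hz' => by
      refine (Set.prod_mono ?_ (Metric.ball_subset_ball (by linarith))).trans hball
      refine Metric.ball_subset_ball' ?_
      rw [Metric.mem_ball] at hz'
      linarith
    refine ⟨Metric.ball z (r / 2), mem_nhdsWithin_of_mem_nhds (Metric.ball_mem_nhds z (by linarith)),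
      r / 2, by linarith, C, fun z' hz' => ⟨hk.mono (hsub z' hz'), fun z'' hz'' ζ hζ hs => ?_⟩⟩
    exact hC (z'', ζ) (hsub z' hz' ⟨hz'', hζ⟩) hs

/-- A closed neighbourhood of the compact set `x₀ + supp f` still lies in `Oω`. It contains the
translates for all `x` near `x₀`, and a uniform kernel exists on it. -/
theorem exists_kernelFamily (hρ : ∀ z ∈ Oω, IsThermalAt ω z (ρ z)) (hO : IsOpen Oω)
    {f : Spacetime → ℝ} (hf : IsMollifier f) {x₀ : Spacetime}
    (hx₀ : ∀ y ∈ tsupport f, x₀ + y ∈ Oω) : ∃ (K : Set Spacetime) (δ r : ℝ), 0 < δ ∧ 0 < r ∧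
      IsCompact K ∧ K ⊆ Oω ∧
      KernelFamily (theKernel ω.twoPoint) (Metric.thickening r K) (Metric.ball 0 r ∩ spacelike) K
        (Metric.ball x₀ δ) ∧
      IsWeight (fun y => (f y : ℂ)) K (Metric.ball x₀ δ) ∧
      ∀ y ∈ tsupport f, ∃ U, IsKernelOn ω.twoPoint U (theKernel ω.twoPoint) ∧
        ∀ x ∈ Metric.ball x₀ δ, ∀ ζ ∈ Metric.ball (0 : Spacetime) r, (x + y, ζ) ∈ U := by
  have hK₀ : IsCompact ((fun y => x₀ + y) '' tsupport f) := hf.compact.isCompact.image (by fun_prop)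
  obtain ⟨δ₀, hδ₀, hsub⟩ := hK₀.exists_cthickening_subset_open hO (by rintro _ ⟨y, hy, rfl⟩; exact hx₀ y hy)
  have hK := hK₀.cthickening (r := δ₀)
  -- Order zero is enough here: being a kernel already includes smoothness of all orders, and only
  -- the bounds depend on the order.
  obtain ⟨r, hr, C, hkr⟩ := exists_uniform_kernel hρ hK hsub 0
  have hw : ∀ y ∈ tsupport f, x₀ + y ∈ (fun y => x₀ + y) '' tsupport f := fun y hy => ⟨y, hy, rfl⟩
  refine ⟨_, min δ₀ r, r, lt_min hδ₀ hr, hr, hK, hsub, ?_, ?_, ?_⟩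
  · have hmem : ∀ z ∈ Metric.thickening r (Metric.cthickening δ₀ ((fun y => x₀ + y) '' tsupport f)),
        ∃ c, z ∈ Metric.ball c r ∧ IsKernelOn ω.twoPoint (Metric.ball c r ×ˢ Metric.ball 0 r)
          (theKernel ω.twoPoint) := fun z hz => by
      obtain ⟨c, hc, hzc⟩ := Metric.mem_thickening_iff.1 hz
      exact ⟨c, hzc, (hkr c hc).1⟩
    refine ⟨Metric.isOpen_thickening, Metric.isOpen_ball.inter isOpen_spacelike, Metric.isOpen_ball,
      hK, Metric.self_subset_thickening hr _, fun z hz ζ hζ => ?_, fun m => ?_⟩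
    · obtain ⟨c, hzc, hk⟩ := hmem z hz
      exact hk.smooth z ζ ⟨hzc, hζ.1⟩ hζ.2
    · rintro ⟨z, ζ⟩ ⟨hz, hζ⟩
      obtain ⟨c, hzc, hk⟩ := hmem z hz
      refine (hk.cont m (z, ζ) ⟨⟨hzc, hζ.1⟩, hζ.2⟩).mono_of_mem_nhdsWithin
        (mem_nhdsWithin_of_mem_nhds ?_)
      have hopen : IsOpen ((Metric.ball c r ×ˢ Metric.ball (0 : Spacetime) r) ∩
          Prod.snd ⁻¹' spacelike) :=
        (Metric.isOpen_ball.prod Metric.isOpen_ball).inter (isOpen_spacelike.preimage continuous_snd)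
      exact hopen.mem_nhds ⟨⟨hzc, hζ.1⟩, hζ.2⟩
  · refine ⟨Complex.ofRealCLM.contDiff.comp hf.smooth, fun x hx y hy => ?_⟩
    rw [tsupport_ofReal_comp] at hy
    refine Metric.mem_cthickening_of_dist_le _ (x₀ + y) _ _ (hw y hy) ?_
    rw [dist_add_right]
    exact (Metric.mem_ball.1 hx).le.trans (min_le_left _ _)
  · intro y hy
    refine ⟨_, (hkr (x₀ + y) (Metric.self_subset_cthickening _ (hw y hy))).1, fun x hx ζ hζ => ⟨?_, hζ⟩⟩
    rw [Metric.mem_ball, dist_add_right]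
    exact (Metric.mem_ball.1 hx).trans_le (min_le_right _ _)

variable {K Z T : Set Spacetime} {r : ℝ} {h : Spacetime → ℂ}

/-- The averaged kernels are bounded near coinciding points, and their limits are the averages of
the expectation values of the balanced derivatives. -/
theorem kernelAvg_bound_tendsto (hρ : ∀ z ∈ Oω, IsThermalAt ω z (ρ z)) (hK : K ⊆ Oω)
    (hr : 0 < r)
    (hw : KernelFamily (theKernel ω.twoPoint) Z (Metric.ball 0 r ∩ spacelike) K T)
    (hh : IsWeight h K T) {x : Spacetime} (hx : x ∈ T) {m : ℕ} (μ : Fin m → Fin 4) :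
    (∃ r' > 0, r' ≤ r ∧ ∃ C, ∀ x' ∈ T, ∀ ζ ∈ Metric.ball (0 : Spacetime) r', ζ ∈ spacelike →
      ‖kernelAvg (theKernel ω.twoPoint) h m x' ζ‖ ≤ C) ∧
    Tendsto (fun ζ => kernelAvg (theKernel ω.twoPoint) h m x ζ fun i => upVec (μ i))
      (𝓝[spacelike] 0) (𝓝 (∫ z, h (z - x) * refTheta (ρ z) fun i => upVec (μ i))) := by
  obtain ⟨r₁, hr₁, C, hC⟩ := exists_uniform_kernel hρ hw.compact hK m
  have hCn : ∀ z ∈ K, ∀ ζ ∈ Metric.ball (0 : Spacetime) r₁, ζ ∈ spacelike →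
      ‖iteratedFDeriv ℝ m (theKernel ω.twoPoint z) ζ‖ ≤ C := fun z hz =>
    (hC z hz).2 z (Metric.mem_ball_self hr₁)
  have hhc := hh.smooth.continuous
  have hts : ∀ x ∈ T, HasCompactSupport fun z => h (z - x) := fun x hx =>
    HasCompactSupport.intro hw.compact fun z hz => hh.eq_zero hx hz
  have hint : ∀ x ∈ T, Integrable fun z => ‖h (z - x)‖ := fun x hx =>
    ((by fun_prop : Continuous fun z => h (z - x)).integrable_of_hasCompactSupport (hts x hx)).norm
  have hev : ∀ᶠ ζ in 𝓝[spacelike] (0 : Spacetime),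
      ζ ∈ Metric.ball (0 : Spacetime) (min r r₁) ∧ ζ ∈ spacelike :=
    inter_mem (mem_nhdsWithin_of_mem_nhds (Metric.ball_mem_nhds 0 (lt_min hr hr₁)))
      self_mem_nhdsWithin
  have hb1 : Metric.ball (0 : Spacetime) (min r r₁) ⊆ Metric.ball 0 r :=
    Metric.ball_subset_ball (min_le_left _ _)
  have hb2 : Metric.ball (0 : Spacetime) (min r r₁) ⊆ Metric.ball 0 r₁ :=
    Metric.ball_subset_ball (min_le_right _ _)
  constructor
  · refine ⟨min r r₁, lt_min hr hr₁, min_le_left _ _, (∫ z, ‖h z‖) * C, fun x' hx' ζ hζ hs => ?_⟩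
    rw [← integral_sub_right_eq_self (fun z => ‖h z‖) x', ← integral_mul_const]
    refine norm_integral_le_of_norm_le ((hint x' hx').mul_const C) (Eventually.of_forall fun z => ?_)
    rw [norm_smul]
    by_cases hz : z ∈ K
    · exact mul_le_mul_of_nonneg_left (hCn z hz ζ (hb2 hζ) hs) (norm_nonneg _)
    · simp [hh.eq_zero hx' hz]
  · have hlim : ∀ z ∈ K, Tendsto (fun ζ => iteratedFDeriv ℝ m (theKernel ω.twoPoint z) ζ
        fun i => upVec (μ i)) (𝓝[spacelike] 0) (𝓝 (refTheta (ρ z) fun i => upVec (μ i))) :=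
      fun z hz => by
        obtain ⟨_, _, _, _, _, ht⟩ := ((hρ z (hK hz)).hasThetaValue μ).theKernel
        exact ht
    -- Pointwise in `z` the limits are the reference values of `ρ z`; the uniform bound on `K`
    -- dominates.
    have hmain : Tendsto (fun ζ => ∫ z, h (z - x) *
        iteratedFDeriv ℝ m (theKernel ω.twoPoint z) ζ fun i => upVec (μ i)) (𝓝[spacelike] 0)
        (𝓝 (∫ z, h (z - x) * refTheta (ρ z) fun i => upVec (μ i))) := by
      refine tendsto_integral_filter_of_dominated_convergence
        (fun z => ‖h (z - x)‖ * (C * ∏ i, ‖upVec (μ i)‖)) ?_ ?_ ((hint x hx).mul_const _) ?_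
      · filter_upwards [hev] with ζ hζ
        exact (ContinuousMultilinearMap.apply ℝ (fun _ : Fin m => Spacetime) ℂ
          fun i => upVec (μ i)).continuous.comp_aestronglyMeasurable
            (hw.integrable_integrand hh m hx ⟨hb1 hζ.1, hζ.2⟩).1
      · filter_upwards [hev] with ζ hζ
        refine Eventually.of_forall fun z => ?_
        rw [norm_mul]
        by_cases hz : z ∈ K
        · refine mul_le_mul_of_nonneg_left ?_ (norm_nonneg _)
          refine (ContinuousMultilinearMap.le_opNorm _ _).trans ?_
          exact mul_le_mul_of_nonneg_right (hCn z hz ζ (hb2 hζ.1) hζ.2) (by positivity)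
        · simp [hh.eq_zero hx hz]
      · refine Eventually.of_forall fun z => ?_
        by_cases hz : z ∈ K
        · exact (hlim z hz).const_mul _
        · simpa [hh.eq_zero hx hz] using tendsto_const_nhds
    refine hmain.congr' ?_
    filter_upwards [hev] with ζ hζ
    exact (hw.kernelAvg_apply hh hx ⟨hb1 hζ.1, hζ.2⟩ _).symm

end setup

theorem continuousOn_thetaFn {m : ℕ} (μ : Fin m → Fin 4) : ContinuousOn (thetaFn μ) forwardCone := by
  refine continuousOn_integral_of_compact_support (k := univ) isCompact_univ ?_
    fun _ _ _ h => absurd trivial h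
  have hφ : ContinuousOn (fun s : ℝ => (s ^ (m + 2))⁻¹) (Ioi 0) :=
    (continuousOn_id.pow _).inv₀ fun s hs => pow_ne_zero _ (ne_of_gt hs)
  have h1 : Continuous fun z : Spacetime × Sphere => ∏ i, ray z.2 (μ i) := by
    have := continuous_ray
    fun_prop
  exact h1.continuousOn.mul (continuousOn_comp_ray hφ)

/-- The measure `σ` is the average of the family `ρ` with the weight `g`. -/
def IsAverage (ρ : Spacetime → Measure Spacetime) (g : Spacetime → ℝ) (σ : Measure Spacetime) :
    Prop :=
  (∃ B, SupportedIn σ B) ∧ ∀ ψ : Spacetime → ℂ, ContinuousOn ψ forwardCone →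
    ∫ β, ψ β ∂σ = ∫ z, (g z : ℂ) * ∫ β, ψ β ∂ρ z

/-- Finite measures are determined by bounded continuous functions. Support properties known for one
average thereby hold for any other. -/
theorem IsAverage.unique {ρ : Spacetime → Measure Spacetime} {g : Spacetime → ℝ}
    {σ σ' : Measure Spacetime} (h : IsAverage ρ g σ) (h' : IsAverage ρ g σ') : σ = σ' := by
  obtain ⟨⟨B, hB⟩, h⟩ := h
  obtain ⟨⟨B', hB'⟩, h'⟩ := h'
  have := hB.finite
  have := hB'.finite
  refine ext_of_forall_integral_eq_of_IsFiniteMeasure fun φ => ?_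
  have hφ : Continuous fun β => (φ β : ℂ) := Complex.continuous_ofReal.comp φ.continuous
  have h1 := (h _ hφ.continuousOn).trans (h' _ hφ.continuousOn).symm
  rw [integral_complex_ofReal, integral_complex_ofReal] at h1
  exact_mod_cast h1

theorem ThermalFamily.exists_isAverage {ρ : Spacetime → Measure Spacetime} {K B : Set Spacetime}
    (h : ThermalFamily ρ K B) {g : Spacetime → ℝ} (hg : Continuous g) (hg0 : ∀ z, 0 ≤ g z)
    (hgK : ∀ z, z ∉ K → g z = 0) : ∃ σ, SupportedIn σ B ∧ IsAverage ρ g σ := by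
  have hgK' : tsupport g ⊆ K := closure_minimal (fun z hz => by
    by_contra hzK; exact hz (hgK z hzK)) h.compact.isClosed
  obtain ⟨σ, hσ, hσ'⟩ := h.exists_average hg (HasCompactSupport.intro h.compact hgK) hgK' hg0
  exact ⟨σ, hσ, ⟨B, hσ⟩, fun ψ hψ => hσ' ψ (hψ.mono h.subsetB)⟩

theorem IsThermalOn.exists_thermalFamily {ω : State} {ρ : Spacetime → Measure Spacetime}
    {Oω : Set Spacetime} (hρ : ∀ x ∈ Oω, IsThermalAt ω x (ρ x))
    (hint : ∀ l : List TestFn, LocallyIntegrableOn (fun x => refNPoint (ρ x) l) Oω)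
    (hsupp : ∀ K ⊆ Oω, IsCompact K →
      ∃ B : Set Spacetime, IsCompact B ∧ B ⊆ forwardCone ∧ ∀ x ∈ K, ρ x Bᶜ = 0)
    {K : Set Spacetime} (hK : IsCompact K) (hKO : K ⊆ Oω) : ∃ B, ThermalFamily ρ K B := by
  obtain ⟨B, hB, hBV, h0⟩ := hsupp K hKO hK
  refine ⟨B, hK, fun z hz => (hρ z (hKO hz)).1, fun z hz => ⟨?_, hB, hBV, h0 z hz⟩, hB, hBV,
    fun l => ((hint l).integrableOn_compact_subset hKO hK).1⟩
  have := (hρ z (hKO hz)).1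
  infer_instance

/-- The values of the balanced derivatives are, up to a constant, expectation values of the
continuous functions `thetaFn`, to which the defining property of the average applies. -/
theorem integral_refTheta_eq {ρ : Spacetime → Measure Spacetime} {K B : Set Spacetime}
    (h : ThermalFamily ρ K B) {g : Spacetime → ℝ} (hgK : ∀ z, z ∉ K → g z = 0)
    {σ : Measure Spacetime} (hσ : IsAverage ρ g σ) {m : ℕ} (μ : Fin m → Fin 4) :
    ∫ z, (g z : ℂ) * refTheta (ρ z) (fun i => upVec (μ i)) =
      refTheta σ fun i => upVec (μ i) := by
  obtain ⟨B', hB'⟩ := hσ.1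
  rw [hB'.refTheta_upVec, ← integral_complex_ofReal, hσ.2 (fun β => (thetaFn μ β : ℂ))
    (Complex.continuous_ofReal.comp_continuousOn (continuousOn_thetaFn μ)), ← integral_const_mul]
  congr 1
  funext z
  by_cases hz : z ∈ K
  · rw [(h.supp z hz).refTheta_upVec, integral_complex_ofReal]
    ring
  · simp [hgK z hz]

theorem IsAverage.isProbabilityMeasure {ρ : Spacetime → Measure Spacetime} {K B : Set Spacetime}
    (h : ThermalFamily ρ K B) {g : Spacetime → ℝ} (hgK : ∀ z, z ∉ K → g z = 0)
    (hg : ∫ z, g z = 1) {σ : Measure Spacetime} (hσ : IsAverage ρ g σ) :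
    IsProbabilityMeasure σ := by
  obtain ⟨B', hB'⟩ := hσ.1
  have := hB'.finite
  have h1 := hσ.2 (fun _ => 1) continuousOn_const
  have h2 : ∫ z, (g z : ℂ) * ∫ _β, (1 : ℂ) ∂ρ z = ((∫ z, g z : ℝ) : ℂ) := by
    rw [← integral_complex_ofReal]
    congr 1
    funext z
    by_cases hz : z ∈ K
    · have := h.prob z hz
      simp
    · simp [hgK z hz]
  rw [h2, hg, integral_const, Complex.real_smul, mul_one] at h1
  have h3 : σ.real univ = 1 := by exact_mod_cast h1
  exact ⟨by rw [← ENNReal.toReal_eq_one_iff]; exact h3⟩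

/-- The dependence on `x` is through the continuous weight, while the expectation values are bounded
on `K`. This yields local integrability of the averaged n-point functions. -/
theorem continuousAt_average {ρ : Spacetime → Measure Spacetime} {K B : Set Spacetime}
    (h : ThermalFamily ρ K B) {f : Spacetime → ℝ} (hf : Continuous f) (hfc : HasCompactSupport f)
    {T : Set Spacetime} (hT : IsOpen T) (hTK : ∀ x ∈ T, ∀ z, z ∉ K → f (z - x) = 0)
    {ψ : Spacetime → ℂ} (hψ : ContinuousOn ψ B) {x : Spacetime} (hx : x ∈ T) :
    ContinuousAt (fun x => ∫ z, (f (z - x) : ℂ) * ∫ β, ψ β ∂ρ z) x := by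
  obtain ⟨C, hC⟩ := h.compactB.exists_bound_of_continuousOn hψ
  obtain ⟨D, hD⟩ := hfc.exists_bound_of_continuous hf
  have hfx : ∀ x, Continuous fun z => (f (z - x) : ℂ) := fun x => by
    have := Complex.continuous_ofReal
    fun_prop
  have hD0 : 0 ≤ D := (norm_nonneg _).trans (hD 0)
  refine continuousAt_of_dominated (bound := K.indicator fun _ => D * C) ?_ ?_ ?_ ?_
  · filter_upwards [hT.mem_nhds hx] with x' hx'
    have hz : ∀ z, z ∉ K → (f (z - x') : ℂ) = 0 := fun z hz => by simp [hTK x' hx' z hz]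
    exact (h.integrable_mul (hfx x') (HasCompactSupport.intro h.compact hz)
      (closure_minimal (fun z hz' => by by_contra hzK; exact hz' (hz z hzK)) h.compact.isClosed)
      hψ).1
  · filter_upwards [hT.mem_nhds hx] with x' hx'
    refine Eventually.of_forall fun z => ?_
    by_cases hz : z ∈ K
    · rw [indicator_of_mem hz, norm_mul, Complex.norm_real]
      exact mul_le_mul (hD _) (h.norm_integral_le hC hz) (norm_nonneg _) hD0
    · simp [hTK x' hx' z hz, hz]
  · exact (integrable_indicator_iff h.compact.measurableSet).2
      (integrableOn_const h.compact.measure_lt_top.ne)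
  · refine Eventually.of_forall fun z => ?_
    have : Continuous fun x => (f (z - x) : ℂ) := by
      have := Complex.continuous_ofReal
      fun_prop
    exact (this.mul continuous_const).continuousAt

/-- The averaged canonical kernel serves as kernel of the regularized state near `x`; its limits at
`ζ = 0` are averages of the values for `ρ z`, which by linearity are the values for `σ`. -/
theorem isThermalAt_regularized {ω ωf : State} {ρ : Spacetime → Measure Spacetime}
    {Oω : Set Spacetime} (hρ : ∀ x ∈ Oω, IsThermalAt ω x (ρ x)) (hOω : IsOpen Oω)
    (hfam : ∀ K ⊆ Oω, IsCompact K → ∃ B, ThermalFamily ρ K B)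
    {f : Spacetime → ℝ} (hf : IsMollifier f) (hreg : IsRegularization ω f ωf) {x : Spacetime}
    (hx : ∀ y ∈ tsupport f, x + y ∈ Oω) {σ : Measure Spacetime}
    (hσ : IsAverage ρ (fun z => f (z - x)) σ) : IsThermalAt ωf x σ := by
  obtain ⟨K, δ, r, hδ, hr, hK, hKO, hw, hh, hker⟩ := exists_kernelFamily hρ hOω hf hx
  obtain ⟨B, hB⟩ := hfam K hKO hK
  have hxT : x ∈ Metric.ball x δ := Metric.mem_ball_self hδ
  have hgK : ∀ z, z ∉ K → f (z - x) = 0 := fun z hz => by exact_mod_cast hh.eq_zero hxT hz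
  have hg1 : ∫ z, f (z - x) = 1 := by rw [integral_sub_right_eq_self f x, hf.integral_eq]
  have hp := hσ.isProbabilityMeasure hB hgK hg1
  obtain ⟨⟨B', hB'⟩, -⟩ := id hσ
  refine ⟨hp, ⟨B', hB'.compact, hB'.subset, hB'.null⟩, fun m μ =>
    ⟨refTheta σ fun i => upVec (μ i), ?_, hB'.hasThetaValue x μ⟩⟩
  obtain ⟨⟨r', hr', hrr', C, hC⟩, hlim⟩ := kernelAvg_bound_tendsto hρ hKO hr hw hh hxT μ
  rw [integral_refTheta_eq hB hgK hσ μ] at hlim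
  have hbb : Metric.ball (0 : Spacetime) r' ⊆ Metric.ball 0 r := Metric.ball_subset_ball hrr'
  refine ⟨Metric.ball x δ ×ˢ Metric.ball 0 r', avg (theKernel ω.twoPoint) fun y => (f y : ℂ),
    Metric.isOpen_ball.prod Metric.isOpen_ball, ⟨hxT, Metric.mem_ball_self hr'⟩, ⟨?_, ?_, ?_⟩, ?_, ?_⟩
  · exact fun x' ζ hq hs => hw.contDiffAt_avg hh hq.1 ⟨hbb hq.2, hs⟩
  · intro m
    refine ((hw.continuousOn_kernelAvg hh m).mono fun q hq => ⟨hq.1.1, hbb hq.1.2, hq.2⟩).congr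
      fun q hq => ?_
    exact hw.iteratedFDeriv_avg hh hq.1.1 ⟨hbb hq.1.2, hq.2⟩ m
  · intro φ χ hφχ
    refine regularized_kernel hf hreg hw inter_subset_right hh hker rfl φ χ fun x₁ h₁ x₂ h₂ => ?_
    obtain ⟨h3, h4⟩ := hφχ x₁ h₁ x₂ h₂
    exact ⟨h3.1, hbb h3.2, h4⟩
  · refine ⟨C, fun q hq hs => ?_⟩
    rw [hw.iteratedFDeriv_avg hh hq.1 ⟨hbb hq.2, hs⟩ m]
    exact hC q.1 hq.1 q.2 hq.2 hs
  · refine hlim.congr' ?_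
    filter_upwards [inter_mem (mem_nhdsWithin_of_mem_nhds (Metric.ball_mem_nhds 0 hr'))
      self_mem_nhdsWithin] with ζ hζ
    rw [hw.iteratedFDeriv_avg hh hxT ⟨hbb hζ.1, hζ.2⟩ m]
    rfl

theorem isThermalOn_regularized {ω ωf : State} {ρ : Spacetime → Measure Spacetime}
    {Oω O : Set Spacetime} (hρ : ∀ x ∈ Oω, IsThermalAt ω x (ρ x)) (hOω : IsOpen Oω)
    (hfam : ∀ K ⊆ Oω, IsCompact K → ∃ B, ThermalFamily ρ K B)
    {f : Spacetime → ℝ} (hf : IsMollifier f) (hreg : IsRegularization ω f ωf) (hO : IsOpen O)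
    (hsub : ∀ x ∈ O, ∀ y ∈ tsupport f, x + y ∈ Oω) :
    ∃ σ : Spacetime → Measure Spacetime, (∀ x ∈ O, IsAverage ρ (fun z => f (z - x)) (σ x)) ∧
      (∀ x ∈ O, IsThermalAt ωf x (σ x)) ∧
      (∀ l : List TestFn, LocallyIntegrableOn (fun x => refNPoint (σ x) l) O) ∧
      ∀ K ⊆ O, IsCompact K →
        ∃ B : Set Spacetime, IsCompact B ∧ B ⊆ forwardCone ∧ ∀ x ∈ K, σ x Bᶜ = 0 := by
  have hfc := hf.smooth.continuous
  -- The averages for `x ∈ K` involve only the compact set `K + supp f`, which provides the common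
  -- temperature support.
  have hex : ∀ K ⊆ O, IsCompact K → ∃ B, IsCompact B ∧ B ⊆ forwardCone ∧ ∀ x ∈ K,
      ∃ σ, SupportedIn σ B ∧ IsAverage ρ (fun z => f (z - x)) σ := by
    intro K hKO hK
    have hK' : IsCompact ((fun q : Spacetime × Spacetime => q.1 + q.2) '' (K ×ˢ tsupport f)) :=
      (hK.prod hf.compact.isCompact).image (by fun_prop)
    have hKO' : (fun q : Spacetime × Spacetime => q.1 + q.2) '' (K ×ˢ tsupport f) ⊆ Oω := by
      rintro _ ⟨⟨x, y⟩, ⟨hx, hy⟩, rfl⟩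
      exact hsub x (hKO hx) y hy
    obtain ⟨B, hB⟩ := hfam _ hKO' hK'
    refine ⟨B, hB.compactB, hB.subsetB, fun x hx => hB.exists_isAverage (by fun_prop)
      (fun z => hf.nonneg _) fun z hz => ?_⟩
    refine image_eq_zero_of_notMem_tsupport fun hy => hz ⟨(x, z - x), ⟨hx, hy⟩, by simp⟩
  have hσ : ∀ x, ∃ σ, x ∈ O → IsAverage ρ (fun z => f (z - x)) σ := fun x => by
    by_cases hx : x ∈ O
    · obtain ⟨B, -, -, h⟩ := hex {x} (by simpa using hx) isCompact_singleton
      obtain ⟨σ, -, hσ⟩ := h x rfl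
      exact ⟨σ, fun _ => hσ⟩
    · exact ⟨0, fun h => absurd h hx⟩
  choose σ hσ using hσ
  refine ⟨σ, hσ, fun x hx => isThermalAt_regularized hρ hOω hfam hf hreg (hsub x hx) (hσ x hx),
    fun l => ?_, fun K hKO hK => ?_⟩
  · refine ContinuousOn.locallyIntegrableOn (fun x hx => ContinuousAt.continuousWithinAt ?_)
      hO.measurableSet
    obtain ⟨K, δ, r, hδ, hr, hK, hKO, hw, hh, hker⟩ := exists_kernelFamily hρ hOω hf (hsub x hx)
    obtain ⟨B, hB⟩ := hfam K hKO hK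
    have hcont := continuousOn_wick _ l rfl
    refine (continuousAt_average hB hfc hf.compact Metric.isOpen_ball (T := Metric.ball x δ)
      (fun x' hx' z hz => by exact_mod_cast hh.eq_zero hx' hz) (hcont.mono hB.subsetB)
      (Metric.mem_ball_self hδ)).congr ?_
    filter_upwards [hO.mem_nhds hx] with x' hx'
    exact ((hσ x' hx').2 _ hcont).symm
  · obtain ⟨B, hBc, hBV, h⟩ := hex K hKO hK
    refine ⟨B, hBc, hBV, fun x hx => ?_⟩
    obtain ⟨σ', hσB, hσ'⟩ := h x hx
    -- The measure was chosen point by point; uniqueness transfers the support that is uniform on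
    -- `K`.
    rw [(hσ x (hKO hx)).unique hσ']
    exact hσB.null

/-! ### The field equation for the averaged kernels -/

section parts

variable {E : Type*} [NormedAddCommGroup E] [NormedSpace ℝ E] [FiniteDimensional ℝ E]
  [MeasurableSpace E] [BorelSpace E] {μ : Measure E} [μ.IsAddHaarMeasure]

/-- Integration by parts with a test function. -/
theorem integral_lineDeriv_mul_eq {Ψ Ψ' Q Q' : E → ℂ} {Ω C : Set E} {d : E} (hΩ : IsOpen Ω)
    (hC : IsCompact C) (hCΩ : C ⊆ Ω) (hΨ : Continuous Ψ) (hΨ' : Continuous Ψ')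
    (hΨC : ∀ z, z ∉ C → Ψ z = 0) (hΨC' : ∀ z, z ∉ C → Ψ' z = 0)
    (hdΨ : ∀ z, HasLineDerivAt ℝ Ψ (Ψ' z) z d) (hQ : ContinuousOn Q Ω) (hQ' : ContinuousOn Q' Ω)
    (hdQ : ∀ z ∈ Ω, HasLineDerivAt ℝ Q (Q' z) z d) :
    ∫ z, Ψ' z * Q z ∂μ = -∫ z, Ψ z * Q' z ∂μ := by
  have hint : ∀ {A R : E → ℂ}, Continuous A → (∀ z, z ∉ C → A z = 0) → ContinuousOn R Ω →
      Integrable (fun z => A z * R z) μ := fun {A R} hA hA0 hR => by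
    have hs : tsupport (fun z => A z * R z) ⊆ C :=
      closure_minimal (fun z hz => by
        by_contra hzC; exact left_ne_zero_of_mul hz (hA0 z hzC)) hC.isClosed
    refine Continuous.integrable_of_hasCompactSupport
      (ContinuousOn.continuous_of_tsupport_subset (hA.continuousOn.mul hR) hΩ (hs.trans hCΩ))
      (hC.of_isClosed_subset (isClosed_tsupport _) hs)
  have h1 := hint hΨ' hΨC' hQ
  have h2 := hint hΨ hΨC hQ'
  have h3 := hint hΨ hΨC hQ
  have hd : ∀ z, HasLineDerivAt ℝ (fun z => Ψ z * Q z) (Ψ' z * Q z + Ψ z * Q' z) z d := by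
    intro z
    by_cases hz : z ∈ Ω
    · have ha := hdΨ z
      have hb := hdQ z hz
      simp only [HasLineDerivAt] at ha hb ⊢
      have := ha.fun_mul hb
      simpa only [zero_smul, add_zero] using this
    · have hzC : z ∉ C := fun h => hz (hCΩ h)
      rw [hΨC z hzC, hΨC' z hzC, zero_mul, zero_mul, add_zero]
      have hev : (fun t : ℝ => Ψ (z + t • d) * Q (z + t • d)) =ᶠ[𝓝 0] fun _ => 0 := by
        have hc : Continuous fun t : ℝ => z + t • d := by fun_prop
        filter_upwards [(hC.isClosed.isOpen_compl.preimage hc).mem_nhds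
          (by simpa using hzC : (0 : ℝ) ∈ _)] with t ht
        rw [hΨC _ ht, zero_mul]
      exact (hasDerivAt_const (0 : ℝ) (0 : ℂ)).congr_of_eventuallyEq hev
  have h0 := integral_bilinear_hasLineDerivAt_right_eq_neg_left_of_integrable (μ := μ)
    (f := fun _ : E => (1 : ℂ)) (f' := fun _ => (0 : ℂ)) (g := fun z => Ψ z * Q z)
    (g' := fun z => Ψ' z * Q z + Ψ z * Q' z) (v := d) (B := ContinuousLinearMap.mul ℝ ℂ)
    (by simp) (by simpa only [ContinuousLinearMap.mul_apply', one_mul] using h1.fun_add h2)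
    (by simpa using h3)
    (fun z _ => by simpa [HasLineDerivAt] using hasDerivAt_const (0 : ℝ) (1 : ℂ)) fun z _ => hd z
  simp only [ContinuousLinearMap.mul_apply', one_mul, zero_mul, integral_zero, neg_zero] at h0
  rw [integral_add h1 h2] at h0
  exact eq_neg_of_add_eq_zero_left h0

end parts

/-! ### The wave operator on test functions and in momentum space -/

/-- The coordinate derivative of a test function. -/
def pdT (ν : Fin 4) (φ : TestFn) : TestFn :=
  ⟨pd ν φ.1, (φ.2.1.fderiv_right (by exact_mod_cast le_top)).clm_apply contDiff_const,
    φ.2.2.fderiv_apply ℝ _⟩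

theorem tsupport_pdT (ν : Fin 4) (φ : TestFn) : tsupport (pdT ν φ).1 ⊆ tsupport φ.1 :=
  tsupport_fderiv_apply_subset ℝ _

/-- The wave operator on test functions. -/
def boxT (φ : TestFn) : TestFn := ∑ ν, (eta ν : ℂ) • pdT ν (pdT ν φ)

theorem boxT_apply (φ : TestFn) (x : Spacetime) :
    (boxT φ).1 x = ∑ ν, (eta ν : ℂ) * (pdT ν (pdT ν φ)).1 x := by
  simp [boxT, Finset.sum_apply]

theorem boxT_val (φ : TestFn) : (boxT φ).1 = box φ.1 := by
  funext x
  rw [boxT_apply]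
  rfl

theorem tsupport_boxT (φ : TestFn) : tsupport (boxT φ).1 ⊆ tsupport φ.1 := by
  refine closure_minimal (fun x hx => ?_) (isClosed_tsupport _)
  by_contra hx'
  refine hx ?_
  rw [boxT_apply]
  refine Finset.sum_eq_zero fun ν _ => ?_
  rw [image_eq_zero_of_notMem_tsupport fun h => hx' (tsupport_pdT _ _ (tsupport_pdT _ _ h)), mul_zero]

theorem field_boxT (φ : TestFn) : field (boxT φ) = 0 := field_eq_zero φ _ (boxT_val φ)

theorem hasLineDerivAt_testFn (φ : TestFn) (ν : Fin 4) (x : Spacetime) :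
    HasLineDerivAt ℝ φ.1 ((pdT ν φ).1 x) x (basisVec ν) :=
  (φ.2.1.differentiable (by simp) x).hasFDerivAt.hasLineDerivAt _

/-- Integration by parts against the plane wave. -/
theorem minkFT_pdT (ν : Fin 4) (φ : TestFn) (p : Spacetime) :
    minkFT (pdT ν φ) p = I * (eta ν * p ν : ℝ) * minkFT φ p := by
  have hE : ∀ z : Spacetime, HasLineDerivAt ℝ (fun x => exp (-I * (mink x p : ℂ)))
      (exp (-I * (mink z p : ℂ)) * (-I * (eta ν * p ν : ℝ))) z (basisVec ν) := by
    intro z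
    have h1 : HasDerivAt (fun t : ℝ => ((mink z p + t * (eta ν * p ν) : ℝ) : ℂ))
        ((eta ν * p ν : ℝ) : ℂ) 0 := by
      have := ((hasDerivAt_id (0 : ℝ)).mul_const (eta ν * p ν)).const_add (mink z p)
      simpa using this.ofReal_comp
    have h2 := (h1.const_mul (-I)).cexp
    simp only [HasLineDerivAt, mink_add_left, mink_smul_left, mink_basisVec_left]
    simpa using h2
  have hcont : Continuous fun x : Spacetime => exp (-I * (mink x p : ℂ)) := by
    have := Complex.continuous_ofReal
    fun_prop
  have := integral_lineDeriv_mul_eq (μ := volume) (Ω := univ) (C := tsupport φ.1) (d := basisVec ν)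
    isOpen_univ φ.2.2 (subset_univ _) φ.2.1.continuous (pdT ν φ).2.1.continuous
    (fun z hz => image_eq_zero_of_notMem_tsupport hz)
    (fun z hz => image_eq_zero_of_notMem_tsupport fun h => hz (tsupport_pdT ν φ h))
    (hasLineDerivAt_testFn φ ν) hcont.continuousOn (hcont.mul continuous_const).continuousOn
    fun z _ => hE z
  simp only [Pi.mul_apply] at this
  rw [minkFT, this, minkFT, ← integral_neg, ← integral_const_mul]
  congr 1
  funext x
  ring

/-- On Fourier transforms the wave operator acts as multiplication by `-p²`, which is zero on the
light cone. -/
theorem minkFT_boxT (φ : TestFn) {p : Spacetime} (hp : mink p p = 0) : minkFT (boxT φ) p = 0 := by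
  have h1 : minkFT (boxT φ) p = ∑ ν, (eta ν : ℂ) * minkFT (pdT ν (pdT ν φ)) p := by
    simp only [minkFT, boxT_apply, Finset.sum_mul, ← integral_const_mul]
    rw [integral_finsetSum]
    · simp only [mul_assoc]
    · intro ν _
      simp only [mul_assoc]
      exact (integrable_phase p).const_mul _
  rw [h1]
  have h2 : ∀ ν, (eta ν : ℂ) * minkFT (pdT ν (pdT ν φ)) p =
      -((eta ν * (p ν * p ν) : ℝ) : ℂ) * minkFT φ p := fun ν => by
    rw [minkFT_pdT, minkFT_pdT]
    have h3 : (eta ν : ℂ) * (eta ν : ℂ) = 1 := by exact_mod_cast eta_mul_eta ν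
    push_cast
    linear_combination (I ^ 2 * (eta ν : ℂ) * (p ν) ^ 2 * minkFT φ p) * h3 +
      (eta ν : ℂ) * (p ν) ^ 2 * minkFT φ p * I_sq
  simp only [h2, ← Finset.sum_mul, Finset.sum_neg_distrib]
  rw [← Complex.ofReal_sum]
  change -((mink p p : ℝ) : ℂ) * _ = 0
  simp [hp]

theorem vacForm_boxT_left (φ χ : TestFn) : vacForm (boxT φ) χ = 0 := by
  have h : ∀ q, mink (-shell q) (-shell q) = 0 := fun q => by
    rw [mink_neg_left, mink_neg_right, neg_neg, mink_shell_self]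
  simp [vacForm, shellForm, minkFT_boxT φ (mink_shell_self _), minkFT_boxT φ (h _)]

theorem vacForm_boxT_right (φ χ : TestFn) : vacForm φ (boxT χ) = 0 := by
  have h : ∀ q, mink (-shell q) (-shell q) = 0 := fun q => by
    rw [mink_neg_left, mink_neg_right, neg_neg, mink_shell_self]
  simp [vacForm, shellForm, minkFT_boxT χ (mink_shell_self _), minkFT_boxT χ (h _)]

/-! ### The wave equation in each of the two points -/

namespace KernelFamily

variable {w : Spacetime → Spacetime → ℂ} {Z S K T : Set Spacetime} {h : Spacetime → ℂ}

/-- The derivatives of an averaged kernel with respect to one of the two points. -/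
theorem hasLineDerivAt_kernelAvg (hw : KernelFamily w Z S K T) (hh : IsWeight h K T) {m : ℕ}
    (v : Fin m → Spacetime) {e : Spacetime} {s : ℝ} {d : Spacetime × Spacetime}
    (hd : midDiff d = ((1 / 2 : ℝ) • e, (s / 2) • e)) {z : Spacetime × Spacetime}
    (hz : z ∈ midDiff ⁻¹' (T ×ˢ S)) :
    HasLineDerivAt ℝ (fun z => kernelAvg w h m (midDiff z).1 (midDiff z).2 v)
      ((s / 2 : ℂ) * kernelAvg w h (m + 1) (midDiff z).1 (midDiff z).2 (Fin.cons e v) -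
        (1 / 2 : ℂ) * kernelAvg w (LocalEq.dirDeriv e h) m (midDiff z).1 (midDiff z).2 v) z d := by
  obtain ⟨L, hL, hLe⟩ := hw.exists_hasFDerivAt_kernelAvg hh m hz.1 hz.2
  -- The passage to midpoint and half difference is linear, so lines go to lines.
  have h1 : HasDerivAt (fun t : ℝ => midDiff (z + t • d)) (midDiff d) 0 := by
    have h2 : ∀ t : ℝ, midDiff (z + t • d) = midDiff z + t • midDiff d := fun t => by
      simp only [midDiff]
      ext1
      · simp only [Prod.fst_add, Prod.snd_add, Prod.smul_fst, Prod.smul_snd]; module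
      · simp only [Prod.fst_add, Prod.snd_add, Prod.smul_fst, Prod.smul_snd]; module
    simp only [h2]
    simpa using ((hasDerivAt_id (0 : ℝ)).smul_const (midDiff d)).const_add (midDiff z)
  have h3 : HasFDerivAt (fun q : Spacetime × Spacetime => kernelAvg w h m q.1 q.2) L
      (midDiff (z + (0 : ℝ) • d)) := by
    rw [zero_smul, add_zero]; exact hL
  have h4 := h3.comp_hasDerivAt (0 : ℝ) h1
  have h5 := ((ContinuousMultilinearMap.apply ℝ (fun _ : Fin m => Spacetime) ℂ
    v).hasFDerivAt).comp_hasDerivAt (0 : ℝ) h4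
  have h6 : L (midDiff d) = (s / 2) • (kernelAvg w h (m + 1) (midDiff z).1 (midDiff z).2).curryLeft e -
      (1 / 2 : ℝ) • kernelAvg w (LocalEq.dirDeriv e h) m (midDiff z).1 (midDiff z).2 := by
    rw [hd, hLe, map_smul]
    congr 1
    have : LocalEq.dirDeriv ((1 / 2 : ℝ) • e) h = fun y => (1 / 2 : ℝ) • LocalEq.dirDeriv e h y := by
      funext y
      simp only [LocalEq.dirDeriv, map_smul]
    rw [this, kernelAvg, kernelAvg, ← integral_smul]
    simp only [smul_assoc]
  rw [h6] at h5
  refine h5.congr_deriv ?_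
  simp [Complex.real_smul]

theorem continuousOn_kernelAvg_pair (hw : KernelFamily w Z S K T) (hh : IsWeight h K T) {m : ℕ}
    (v : Fin m → Spacetime) :
    ContinuousOn (fun z => kernelAvg w h m (midDiff z).1 (midDiff z).2 v)
      (midDiff ⁻¹' (T ×ˢ S)) :=
  (ContinuousMultilinearMap.apply ℝ (fun _ : Fin m => Spacetime) ℂ v).continuous.comp_continuousOn
    ((hw.continuousOn_kernelAvg hh m).comp continuous_midDiff.continuousOn fun _ hz => hz)

end KernelFamily

namespace KernelFamily

variable {w : Spacetime → Spacetime → ℂ} {Z S K T : Set Spacetime} {h : Spacetime → ℂ}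

/-- The first derivative of an averaged kernel with respect to the point `x + ζ` (for `s = 1`) or
`x - ζ` (for `s = -1`), as a function of these points. -/
def pairDeriv (w : Spacetime → Spacetime → ℂ) (h : Spacetime → ℂ) (s : ℝ) (e : Spacetime)
    (z : Spacetime × Spacetime) : ℂ :=
  (s / 2 : ℂ) * kernelAvg w h 1 (midDiff z).1 (midDiff z).2 (Fin.cons e Fin.elim0) -
    (1 / 2 : ℂ) * kernelAvg w (LocalEq.dirDeriv e h) 0 (midDiff z).1 (midDiff z).2 Fin.elim0

/-- The second derivative of an averaged kernel with respect to one of the points. -/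
def pairDeriv₂ (w : Spacetime → Spacetime → ℂ) (h : Spacetime → ℂ) (s : ℝ) (e : Spacetime)
    (z : Spacetime × Spacetime) : ℂ :=
  (s / 2 : ℂ) * ((s / 2 : ℂ) * kernelAvg w h 2 (midDiff z).1 (midDiff z).2
      (Fin.cons e (Fin.cons e Fin.elim0)) -
    (1 / 2 : ℂ) * kernelAvg w (LocalEq.dirDeriv e h) 1 (midDiff z).1 (midDiff z).2
      (Fin.cons e Fin.elim0)) -
  (1 / 2 : ℂ) * ((s / 2 : ℂ) * kernelAvg w (LocalEq.dirDeriv e h) 1 (midDiff z).1 (midDiff z).2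
      (Fin.cons e Fin.elim0) -
    (1 / 2 : ℂ) * kernelAvg w (LocalEq.dirDeriv e (LocalEq.dirDeriv e h)) 0 (midDiff z).1
      (midDiff z).2 Fin.elim0)

theorem continuousOn_pairDeriv (hw : KernelFamily w Z S K T) (hh : IsWeight h K T) (s : ℝ)
    (e : Spacetime) : ContinuousOn (pairDeriv w h s e) (midDiff ⁻¹' (T ×ˢ S)) :=
  (continuousOn_const.mul (hw.continuousOn_kernelAvg_pair hh _)).sub
    (continuousOn_const.mul (hw.continuousOn_kernelAvg_pair (hh.dirDeriv e) _))

theorem continuousOn_pairDeriv₂ (hw : KernelFamily w Z S K T) (hh : IsWeight h K T) (s : ℝ)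
    (e : Spacetime) : ContinuousOn (pairDeriv₂ w h s e) (midDiff ⁻¹' (T ×ˢ S)) :=
  (continuousOn_const.mul ((continuousOn_const.mul (hw.continuousOn_kernelAvg_pair hh _)).sub
    (continuousOn_const.mul (hw.continuousOn_kernelAvg_pair (hh.dirDeriv e) _)))).sub
  (continuousOn_const.mul ((continuousOn_const.mul
    (hw.continuousOn_kernelAvg_pair (hh.dirDeriv e) _)).sub
    (continuousOn_const.mul (hw.continuousOn_kernelAvg_pair ((hh.dirDeriv e).dirDeriv e) _))))

theorem hasLineDerivAt_pairDeriv (hw : KernelFamily w Z S K T) (hh : IsWeight h K T)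
    {e : Spacetime} {s : ℝ} {d : Spacetime × Spacetime}
    (hd : midDiff d = ((1 / 2 : ℝ) • e, (s / 2) • e)) {z : Spacetime × Spacetime}
    (hz : z ∈ midDiff ⁻¹' (T ×ˢ S)) :
    HasLineDerivAt ℝ (pairDeriv w h s e) (pairDeriv₂ w h s e z) z d := by
  have h1 := hw.hasLineDerivAt_kernelAvg hh (Fin.cons e Fin.elim0) hd hz
  have h2 := hw.hasLineDerivAt_kernelAvg (hh.dirDeriv e) Fin.elim0 hd hz
  exact (h1.const_mul (s / 2 : ℂ)).fun_sub (h2.const_mul (1 / 2 : ℂ))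

/-- Integration by parts twice along `d`, a direction moving only one of the two points when used
below, shifts both derivatives from the test function to the kernel. -/
theorem integral_second_parts (hw : KernelFamily w Z S K T) (hh : IsWeight h K T)
    {e : Spacetime} {s : ℝ} {d : Spacetime × Spacetime}
    (hd : midDiff d = ((1 / 2 : ℝ) • e, (s / 2) • e)) {C : Set (Spacetime × Spacetime)}
    (hC : IsCompact C) (hCΩ : C ⊆ midDiff ⁻¹' (T ×ˢ S)) {Ψ Ψ' Ψ'' : Spacetime × Spacetime → ℂ}
    (hΨ : Continuous Ψ) (hΨ' : Continuous Ψ') (hΨ'' : Continuous Ψ'')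
    (h0 : ∀ z, z ∉ C → Ψ z = 0) (h0' : ∀ z, z ∉ C → Ψ' z = 0) (h0'' : ∀ z, z ∉ C → Ψ'' z = 0)
    (hdΨ : ∀ z, HasLineDerivAt ℝ Ψ (Ψ' z) z d) (hdΨ' : ∀ z, HasLineDerivAt ℝ Ψ' (Ψ'' z) z d) :
    ∫ z, Ψ'' z * avg w h (midDiff z).1 (midDiff z).2 = ∫ z, Ψ z * pairDeriv₂ w h s e z := by
  have hΩ := (hw.isOpenT.prod hw.isOpenS).preimage continuous_midDiff
  have : (volume : Measure (Spacetime × Spacetime)).IsAddHaarMeasure :=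
    inferInstanceAs ((volume.prod volume : Measure (Spacetime × Spacetime)).IsAddHaarMeasure)
  have e0 : ∫ z, Ψ'' z * avg w h (midDiff z).1 (midDiff z).2 =
      ∫ z, Ψ'' z * kernelAvg w h 0 (midDiff z).1 (midDiff z).2 Fin.elim0 := by
    congr 1
    funext z
    by_cases hz : z ∈ C
    · rw [hw.kernelAvg_zero hh (hCΩ hz).1 (hCΩ hz).2]
    · rw [h0'' z hz, zero_mul, zero_mul]
  rw [e0, integral_lineDeriv_mul_eq (μ := volume) hΩ hC hCΩ hΨ' hΨ'' h0' h0'' hdΨ'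
    (hw.continuousOn_kernelAvg_pair hh _) (hw.continuousOn_pairDeriv hh s e)
    fun z hz => hw.hasLineDerivAt_kernelAvg hh _ hd hz,
    integral_lineDeriv_mul_eq (μ := volume) hΩ hC hCΩ hΨ hΨ' h0 h0' hdΨ
    (hw.continuousOn_pairDeriv hh s e) (hw.continuousOn_pairDeriv₂ hh s e)
    fun z hz => hw.hasLineDerivAt_pairDeriv hh hd hz, neg_neg]

theorem hasLineDerivAt_fst (φ χ : TestFn) (ν : Fin 4) (z : Spacetime × Spacetime) :
    HasLineDerivAt ℝ (fun z : Spacetime × Spacetime => φ.1 z.1 * χ.1 z.2)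
      ((pdT ν φ).1 z.1 * χ.1 z.2) z (basisVec ν, 0) := by
  have := (hasLineDerivAt_testFn φ ν z.1).mul_const (χ.1 z.2)
  simpa [HasLineDerivAt] using this

theorem hasLineDerivAt_snd (φ χ : TestFn) (ν : Fin 4) (z : Spacetime × Spacetime) :
    HasLineDerivAt ℝ (fun z : Spacetime × Spacetime => φ.1 z.1 * χ.1 z.2)
      (φ.1 z.1 * (pdT ν χ).1 z.2) z (0, basisVec ν) := by
  have := (hasLineDerivAt_testFn χ ν z.2).const_mul (φ.1 z.1)
  simpa [HasLineDerivAt] using this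

/-- The weak form of the wave equation becomes pointwise: after two integrations by parts the
continuous function in question is orthogonal to all products of test functions. -/
theorem sum_pairDeriv₂_eq_zero (hw : KernelFamily w Z S K T) (hh : IsWeight h K T)
    (hl : ∀ φ χ : TestFn, tsupport φ.1 ×ˢ tsupport χ.1 ⊆ midDiff ⁻¹' (T ×ˢ S) →
      ∫ z : Spacetime × Spacetime,
        (boxT φ).1 z.1 * χ.1 z.2 * avg w h (midDiff z).1 (midDiff z).2 = 0)
    (hr : ∀ φ χ : TestFn, tsupport φ.1 ×ˢ tsupport χ.1 ⊆ midDiff ⁻¹' (T ×ˢ S) →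
      ∫ z : Spacetime × Spacetime,
        φ.1 z.1 * (boxT χ).1 z.2 * avg w h (midDiff z).1 (midDiff z).2 = 0)
    {s : ℝ} (hs : s = 1 ∨ s = -1) {z : Spacetime × Spacetime} (hz : z ∈ midDiff ⁻¹' (T ×ˢ S)) :
    ∑ ν, (eta ν : ℂ) * pairDeriv₂ w h s (basisVec ν) z = 0 := by
  have hΩ := (hw.isOpenT.prod hw.isOpenS).preimage continuous_midDiff
  have hcont : ContinuousOn (fun z => ∑ ν, (eta ν : ℂ) * pairDeriv₂ w h s (basisVec ν) z)
      (midDiff ⁻¹' (T ×ˢ S)) := continuousOn_finsetSum _ fun ν _ =>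
    continuousOn_const.mul (hw.continuousOn_pairDeriv₂ hh s _)
  have havg : ContinuousOn (fun z => avg w h (midDiff z).1 (midDiff z).2)
      (midDiff ⁻¹' (T ×ˢ S)) :=
    (hw.continuousOn_avg hh).comp continuous_midDiff.continuousOn fun _ hz => hz
  refine kernel_eq_of_test_eq (Q₁ := fun x₁ x₂ =>
      ∑ ν, (eta ν : ℂ) * pairDeriv₂ w h s (basisVec ν) (x₁, x₂)) (Q₂ := fun _ _ => 0) hΩ hcont
    continuousOn_const (fun φ χ hφχ => ?_) (a := z.1) (b := z.2) hz
  simp only [mul_zero, integral_zero]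
  rw [(integral_test_kernel φ χ (Q := fun x₁ x₂ =>
      ∑ ν, (eta ν : ℂ) * pairDeriv₂ w h s (basisVec ν) (x₁, x₂)) hΩ hcont hφχ).2]
  have hC : IsCompact (tsupport φ.1 ×ˢ tsupport χ.1) := φ.2.2.isCompact.prod χ.2.2.isCompact
  have hvan : ∀ φ' χ' : TestFn, tsupport φ'.1 ⊆ tsupport φ.1 → tsupport χ'.1 ⊆ tsupport χ.1 →
      ∀ z, z ∉ tsupport φ.1 ×ˢ tsupport χ.1 → φ'.1 z.1 * χ'.1 z.2 = 0 := by
    intro φ' χ' hφ' hχ' z hz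
    by_contra hne
    exact hz ⟨hφ' (subset_tsupport _ (left_ne_zero_of_mul hne)),
      hχ' (subset_tsupport _ (right_ne_zero_of_mul hne))⟩
  have hcts : ∀ φ' χ' : TestFn, Continuous fun z : Spacetime × Spacetime => φ'.1 z.1 * χ'.1 z.2 :=
    fun φ' χ' => by
      have := φ'.2.1.continuous
      have := χ'.2.1.continuous
      fun_prop
  have hint : ∀ ν, Integrable fun z : Spacetime × Spacetime =>
      φ.1 z.1 * χ.1 z.2 * ((eta ν : ℂ) * pairDeriv₂ w h s (basisVec ν) z) := fun ν =>
    (integral_test_kernel φ χ (Q := fun x₁ x₂ => (eta ν : ℂ) *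
      pairDeriv₂ w h s (basisVec ν) (x₁, x₂)) hΩ
      (continuousOn_const.mul (hw.continuousOn_pairDeriv₂ hh s _)) hφχ).1
  have hsplit : ∫ z : Spacetime × Spacetime, φ.1 z.1 * χ.1 z.2 *
      (∑ ν, (eta ν : ℂ) * pairDeriv₂ w h s (basisVec ν) z) =
      ∑ ν, (eta ν : ℂ) * ∫ z : Spacetime × Spacetime, φ.1 z.1 * χ.1 z.2 *
        pairDeriv₂ w h s (basisVec ν) z := by
    simp only [Finset.mul_sum]
    rw [integral_finsetSum _ fun ν _ => hint ν]
    refine Finset.sum_congr rfl fun ν _ => ?_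
    rw [← integral_const_mul]
    congr 1
    funext z
    ring
  refine hsplit.trans ?_
  have hterm : ∀ φ' χ' : TestFn, tsupport φ'.1 ⊆ tsupport φ.1 → tsupport χ'.1 ⊆ tsupport χ.1 →
      Integrable fun z : Spacetime × Spacetime =>
        φ'.1 z.1 * χ'.1 z.2 * avg w h (midDiff z).1 (midDiff z).2 := fun φ' χ' hφ' hχ' =>
    (integral_test_kernel φ' χ' (Q := fun x₁ x₂ =>
      avg w h (midDiff (x₁, x₂)).1 (midDiff (x₁, x₂)).2) hΩ havg
      ((Set.prod_mono hφ' hχ').trans hφχ)).1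
  rcases hs with rfl | rfl
  · have h2 : ∀ ν, ∫ z : Spacetime × Spacetime, φ.1 z.1 * χ.1 z.2 *
        pairDeriv₂ w h 1 (basisVec ν) z = ∫ z : Spacetime × Spacetime,
          (pdT ν (pdT ν φ)).1 z.1 * χ.1 z.2 * avg w h (midDiff z).1 (midDiff z).2 := fun ν => by
      have t1 := tsupport_pdT ν φ
      have t2 := (tsupport_pdT ν (pdT ν φ)).trans t1
      exact (hw.integral_second_parts hh (d := (basisVec ν, 0)) (by simp [midDiff]) hC hφχ (hcts φ χ)
        (hcts (pdT ν φ) χ) (hcts (pdT ν (pdT ν φ)) χ) (hvan _ _ subset_rfl subset_rfl)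
        (hvan _ _ t1 subset_rfl) (hvan _ _ t2 subset_rfl) (hasLineDerivAt_fst φ χ ν)
        (hasLineDerivAt_fst (pdT ν φ) χ ν)).symm
    rw [← hl φ χ hφχ]
    simp only [h2, boxT_apply, Finset.sum_mul, ← integral_const_mul]
    rw [integral_finsetSum]
    · simp only [mul_assoc]
    · intro ν _
      simp only [mul_assoc]
      refine Integrable.const_mul ?_ _
      simpa only [mul_assoc] using hterm (pdT ν (pdT ν φ)) χ
        ((tsupport_pdT ν (pdT ν φ)).trans (tsupport_pdT ν φ)) subset_rfl
  · have h2 : ∀ ν, ∫ z : Spacetime × Spacetime, φ.1 z.1 * χ.1 z.2 *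
        pairDeriv₂ w h (-1) (basisVec ν) z = ∫ z : Spacetime × Spacetime,
          φ.1 z.1 * (pdT ν (pdT ν χ)).1 z.2 * avg w h (midDiff z).1 (midDiff z).2 := fun ν => by
      have t1 := tsupport_pdT ν χ
      have t2 := (tsupport_pdT ν (pdT ν χ)).trans t1
      refine (hw.integral_second_parts hh (d := (0, basisVec ν)) ?_ hC hφχ (hcts φ χ)
        (hcts φ (pdT ν χ)) (hcts φ (pdT ν (pdT ν χ))) (hvan _ _ subset_rfl subset_rfl)
        (hvan _ _ subset_rfl t1) (hvan _ _ subset_rfl t2) (hasLineDerivAt_snd φ χ ν)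
        (hasLineDerivAt_snd φ (pdT ν χ) ν)).symm
      simp only [midDiff]
      ext1
      · simp only [zero_add]
      · simp only [zero_sub]; module
    rw [← hr φ χ hφχ]
    simp only [h2, boxT_apply, Finset.sum_mul, Finset.mul_sum, ← integral_const_mul]
    rw [integral_finsetSum]
    · refine Finset.sum_congr rfl fun ν _ => ?_
      congr 1
      funext z
      ring
    · intro ν _
      refine ((hterm φ (pdT ν (pdT ν χ)) subset_rfl
        ((tsupport_pdT ν (pdT ν χ)).trans (tsupport_pdT ν χ))).const_mul (eta ν : ℂ)).congr
        (Eventually.of_forall fun z => ?_)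
      simp only
      ring

/-- The field equations for the averaged kernels. -/
theorem field_equations
    (hz : ∀ s : ℝ, s = 1 ∨ s = -1 → ∀ z ∈ midDiff ⁻¹' (T ×ˢ S),
      ∑ ν, (eta ν : ℂ) * pairDeriv₂ w h s (basisVec ν) z = 0)
    {x ζ : Spacetime} (hx : x ∈ T) (hζ : ζ ∈ S) :
    ∑ ν, (eta ν : ℂ) * kernelAvg w (LocalEq.dirDeriv (basisVec ν) h) 1 x ζ
      (Fin.cons (basisVec ν) Fin.elim0) = 0 ∧
    ∑ ν, (eta ν : ℂ) * (kernelAvg w h 2 x ζ (Fin.cons (basisVec ν) (Fin.cons (basisVec ν) Fin.elim0)) +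
      kernelAvg w (LocalEq.dirDeriv (basisVec ν) (LocalEq.dirDeriv (basisVec ν) h)) 0 x ζ
        Fin.elim0) = 0 := by
  have hmem : (x + ζ, x - ζ) ∈ midDiff ⁻¹' (T ×ˢ S) := by
    rw [mem_preimage, midDiff_add_sub]
    exact ⟨hx, hζ⟩
  have h1 := hz 1 (Or.inl rfl) _ hmem
  have h2 := hz (-1) (Or.inr rfl) _ hmem
  simp only [pairDeriv₂, midDiff_add_sub, Complex.ofReal_one, Complex.ofReal_neg] at h1 h2
  simp only [Fin.sum_univ_four] at h1 h2 ⊢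
  constructor
  -- The two wave operators are one quarter of `(∂_x ± ∂_ζ)²`. Their difference isolates the mixed
  -- term, while their sum leaves the two pure ones.
  · linear_combination h2 - h1
  · linear_combination 2 * h2 + 2 * h1

end KernelFamily

/-! ### Differentiating the field equations with respect to the half difference -/

namespace KernelFamily

variable {w : Spacetime → Spacetime → ℂ} {Z S K T : Set Spacetime} {h : Spacetime → ℂ}

theorem hasDerivAt_kernelAvg_line (hw : KernelFamily w Z S K T) (hh : IsWeight h K T) {m : ℕ}
    {x ζ : Spacetime} (hx : x ∈ T) (hζ : ζ ∈ S) (v : Fin m → Spacetime) (e : Spacetime) :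
    HasDerivAt (fun t : ℝ => kernelAvg w h m x (ζ + t • e) v)
      (kernelAvg w h (m + 1) x ζ (Fin.cons e v)) 0 := by
  have h1 := hw.hasFDerivAt_kernelAvg hh m hx hζ
  have h2 := ((ContinuousMultilinearMap.apply ℝ (fun _ : Fin m => Spacetime) ℂ
    v).hasFDerivAt).comp ζ h1
  exact h2.hasLineDerivAt e

theorem deriv_eq_zero (hw : KernelFamily w Z S K T) {F : Spacetime → ℂ} (hF : ∀ ζ ∈ S, F ζ = 0)
    {ζ : Spacetime} (hζ : ζ ∈ S) {e : Spacetime} {F' : ℂ}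
    (hd : HasDerivAt (fun t : ℝ => F (ζ + t • e)) F' 0) : F' = 0 := by
  have hc : Continuous fun t : ℝ => ζ + t • e := by fun_prop
  have hev : (fun t : ℝ => F (ζ + t • e)) =ᶠ[𝓝 0] fun _ => 0 := by
    filter_upwards [(hw.isOpenS.preimage hc).mem_nhds (by simpa using hζ : (0 : ℝ) ∈ _)] with t ht
    exact hF _ ht
  exact hd.unique ((hasDerivAt_const (0 : ℝ) (0 : ℂ)).congr_of_eventuallyEq hev)

/-- The equation holds for all `ζ` in an open set, so it may be differentiated along `ζ`. The
contracted index sits last and new derivatives are put in front, which makes the induction run. -/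
theorem divergence_eq_zero (hw : KernelFamily w Z S K T) (hh : IsWeight h K T)
    {x : Spacetime} (hx : x ∈ T)
    (h0 : ∀ ζ ∈ S, ∑ ν, (eta ν : ℂ) * kernelAvg w (LocalEq.dirDeriv (basisVec ν) h) 1 x ζ
      (Fin.cons (basisVec ν) Fin.elim0) = 0) (m : ℕ) :
    ∀ ζ ∈ S, ∀ v : Fin m → Spacetime,
      ∑ ν, kernelAvg w (LocalEq.dirDeriv (basisVec ν) h) (m + 1) x ζ
        (Fin.snoc (α := fun _ => Spacetime) v (upVec ν)) = 0 := by
  induction m with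
  | zero =>
    intro ζ hζ v
    rw [← h0 ζ hζ]
    refine Finset.sum_congr rfl fun ν _ => ?_
    have hv : Fin.snoc (α := fun _ => Spacetime) v (upVec ν) =
        fun i => eta ν • (Fin.cons (basisVec ν) Fin.elim0 : Fin 1 → Spacetime) i := by
      funext i
      fin_cases i
      rfl
    rw [hv, ContinuousMultilinearMap.map_smul_univ]
    simp [Complex.real_smul]
  | succ m ih =>
    intro ζ hζ v
    have hcons : ∀ ν, Fin.snoc (α := fun _ => Spacetime) v (upVec ν) =
        Fin.cons (v 0) (Fin.snoc (α := fun _ => Spacetime) (Fin.tail v) (upVec ν)) := fun ν => by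
      rw [Fin.cons_snoc_eq_snoc_cons, Fin.cons_self_tail]
    simp only [hcons]
    exact hw.deriv_eq_zero (fun ζ' hζ' => ih ζ' hζ' (Fin.tail v)) hζ
      (HasDerivAt.fun_sum fun ν _ => hw.hasDerivAt_kernelAvg_line (hh.dirDeriv _) hx hζ _ _)

theorem wave_eq_zero (hw : KernelFamily w Z S K T) (hh : IsWeight h K T)
    {x : Spacetime} (hx : x ∈ T)
    (h0 : ∀ ζ ∈ S, ∑ ν, (eta ν : ℂ) * (kernelAvg w h 2 x ζ
        (Fin.cons (basisVec ν) (Fin.cons (basisVec ν) Fin.elim0)) +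
      kernelAvg w (LocalEq.dirDeriv (basisVec ν) (LocalEq.dirDeriv (basisVec ν) h)) 0 x ζ
        Fin.elim0) = 0) (m : ℕ) :
    ∀ ζ ∈ S, ∀ v : Fin m → Spacetime,
      ∑ ν, (eta ν : ℂ) * (kernelAvg w h (m + 2) x ζ
          (Fin.snoc (α := fun _ => Spacetime) (Fin.snoc (α := fun _ => Spacetime) v (upVec ν))
            (upVec ν)) +
        kernelAvg w (LocalEq.dirDeriv (basisVec ν) (LocalEq.dirDeriv (basisVec ν) h)) m x ζ v) =
        0 := by
  induction m with
  | zero =>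
    intro ζ hζ v
    rw [← h0 ζ hζ]
    refine Finset.sum_congr rfl fun ν _ => ?_
    have hv : Fin.snoc (α := fun _ => Spacetime) (Fin.snoc (α := fun _ => Spacetime) v (upVec ν))
        (upVec ν) = fun i => eta ν • (Fin.cons (basisVec ν) (Fin.cons (basisVec ν)
          Fin.elim0) : Fin 2 → Spacetime) i := by
      funext i
      fin_cases i <;> rfl
    have hη : eta ν * eta ν = 1 := eta_mul_eta ν
    rw [hv, ContinuousMultilinearMap.map_smul_univ, Fin.prod_univ_two, hη, one_smul,
      Subsingleton.elim v Fin.elim0]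
  | succ m ih =>
    intro ζ hζ v
    have hcons : ∀ ν, Fin.snoc (α := fun _ => Spacetime)
        (Fin.snoc (α := fun _ => Spacetime) v (upVec ν)) (upVec ν) =
        Fin.cons (v 0) (Fin.snoc (α := fun _ => Spacetime)
          (Fin.snoc (α := fun _ => Spacetime) (Fin.tail v) (upVec ν)) (upVec ν)) := fun ν => by
      rw [Fin.cons_snoc_eq_snoc_cons, Fin.cons_snoc_eq_snoc_cons, Fin.cons_self_tail]
    have hv : v = Fin.cons (v 0) (Fin.tail v) := (Fin.cons_self_tail v).symm
    simp only [hcons]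
    rw [hv]
    simp only [Fin.cons_zero, Fin.tail_cons]
    exact hw.deriv_eq_zero (fun ζ' hζ' => ih ζ' hζ' (Fin.tail v)) hζ
      (HasDerivAt.fun_sum fun ν _ => ((hw.hasDerivAt_kernelAvg_line hh hx hζ _ _).fun_add
        (hw.hasDerivAt_kernelAvg_line ((hh.dirDeriv _).dirDeriv _) hx hζ _ _)).const_mul _)

end KernelFamily

theorem tendsto_zero_of_eq_zero {r : ℝ} (hr : 0 < r) {F : Spacetime → ℂ} {L : ℂ}
    (hF : ∀ ζ ∈ Metric.ball (0 : Spacetime) r ∩ spacelike, F ζ = 0)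
    (hL : Tendsto F (𝓝[spacelike] 0) (𝓝 L)) : L = 0 := by
  have := nhdsWithin_spacelike_neBot
  have hev : F =ᶠ[𝓝[spacelike] 0] fun _ => 0 := by
    filter_upwards [inter_mem (mem_nhdsWithin_of_mem_nhds (Metric.ball_mem_nhds 0 hr))
      self_mem_nhdsWithin] with ζ hζ
    exact hF ζ hζ
  exact tendsto_nhds_unique (hL.congr' hev) tendsto_const_nhds

theorem regularized_kernel_pair {ω ωf : State} {f : Spacetime → ℝ} (hf : IsMollifier f)
    (hreg : IsRegularization ω f ωf) {w : Spacetime → Spacetime → ℂ} {Z S K T : Set Spacetime}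
    (hw : KernelFamily w Z S K T) (hS : S ⊆ spacelike) (hh : IsWeight (fun y => (f y : ℂ)) K T)
    {V : Set Spacetime}
    (hk : ∀ y ∈ tsupport f, ∃ U, IsKernelOn ω.twoPoint U w ∧ ∀ x ∈ T, ∀ ζ ∈ V, (x + y, ζ) ∈ U)
    (hSV : S = V ∩ spacelike) (φ χ : TestFn)
    (hφχ : tsupport φ.1 ×ˢ tsupport χ.1 ⊆ midDiff ⁻¹' (T ×ˢ S)) :
    ∫ z : Spacetime × Spacetime, φ.1 z.1 * χ.1 z.2 *
      avg w (fun y => (f y : ℂ)) (midDiff z).1 (midDiff z).2 =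
      ωf.twoPoint φ χ - vacForm φ χ := by
  have h1 := regularized_kernel hf hreg hw hS hh hk hSV φ χ
    fun x₁ h₁ x₂ h₂ => hφχ (mk_mem_prod h₁ h₂)
  have h2 := (integral_test_kernel φ χ
    (Q := fun x₁ x₂ => avg w (fun y => (f y : ℂ)) (midDiff (x₁, x₂)).1 (midDiff (x₁, x₂)).2)
    (Ω := midDiff ⁻¹' (T ×ˢ S)) ((hw.isOpenT.prod hw.isOpenS).preimage continuous_midDiff)
    ((hw.continuousOn_avg hh).comp continuous_midDiff.continuousOn fun _ h => h) hφχ).2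
  exact h2.symm.trans h1.symm

/-- The field equations for the averages of the expectation values of the balanced derivatives. -/
theorem theta_equations {ω ωf : State} {ρ : Spacetime → Measure Spacetime}
    {Oω : Set Spacetime} (hρ : ∀ x ∈ Oω, IsThermalAt ω x (ρ x)) (hOω : IsOpen Oω)
    {f : Spacetime → ℝ} (hf : IsMollifier f) (hreg : IsRegularization ω f ωf) {x : Spacetime}
    (hx : ∀ y ∈ tsupport f, x + y ∈ Oω) {h : Spacetime → ℂ} (hfh : h = fun y => (f y : ℂ))
    {m : ℕ} (μ : Fin m → Fin 4) :
    ∑ ν, ∫ z, dirDeriv (basisVec ν) h (z - x) *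
      refTheta (ρ z) (fun i => upVec (Fin.snoc (α := fun _ => Fin 4) μ ν i)) = 0 ∧
    ∑ ν, (eta ν : ℂ) * ((∫ z, h (z - x) * refTheta (ρ z) (fun i => upVec
        (Fin.snoc (α := fun _ => Fin 4) (Fin.snoc (α := fun _ => Fin 4) μ ν) ν i))) +
      ∫ z, dirDeriv (basisVec ν) (dirDeriv (basisVec ν) h) (z - x) *
        refTheta (ρ z) (fun i => upVec (μ i))) = 0 := by
  obtain ⟨K, δ, r, hδ, hr, hK, hKO, hw, hh, hker⟩ := exists_kernelFamily hρ hOω hf hx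
  rw [← hfh] at hh
  have hxT : x ∈ Metric.ball x δ := Metric.mem_ball_self hδ
  have hkernel : ∀ φ χ : TestFn, tsupport φ.1 ×ˢ tsupport χ.1 ⊆
      midDiff ⁻¹' (Metric.ball x δ ×ˢ (Metric.ball 0 r ∩ spacelike)) →
      ∫ z : Spacetime × Spacetime, φ.1 z.1 * χ.1 z.2 *
        avg (theKernel ω.twoPoint) h (midDiff z).1 (midDiff z).2 =
        ωf.twoPoint φ χ - vacForm φ χ := fun φ χ hφχ => by
    subst hfh
    exact regularized_kernel_pair hf hreg hw inter_subset_right hh hker rfl φ χ hφχ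
  -- Fields smeared with `□φ` vanish in the algebra, and so does the vacuum form on them; hence the
  -- averaged kernel is a weak solution in each point.
  have hsum := fun (s : ℝ) (hs : s = 1 ∨ s = -1) z hz => hw.sum_pairDeriv₂_eq_zero hh
    (fun φ χ hφχ => by
      rw [hkernel _ χ ((Set.prod_mono (tsupport_boxT φ) subset_rfl).trans hφχ), vacForm_boxT_left,
        State.twoPoint, field_boxT, zero_mul, map_zero, sub_zero])
    (fun φ χ hφχ => by
      rw [hkernel φ _ ((Set.prod_mono subset_rfl (tsupport_boxT χ)).trans hφχ), vacForm_boxT_right,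
        State.twoPoint, field_boxT, mul_zero, map_zero, sub_zero]) hs (z := z) hz
  have hfe := fun ζ hζ => KernelFamily.field_equations hsum hxT (ζ := ζ) hζ
  have hsnoc : ∀ {m : ℕ} (μ : Fin m → Fin 4) ν, Fin.snoc (α := fun _ => Spacetime)
      (fun i => upVec (μ i)) (upVec ν) =
        fun i => upVec (Fin.snoc (α := fun _ => Fin 4) μ ν i) := fun μ ν =>
    (Fin.comp_snoc upVec μ ν).symm
  -- Derivatives of a weight are again weights, so the limits `ζ → 0` exist for all terms of the
  -- equations.
  have hl₁ := fun ν => (kernelAvg_bound_tendsto hρ hKO hr hw (hh.dirDeriv (basisVec ν)) hxT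
    (Fin.snoc (α := fun _ => Fin 4) μ ν)).2
  have hl₂ := fun ν => (((kernelAvg_bound_tendsto hρ hKO hr hw hh hxT (Fin.snoc (α := fun _ => Fin 4)
        (Fin.snoc (α := fun _ => Fin 4) μ ν) ν)).2.add
      (kernelAvg_bound_tendsto hρ hKO hr hw ((hh.dirDeriv (basisVec ν)).dirDeriv (basisVec ν)) hxT
        μ).2).const_mul (eta ν : ℂ))
  constructor
  · refine tendsto_zero_of_eq_zero hr (fun ζ hζ => ?_) (tendsto_finsetSum _ fun ν _ => hl₁ ν)
    have := hw.divergence_eq_zero hh hxT (fun ζ hζ => (hfe ζ hζ).1) m ζ hζ fun i => upVec (μ i)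
    simpa only [hsnoc] using this
  · refine tendsto_zero_of_eq_zero hr (fun ζ hζ => ?_) (tendsto_finsetSum _ fun ν _ => hl₂ ν)
    have := hw.wave_eq_zero hh hxT (fun ζ hζ => (hfe ζ hζ).2) m ζ hζ fun i => upVec (μ i)
    simpa only [hsnoc] using this

/-! ### Transport equation and wave equation for averages -/

theorem continuousOn_sphere_integral {A : Sphere → ℝ} (hA : Continuous A) {φ : ℝ → ℝ}
    (hφ : ContinuousOn φ (Ioi 0)) :
    ContinuousOn (fun β => ∫ n, A n * φ (mink β (ray n)) ∂sphereMeasure) forwardCone := by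
  refine continuousOn_integral_of_compact_support (k := univ) isCompact_univ ?_
    fun _ _ _ h => absurd trivial h
  exact (hA.comp continuous_snd).continuousOn.mul (continuousOn_comp_ray hφ)

theorem continuousOn_inv_pow (m : ℕ) : ContinuousOn (fun s : ℝ => (s ^ m)⁻¹) (Ioi 0) :=
  (continuousOn_id.pow _).inv₀ fun _ hs => pow_ne_zero _ (ne_of_gt hs)

/-- Derivatives of `f` change sign. Their positive and negative parts are continuous and give one
measure each. -/
theorem ThermalFamily.exists_signed_average {ρ : Spacetime → Measure Spacetime}
    {K B : Set Spacetime} (h : ThermalFamily ρ K B) {g : Spacetime → ℝ} (hg : Continuous g)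
    (hgK : ∀ z, z ∉ K → g z = 0) : ∃ σ : Bool → Measure Spacetime, (∀ b, SupportedIn (σ b) B) ∧
      ∀ ψ : Spacetime → ℝ, ContinuousOn ψ forwardCone →
        ∫ z, g z * ∫ β, ψ β ∂ρ z = ∑ b, (if b then 1 else -1) * ∫ β, ψ β ∂σ b := by
  obtain ⟨σ, hσ, -, hσ'⟩ := h.exists_isAverage (g := fun z => max (g z) 0) (by fun_prop)
    (fun z => le_max_right _ _) fun z hz => by simp [hgK z hz]
  obtain ⟨τ, hτ, -, hτ'⟩ := h.exists_isAverage (g := fun z => max (-g z) 0) (by fun_prop)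
    (fun z => le_max_right _ _) fun z hz => by simp [hgK z hz]
  refine ⟨fun b => if b then σ else τ, by rintro (_ | _) <;> assumption, fun ψ hψ => ?_⟩
  have hψc : ContinuousOn (fun β => (ψ β : ℂ)) forwardCone :=
    Complex.continuous_ofReal.comp_continuousOn hψ
  have hreal : ∀ {k : Spacetime → ℝ} {τ : Measure Spacetime}, (∫ β, (ψ β : ℂ) ∂τ =
      ∫ z, (k z : ℂ) * ∫ β, (ψ β : ℂ) ∂ρ z) → ∫ β, ψ β ∂τ = ∫ z, k z * ∫ β, ψ β ∂ρ z := by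
    intro k τ hk
    simp only [integral_complex_ofReal, ← Complex.ofReal_mul] at hk
    exact_mod_cast hk
  have hint : ∀ {k : Spacetime → ℝ}, Continuous k → (∀ z, z ∉ K → k z = 0) →
      Integrable fun z => k z * ∫ β, ψ β ∂ρ z := fun {k} hk hk0 =>
    h.integrable_mul_real hk (HasCompactSupport.intro h.compact hk0)
      (closure_minimal (fun z hz => by by_contra hzK; exact hz (hk0 z hzK)) h.compact.isClosed)
      (hψ.mono h.subsetB)
  simp only [Fintype.sum_bool, if_true, Bool.false_eq_true, if_false, one_mul, neg_mul]
  rw [hreal (hσ' _ hψc), hreal (hτ' _ hψc), ← sub_eq_add_neg, ← integral_sub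
    (hint (by fun_prop) fun z hz => by simp [hgK z hz])
    (hint (by fun_prop) fun z hz => by simp [hgK z hz])]
  congr 1
  funext z
  rw [← sub_mul]
  congr 1
  rcases le_total (g z) 0 with h0 | h0
  · rw [max_eq_right h0, max_eq_left (by linarith)]; ring
  · rw [max_eq_left h0, max_eq_right (by linarith)]; ring

/-- Each signed weight is replaced by its pair of measures, with the sign moved into the
coefficient; the density argument for finitely many measures then applies. -/
theorem ThermalFamily.averages_functional_eq_zero {ρ : Spacetime → Measure Spacetime}
    {K B : Set Spacetime} (h : ThermalFamily ρ K B) {ι : Type*} [Fintype ι] {g : ι → Spacetime → ℝ}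
    (hg : ∀ i, Continuous (g i)) (hgK : ∀ i z, z ∉ K → g i z = 0) {c : ι → Sphere → ℝ}
    (hc : ∀ i, Continuous (c i))
    (hzero : ∀ (k : ℕ) (v : ℕ → Fin 4), ∑ i, ∫ z, g i z * ∫ β,
      (∫ n, (∏ j ∈ Finset.range (2 * k + 1), ray n (v j)) * c i n *
        (mink β (ray n) ^ (2 * k + 4))⁻¹ ∂sphereMeasure) ∂ρ z = 0)
    {φ : ℝ → ℝ} (hφ : ContinuousOn φ (Ioi 0)) (n : Sphere) :
    ∑ i, c i n * ∫ z, g i z * ∫ β, φ (mink β (ray n)) ∂ρ z = 0 := by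
  choose σ hσ hσ' using fun i => h.exists_signed_average (hg i) (hgK i)
  have hray := continuous_ray
  have key := measures_functional_eq_zero (σ := fun i : ι × Bool => σ i.1 i.2)
    (c := fun i n => c i.1 n * if i.2 then 1 else -1) (B := B) (fun i => hσ i.1 i.2)
    (fun i => (hc i.1).mul continuous_const) ?_ hφ n
  · rw [Fintype.sum_prod_type] at key
    rw [← key]
    refine Finset.sum_congr rfl fun i _ => ?_
    rw [hσ' i _ (continuousOn_comp_mink_ray hφ n), Finset.mul_sum]
    exact Finset.sum_congr rfl fun b _ => by ring
  · intro k v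
    rw [← hzero k v, Fintype.sum_prod_type]
    refine Finset.sum_congr rfl fun i _ => ?_
    rw [hσ' i _ (continuousOn_sphere_integral (A := fun n =>
      (∏ j ∈ Finset.range (2 * k + 1), ray n (v j)) * c i n) (by have := hc i; fun_prop)
      (continuousOn_inv_pow _))]
    refine Finset.sum_congr rfl fun b _ => ?_
    rw [← integral_const_mul]
    congr 1
    funext β
    rw [← integral_const_mul]
    congr 1
    funext n
    ring

theorem dirDeriv_ofReal {f : Spacetime → ℝ} (hf : Differentiable ℝ f) (e : Spacetime) :
    dirDeriv e (fun y => (f y : ℂ)) = fun y => ((fderiv ℝ f y e : ℝ) : ℂ) := by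
  funext y
  have := (Complex.ofRealCLM.hasFDerivAt (x := f y)).comp y (hf y).hasFDerivAt
  have h2 : HasFDerivAt (fun y => (f y : ℂ)) (Complex.ofRealCLM ∘L fderiv ℝ f y) y := this
  rw [dirDeriv, h2.fderiv]
  rfl

theorem ThermalFamily.integral_mul_refTheta {ρ : Spacetime → Measure Spacetime}
    {K B : Set Spacetime} (h : ThermalFamily ρ K B) {g : Spacetime → ℝ}
    (hgK : ∀ z, z ∉ K → g z = 0) {m : ℕ} (μ : Fin m → Fin 4) :
    ∫ z, (g z : ℂ) * refTheta (ρ z) (fun i => upVec (μ i)) =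
      thetaConst m * ((∫ z, g z * ∫ β, thetaFn μ β ∂ρ z : ℝ) : ℂ) := by
  rw [← integral_complex_ofReal, ← integral_const_mul]
  congr 1
  funext z
  by_cases hz : z ∈ K
  · rw [(h.supp z hz).refTheta_upVec]
    push_cast
    ring
  · simp [hgK z hz]

theorem thetaFn_snoc (k : ℕ) (v : ℕ → Fin 4) (ν : Fin 4) (β : Spacetime) :
    thetaFn (Fin.snoc (α := fun _ => Fin 4) (fun i : Fin (2 * k + 1) => v i) ν) β =
      ∫ n, (∏ j ∈ Finset.range (2 * k + 1), ray n (v j)) * ray n ν *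
        (mink β (ray n) ^ (2 * k + 4))⁻¹ ∂sphereMeasure := by
  simp only [thetaFn, Fin.prod_univ_castSucc, Fin.snoc_castSucc, Fin.snoc_last]
  simp only [← Fin.prod_univ_eq_prod_range, Fin.prod_univ_castSucc]

theorem mink_eq_sum (x y : Spacetime) : mink x y = ∑ μ, eta μ * (x μ * y μ) := rfl

/-- The contraction of the two added indices produces the Lorentz square of the light-like vector
`ray n` under the integral. -/
theorem sum_eta_thetaFn {m : ℕ} (μ : Fin m → Fin 4) {β : Spacetime} (hβ : β ∈ forwardCone) :
    ∑ ν, eta ν * thetaFn (Fin.snoc (α := fun _ => Fin 4)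
      (Fin.snoc (α := fun _ => Fin 4) μ ν) ν) β = 0 := by
  have hray := continuous_ray
  have hint : ∀ ν, Integrable (fun n => eta ν * ((∏ i, ray n (Fin.snoc (α := fun _ => Fin 4)
      (Fin.snoc (α := fun _ => Fin 4) μ ν) ν i)) * (mink β (ray n) ^ (m + 1 + 1 + 2))⁻¹))
      sphereMeasure := fun ν => by
    refine Continuous.integrable_of_hasCompactSupport ?_ (HasCompactSupport.of_compactSpace _)
    refine continuous_const.mul (Continuous.mul (by fun_prop) (Continuous.inv₀ (by fun_prop) ?_))
    exact fun n => pow_ne_zero _ (mink_ray_pos hβ n).ne'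
  simp only [thetaFn, ← integral_const_mul]
  rw [← integral_finsetSum _ fun ν _ => hint ν]
  refine integral_eq_zero_of_ae (Eventually.of_forall fun n => ?_)
  simp only [Fin.prod_univ_castSucc, Fin.snoc_castSucc, Fin.snoc_last]
  have h0 := mink_shell_self n
  calc _ = (∏ i, ray n (μ i)) * (mink β (ray n) ^ (m + 1 + 1 + 2))⁻¹ *
      mink (shell n) (shell n) := by
        rw [mink_eq_sum (shell n), Finset.mul_sum]
        refine Finset.sum_congr rfl fun ν _ => ?_
        rw [ray]
        ring
    _ = 0 := by rw [h0, mul_zero]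

section equations

variable {ω ωf : State} {ρ : Spacetime → Measure Spacetime} {Oω : Set Spacetime}
  {f : Spacetime → ℝ} {x : Spacetime}

/-- The averages of functions of `β p`, with `p` light-like, are constant along `p`. -/
theorem transport_equation (hρ : ∀ x ∈ Oω, IsThermalAt ω x (ρ x)) (hOω : IsOpen Oω)
    (hfam : ∀ K ⊆ Oω, IsCompact K → ∃ B, ThermalFamily ρ K B)
    (hf : IsMollifier f) (hreg : IsRegularization ω f ωf) (hx : ∀ y ∈ tsupport f, x + y ∈ Oω)
    {φ : ℝ → ℝ} (hφ : ContinuousOn φ (Ioi 0)) (n : Sphere) :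
    ∑ ν, ray n ν * ∫ z, fderiv ℝ f (z - x) (basisVec ν) * ∫ β, φ (mink β (ray n)) ∂ρ z = 0 := by
  obtain ⟨K, δ, r, hδ, hr, hK, hKO, hw, hh, hker⟩ := exists_kernelFamily hρ hOω hf hx
  obtain ⟨B, hB⟩ := hfam K hKO hK
  have hray := continuous_ray
  have hd := hf.smooth.differentiable (by simp)
  have hfd : Continuous (fderiv ℝ f) := hf.smooth.continuous_fderiv (by simp)
  have hgK : ∀ ν z, z ∉ K → fderiv ℝ f (z - x) (basisVec ν) = 0 := fun ν z hz => by
    have := (hh.dirDeriv (basisVec ν)).eq_zero (Metric.mem_ball_self hδ : x ∈ _) hz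
    rw [dirDeriv_ofReal hd] at this
    exact Complex.ofReal_eq_zero.1 this
  refine hB.averages_functional_eq_zero (g := fun ν z => fderiv ℝ f (z - x) (basisVec ν))
    (c := fun ν n => ray n ν) (fun ν => by fun_prop) hgK (fun ν => by fun_prop) (fun k v => ?_) hφ n
  have h1 := (theta_equations hρ hOω hf hreg hx rfl fun i : Fin (2 * k + 1) => v i).1
  simp only [dirDeriv_ofReal hd] at h1
  simp only [hB.integral_mul_refTheta (hgK _), ← Finset.mul_sum, ← Complex.ofReal_sum] at h1
  -- The `2k + 1` free indices and the contracted one make the order `2 (k + 1)`, so the constant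
  -- can be cancelled.
  have h2 := (mul_eq_zero.1 h1).resolve_left (thetaConst_ne_zero (k + 1))
  simp only [thetaFn_snoc] at h2
  exact_mod_cast h2

/-- The averages of functions of `β p`, with `p` light-like, solve the wave equation. -/
theorem wave_equation (hρ : ∀ x ∈ Oω, IsThermalAt ω x (ρ x)) (hOω : IsOpen Oω)
    (hfam : ∀ K ⊆ Oω, IsCompact K → ∃ B, ThermalFamily ρ K B)
    (hf : IsMollifier f) (hreg : IsRegularization ω f ωf) (hx : ∀ y ∈ tsupport f, x + y ∈ Oω)
    {φ : ℝ → ℝ} (hφ : ContinuousOn φ (Ioi 0)) (n : Sphere) :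
    ∑ ν, eta ν * ∫ z, fderiv ℝ (fun y => fderiv ℝ f y (basisVec ν)) (z - x) (basisVec ν) *
      ∫ β, φ (mink β (ray n)) ∂ρ z = 0 := by
  obtain ⟨K, δ, r, hδ, hr, hK, hKO, hw, hh, hker⟩ := exists_kernelFamily hρ hOω hf hx
  obtain ⟨B, hB⟩ := hfam K hKO hK
  have hray := continuous_ray
  have hxT : x ∈ Metric.ball x δ := Metric.mem_ball_self hδ
  have hd := hf.smooth.differentiable (by simp)
  have hs2 : ∀ e, ContDiff ℝ (⊤ : ℕ∞) fun y => fderiv ℝ f y e := fun e =>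
    (hf.smooth.fderiv_right (by exact_mod_cast le_top)).clm_apply contDiff_const
  have hd2 : ∀ e, Differentiable ℝ fun y => fderiv ℝ f y e := fun e =>
    (hs2 e).differentiable (by simp)
  have hc2 : ∀ e, Continuous (fderiv ℝ fun y => fderiv ℝ f y e) := fun e =>
    (hs2 e).continuous_fderiv (by simp)
  have hfK : ∀ z, z ∉ K → f (z - x) = 0 := fun z hz => by exact_mod_cast hh.eq_zero hxT hz
  have hgK : ∀ ν z, z ∉ K →
      fderiv ℝ (fun y => fderiv ℝ f y (basisVec ν)) (z - x) (basisVec ν) = 0 := fun ν z hz => by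
    have := ((hh.dirDeriv (basisVec ν)).dirDeriv (basisVec ν)).eq_zero hxT hz
    rw [dirDeriv_ofReal hd, dirDeriv_ofReal (hd2 _)] at this
    exact Complex.ofReal_eq_zero.1 this
  have hfc := hf.smooth.continuous
  -- The undifferentiated weight is non-negative, so the trace term can be evaluated in a genuine
  -- averaged measure.
  obtain ⟨σ, hσB, hσ⟩ := hB.exists_isAverage (g := fun z => f (z - x)) (by fun_prop)
    (fun z => hf.nonneg _) hfK
  refine hB.averages_functional_eq_zero
    (g := fun ν z => fderiv ℝ (fun y => fderiv ℝ f y (basisVec ν)) (z - x) (basisVec ν))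
    (c := fun ν _ => eta ν) (fun ν => ?_) hgK (fun ν => continuous_const) (fun k v => ?_) hφ n
  · have := hc2 (basisVec ν)
    fun_prop
  set μ : Fin (2 * k + 2) → Fin 4 := fun i => if (i : ℕ) < 2 * k + 1 then v i else 0 with hμ
  have h1 := (theta_equations hρ hOω hf hreg hx rfl μ).2
  simp only [dirDeriv_ofReal hd, dirDeriv_ofReal (hd2 _), mul_add, Finset.sum_add_distrib] at h1
  -- The term with two `ζ`-derivatives is a trace and vanishes on the support of `σ`; only the wave
  -- operator in `x` remains.
  have hz : ∑ ν, (eta ν : ℂ) * ∫ z, (f (z - x) : ℂ) * refTheta (ρ z) (fun i => upVec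
      (Fin.snoc (α := fun _ => Fin 4) (Fin.snoc (α := fun _ => Fin 4) μ ν) ν i)) = 0 := by
    simp only [integral_refTheta_eq hB hfK hσ, hσB.refTheta_upVec]
    have h2 : ∑ ν, eta ν * ∫ β, thetaFn (Fin.snoc (α := fun _ => Fin 4)
        (Fin.snoc (α := fun _ => Fin 4) μ ν) ν) β ∂σ = 0 := by
      simp only [← integral_const_mul]
      rw [← integral_finsetSum _ fun ν _ => (hσB.integrable (continuousOn_thetaFn _)).const_mul _]
      refine integral_eq_zero_of_ae ?_
      filter_upwards [hσB.ae_mem] with β hβ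
      exact sum_eta_thetaFn μ (hσB.subset hβ)
    calc _ = thetaConst (2 * k + 2 + 1 + 1) * ((∑ ν, eta ν * ∫ β, thetaFn (Fin.snoc
          (α := fun _ => Fin 4) (Fin.snoc (α := fun _ => Fin 4) μ ν) ν) β ∂σ : ℝ) : ℂ) := by
          push_cast
          rw [Finset.mul_sum]
          exact Finset.sum_congr rfl fun ν _ => by ring
      _ = 0 := by rw [h2, Complex.ofReal_zero, mul_zero]
  rw [hz, zero_add] at h1
  simp only [hB.integral_mul_refTheta (hgK _)] at h1
  have h3 : thetaConst (2 * (k + 1)) * ((∑ ν, eta ν * ∫ z,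
      fderiv ℝ (fun y => fderiv ℝ f y (basisVec ν)) (z - x) (basisVec ν) *
        ∫ β, thetaFn μ β ∂ρ z : ℝ) : ℂ) = 0 := by
    rw [← h1]
    push_cast
    rw [Finset.mul_sum]
    exact Finset.sum_congr rfl fun ν _ => mul_left_comm _ _ _
  have h4 := (mul_eq_zero.1 h3).resolve_left (thetaConst_ne_zero (k + 1))
  have h5 : ∑ ν, eta ν * ∫ z, fderiv ℝ (fun y => fderiv ℝ f y (basisVec ν)) (z - x) (basisVec ν) *
      ∫ β, thetaFn μ β ∂ρ z = 0 := by exact_mod_cast h4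
  rw [← h5]
  refine Finset.sum_congr rfl fun ν _ => ?_
  rw [← integral_const_mul]
  congr 1
  funext z
  have h6 : ∀ β, ∫ n, (∏ j ∈ Finset.range (2 * k + 1), ray n (v j)) * eta ν *
      (mink β (ray n) ^ (2 * k + 4))⁻¹ ∂sphereMeasure = eta ν * thetaFn μ β := fun β => by
    rw [thetaFn, ← integral_const_mul]
    congr 1
    funext n
    rw [prod_snoc_zero]
    ring
  simp only [h6, integral_const_mul]
  ring

end equations

/-! ### Smooth dependence on momentum and position -/

/-- The complex bilinear extension of the Lorentz product. -/
def pairL (β : Spacetime) : (Fin 4 → ℂ) →L[ℂ] ℂ :=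
  ∑ j, ((eta j * β j : ℝ) : ℂ) • ContinuousLinearMap.proj j

theorem pairL_apply (β : Spacetime) (k : Fin 4 → ℂ) :
    pairL β k = ∑ j, ((eta j * β j : ℝ) : ℂ) * k j := by
  simp [pairL]

theorem pairL_real (β p : Spacetime) : pairL β (fun i => (p i : ℂ)) = (mink β p : ℂ) := by
  rw [pairL_apply, mink_eq_sum]
  push_cast
  exact Finset.sum_congr rfl fun j _ => by ring

theorem continuous_pairL : Continuous fun q : (Fin 4 → ℂ) × Spacetime => pairL q.2 q.1 := by
  simp only [pairL_apply]
  have := Complex.continuous_ofReal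
  fun_prop

/-- The integral of `ψ` against the complex exponential. -/
def expIntegral (ψ : Spacetime → ℂ) (ν : Measure Spacetime) (k : Fin 4 → ℂ) : ℂ :=
  ∫ β, ψ β * exp (I * pairL β k) ∂ν

/-- The function `ψ` multiplied by the derivative of the exponent with respect to `k j`. -/
def mulCoord (j : Fin 4) (ψ : Spacetime → ℂ) (β : Spacetime) : ℂ :=
  I * ((eta j * β j : ℝ) : ℂ) * ψ β

theorem continuousOn_mulCoord {ψ : Spacetime → ℂ} {B : Set Spacetime} (hψ : ContinuousOn ψ B)
    (j : Fin 4) : ContinuousOn (mulCoord j ψ) B := by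
  have := Complex.continuous_ofReal
  exact (by fun_prop : Continuous fun β : Spacetime =>
    I * ((eta j * β j : ℝ) : ℂ)).continuousOn.mul hψ

theorem continuousOn_mul_exp {ψ : Spacetime → ℂ} {B : Set Spacetime} (hψ : ContinuousOn ψ B) :
    ContinuousOn (fun q : (Fin 4 → ℂ) × Spacetime => ψ q.2 * exp (I * pairL q.2 q.1))
      (univ ×ˢ B) :=
  (hψ.comp continuousOn_snd fun _ hq => hq.2).mul
    (continuous_const.mul continuous_pairL).cexp.continuousOn

theorem exists_bound_mul_exp {ψ : Spacetime → ℂ} {B : Set Spacetime} (hB : IsCompact B)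
    (hψ : ContinuousOn ψ B) (k₀ : Fin 4 → ℂ) :
    ∃ C, ∀ k ∈ Metric.closedBall k₀ 1, ∀ β ∈ B, ‖ψ β * exp (I * pairL β k)‖ ≤ C := by
  obtain ⟨C, hC⟩ := ((isCompact_closedBall k₀ 1).prod hB).exists_bound_of_continuousOn
    ((continuousOn_mul_exp hψ).mono (Set.prod_mono (subset_univ _) subset_rfl))
  exact ⟨C, fun k hk β hβ => hC (k, β) ⟨hk, hβ⟩⟩

theorem SupportedIn.integrable_of_continuousOn {ν : Measure Spacetime} {B : Set Spacetime}
    (h : SupportedIn ν B) {E : Type*} [NormedAddCommGroup E] {ψ : Spacetime → E}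
    (hψ : ContinuousOn ψ B) : Integrable ψ ν := by
  have := h.finite
  rw [← h.restrict]
  exact hψ.integrableOn_compact h.compact

/-- The coordinate functions. -/
def coordC (j : Fin 4) : (Fin 4 → ℂ) →L[ℂ] ℂ := ContinuousLinearMap.proj j

theorem coordC_apply (j : Fin 4) (k : Fin 4 → ℂ) : coordC j k = k j := rfl

/-- The derivative of `ψ β * exp (I * pairL β k)` with respect to `k`. -/
def expDeriv (ψ : Spacetime → ℂ) (k : Fin 4 → ℂ) (β : Spacetime) : (Fin 4 → ℂ) →L[ℂ] ℂ :=
  ∑ j, (mulCoord j ψ β * exp (I * pairL β k)) • coordC j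

theorem hasFDerivAt_mul_exp (ψ : Spacetime → ℂ) (k : Fin 4 → ℂ) (β : Spacetime) :
    HasFDerivAt (fun k => ψ β * exp (I * pairL β k)) (expDeriv ψ k β) k := by
  have h1 := (((pairL β).hasFDerivAt (x := k)).const_mul I).cexp.const_mul (ψ β)
  refine h1.congr_fderiv (ContinuousLinearMap.ext fun v => ?_)
  simp only [expDeriv, mulCoord, _root_.sum_apply, _root_.smul_apply,
    coordC_apply, smul_eq_mul, pairL_apply β v, Finset.mul_sum]
  exact Finset.sum_congr rfl fun j _ => by ring

theorem SupportedIn.integrable_mul_exp {ν : Measure Spacetime} {B : Set Spacetime}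
    (h : SupportedIn ν B) {ψ : Spacetime → ℂ} (hψ : ContinuousOn ψ B) (k : Fin 4 → ℂ) :
    Integrable (fun β => ψ β * exp (I * pairL β k)) ν :=
  h.integrable_of_continuousOn ((continuousOn_mul_exp hψ).comp (f := fun β => (k, β)) (by fun_prop)
    fun _ hβ => ⟨trivial, hβ⟩)

theorem integral_sum_smul {α E ι : Type*} [MeasurableSpace α] {μ : Measure α} [Fintype ι]
    [NormedAddCommGroup E] [NormedSpace ℂ E] [CompleteSpace E] {a : ι → α → ℂ} (L : ι → E)
    (ha : ∀ i, Integrable (a i) μ) :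
    Integrable (fun z => ∑ i, a i z • L i) μ ∧
      ∫ z, ∑ i, a i z • L i ∂μ = ∑ i, (∫ z, a i z ∂μ) • L i := by
  have hi := fun i => (ha i).smul_const (L i)
  refine ⟨integrable_finsetSum _ fun i _ => hi i, ?_⟩
  rw [integral_finsetSum _ fun i _ => hi i]
  exact Finset.sum_congr rfl fun i _ => integral_smul_const _ _

theorem SupportedIn.integral_expDeriv {ν : Measure Spacetime} {B : Set Spacetime}
    (h : SupportedIn ν B) {ψ : Spacetime → ℂ} (hψ : ContinuousOn ψ B) (k : Fin 4 → ℂ) :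
    Integrable (expDeriv ψ k) ν ∧
      ∫ β, expDeriv ψ k β ∂ν = ∑ j, expIntegral (mulCoord j ψ) ν k • coordC j :=
  integral_sum_smul coordC fun j => h.integrable_mul_exp (continuousOn_mulCoord hψ j) k

theorem exists_bound_expDeriv {ψ : Spacetime → ℂ} {B : Set Spacetime} (hB : IsCompact B)
    (hψ : ContinuousOn ψ B) (k₀ : Fin 4 → ℂ) :
    ∃ C, ∀ k ∈ Metric.ball k₀ 1, ∀ β ∈ B, ‖expDeriv ψ k β‖ ≤ C := by
  choose C hC using fun j => exists_bound_mul_exp hB (continuousOn_mulCoord hψ j) k₀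
  refine ⟨∑ j, C j * ‖coordC j‖, fun k hk β hβ => ?_⟩
  refine (norm_sum_le _ _).trans (Finset.sum_le_sum fun j _ => ?_)
  rw [norm_smul]
  exact mul_le_mul_of_nonneg_right (hC j k (Metric.ball_subset_closedBall hk) β hβ) (norm_nonneg _)

/-- Compactness of the temperature set bounds the exponential even at complex momenta, so
differentiation under the integral is legitimate. The derivative consists of integrals of the same
type with `ψ` multiplied by coordinates. -/
theorem SupportedIn.hasFDerivAt_expIntegral {ν : Measure Spacetime} {B : Set Spacetime}
    (h : SupportedIn ν B) {ψ : Spacetime → ℂ} (hψ : ContinuousOn ψ B) (k : Fin 4 → ℂ) :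
    HasFDerivAt (expIntegral ψ ν) (∑ j, expIntegral (mulCoord j ψ) ν k • coordC j) k := by
  have := h.finite
  obtain ⟨C, hC⟩ := exists_bound_expDeriv h.compact hψ k
  rw [← (h.integral_expDeriv hψ k).2]
  exact hasFDerivAt_integral_of_dominated_of_fderiv_le (𝕜 := ℂ) (s := Metric.ball k 1)
    (F := fun k β => ψ β * exp (I * pairL β k)) (F' := expDeriv ψ) (bound := fun _ => C)
    (Metric.ball_mem_nhds k one_pos)
    (Eventually.of_forall fun k' => (h.integrable_mul_exp hψ k').1)
    (h.integrable_mul_exp hψ k) (h.integral_expDeriv hψ k).1.1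
    (h.ae_mem.mono fun β hβ k' hk' => hC k' hk' β hβ) (integrable_const _)
    (Eventually.of_forall fun β k' _ => hasFDerivAt_mul_exp ψ k' β)

/-- The averages of the integrals against the complex exponential. -/
def avgExp (ρ : Spacetime → Measure Spacetime) (g ψ : Spacetime → ℂ)
    (q : (Fin 4 → ℂ) × Spacetime) : ℂ :=
  ∫ z, g (z - q.2) * expIntegral ψ (ρ z) q.1

/-- The coordinates of momentum and position. -/
def coordCLM : Fin 4 ⊕ Fin 4 → (Fin 4 → ℂ) × Spacetime →L[ℝ] ℂ
  | .inl j => (coordC j).restrictScalars ℝ ∘L ContinuousLinearMap.fst ℝ _ _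
  | .inr μ => -(Complex.ofRealCLM ∘L (EuclideanSpace.proj μ : Spacetime →L[ℝ] ℝ) ∘L
      ContinuousLinearMap.snd ℝ _ _)

/-- The weights that occur in the derivative of an average. -/
def derivWeight (g : Spacetime → ℂ) : Fin 4 ⊕ Fin 4 → Spacetime → ℂ
  | .inl _ => g
  | .inr μ => dirDeriv (basisVec μ) g

/-- The functions that occur in the derivative of an average. -/
def derivFn (ψ : Spacetime → ℂ) : Fin 4 ⊕ Fin 4 → Spacetime → ℂ
  | .inl j => mulCoord j ψ
  | .inr _ => ψ

theorem IsWeight.derivWeight {g : Spacetime → ℂ} {K T : Set Spacetime} (hg : IsWeight g K T) :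
    ∀ i, IsWeight (derivWeight g i) K T
  | .inl _ => hg
  | .inr μ => hg.dirDeriv (basisVec μ)

theorem continuousOn_derivFn {ψ : Spacetime → ℂ} {B : Set Spacetime} (hψ : ContinuousOn ψ B) :
    ∀ i, ContinuousOn (derivFn ψ i) B
  | .inl j => continuousOn_mulCoord hψ j
  | .inr _ => hψ

theorem sum_coord_basisVec (v : Spacetime) : v = ∑ μ, v μ • basisVec μ := by
  ext i
  simp [basisVec, Finset.sum_apply, Pi.single_apply]

theorem IsWeight.exists_bound {g : Spacetime → ℂ} {K T : Set Spacetime} (hg : IsWeight g K T)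
    (hK : IsCompact K) {x : Spacetime} (hx : x ∈ T) : ∃ C, ∀ y, ‖g y‖ ≤ C := by
  have : HasCompactSupport g := by
    refine HasCompactSupport.intro (hK.image (by fun_prop : Continuous fun z => z - x)) fun y hy => ?_
    have := hg.eq_zero hx (z := x + y) fun h => hy ⟨x + y, h, by simp⟩
    simpa using this
  exact this.exists_bound_of_continuous hg.smooth.continuous

/-- The derivative of the integrand of an average. -/
def avgDeriv (ρ : Spacetime → Measure Spacetime) (g ψ : Spacetime → ℂ)
    (q : (Fin 4 → ℂ) × Spacetime) (z : Spacetime) : (Fin 4 → ℂ) × Spacetime →L[ℝ] ℂ :=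
  ∑ i, (derivWeight g i (z - q.2) * expIntegral (derivFn ψ i) (ρ z) q.1) • coordCLM i

theorem fderiv_eq_sum (g : Spacetime → ℂ) (y v : Spacetime) :
    fderiv ℝ g y v = ∑ μ, (v μ : ℂ) * dirDeriv (basisVec μ) g y := by
  conv_lhs => rw [sum_coord_basisVec v, map_sum]
  simp only [map_smul, Complex.real_smul]
  rfl

theorem avgDeriv_apply (ρ : Spacetime → Measure Spacetime) (g ψ : Spacetime → ℂ)
    (q : (Fin 4 → ℂ) × Spacetime) (z : Spacetime) (v : (Fin 4 → ℂ) × Spacetime) :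
    avgDeriv ρ g ψ q z v =
      g (z - q.2) * (∑ j, expIntegral (mulCoord j ψ) (ρ z) q.1 • coordC j) v.1 +
        expIntegral ψ (ρ z) q.1 * -(fderiv ℝ g (z - q.2) v.2) := by
  have h1 : ∀ j, coordCLM (.inl j) v = v.1 j := fun j => rfl
  have h2 : ∀ μ, coordCLM (.inr μ) v = -(v.2 μ : ℂ) := fun μ => rfl
  simp only [avgDeriv, Fintype.sum_sum_type, derivWeight, derivFn, fderiv_eq_sum, _root_.add_apply,
    _root_.sum_apply, _root_.smul_apply, smul_eq_mul, h1, h2, coordC_apply,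
    Finset.mul_sum, ← Finset.sum_neg_distrib]
  congr 1 <;> exact Finset.sum_congr rfl fun j _ => by ring

namespace ThermalFamily

variable {ρ : Spacetime → Measure Spacetime} {K B T : Set Spacetime} {g ψ : Spacetime → ℂ}

theorem integrable_avgExp (h : ThermalFamily ρ K B) (hg : IsWeight g K T)
    (hψ : ContinuousOn ψ B) {q : (Fin 4 → ℂ) × Spacetime} (hq : q.2 ∈ T) :
    Integrable fun z => g (z - q.2) * expIntegral ψ (ρ z) q.1 := by
  have hz : ∀ z, z ∉ K → g (z - q.2) = 0 := fun z hz => hg.eq_zero hq hz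
  have hc := hg.smooth.continuous
  exact h.integrable_mul (by fun_prop) (HasCompactSupport.intro h.compact hz)
    (closure_minimal (fun z hz' => by by_contra hzK; exact hz' (hz z hzK)) h.compact.isClosed)
    ((continuousOn_mul_exp hψ).comp (f := fun β => (q.1, β)) (by fun_prop)
      fun β hβ => ⟨trivial, hβ⟩)

theorem integral_avgDeriv (h : ThermalFamily ρ K B) (hg : IsWeight g K T)
    (hψ : ContinuousOn ψ B) {q : (Fin 4 → ℂ) × Spacetime} (hq : q.2 ∈ T) :
    Integrable (avgDeriv ρ g ψ q) ∧ ∫ z, avgDeriv ρ g ψ q z =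
      ∑ i, avgExp ρ (derivWeight g i) (derivFn ψ i) q • coordCLM i :=
  integral_sum_smul coordCLM fun i =>
    h.integrable_avgExp (hg.derivWeight i) (continuousOn_derivFn hψ i) hq

theorem avgDeriv_eq_zero (hg : IsWeight g K T) {q : (Fin 4 → ℂ) × Spacetime} (hq : q.2 ∈ T)
    {z : Spacetime} (hz : z ∉ K) : avgDeriv ρ g ψ q z = 0 :=
  Finset.sum_eq_zero fun i _ => by rw [(hg.derivWeight i).eq_zero hq hz, zero_mul]; exact zero_smul ℂ (coordCLM i)

theorem exists_bound_avgDeriv (h : ThermalFamily ρ K B) (hg : IsWeight g K T)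
    (hψ : ContinuousOn ψ B) {q : (Fin 4 → ℂ) × Spacetime} (hq : q.2 ∈ T) :
    ∃ C, ∀ z, ∀ q' ∈ Metric.ball q.1 1 ×ˢ T,
      ‖avgDeriv ρ g ψ q' z‖ ≤ K.indicator (fun _ => C) z := by
  choose D hD using fun i => (hg.derivWeight i).exists_bound h.compact hq
  choose C hC using fun i => exists_bound_mul_exp h.compactB (continuousOn_derivFn hψ i) q.1
  have hDnn : ∀ i, 0 ≤ D i := fun i => (norm_nonneg _).trans (hD i 0)
  refine ⟨∑ i, D i * C i * ‖coordCLM i‖, fun z q' hq' => ?_⟩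
  by_cases hz : z ∈ K
  · rw [indicator_of_mem hz]
    refine (norm_sum_le _ _).trans (Finset.sum_le_sum fun i _ => ?_)
    rw [norm_smul, norm_mul]
    have h1 := h.norm_integral_le (ψ := fun β => derivFn ψ i β * exp (I * pairL β q'.1))
      (hC i q'.1 (Metric.ball_subset_closedBall hq'.1)) hz
    exact mul_le_mul_of_nonneg_right (mul_le_mul (hD i _) h1 (norm_nonneg _) (hDnn i))
      (norm_nonneg _)
  · rw [indicator_of_notMem hz, avgDeriv_eq_zero hg hq'.2 hz, norm_zero]

theorem hasFDerivAt_avgExp_integrand (h : ThermalFamily ρ K B) (hT : IsOpen T)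
    (hg : IsWeight g K T) (hψ : ContinuousOn ψ B) {q : (Fin 4 → ℂ) × Spacetime} (hq : q.2 ∈ T)
    (z : Spacetime) :
    HasFDerivAt (fun q : (Fin 4 → ℂ) × Spacetime => g (z - q.2) * expIntegral ψ (ρ z) q.1)
      (avgDeriv ρ g ψ q z) q := by
  by_cases hz : z ∈ K
  · have h1 : HasFDerivAt (fun q : (Fin 4 → ℂ) × Spacetime => g (z - q.2))
        (-(fderiv ℝ g (z - q.2) ∘L ContinuousLinearMap.snd ℝ (Fin 4 → ℂ) Spacetime)) q := by
      have ha := (hg.smooth.differentiable (by simp) (z - q.2)).hasFDerivAt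
      have hb := ha.comp q ((hasFDerivAt_snd (𝕜 := ℝ) (p := q)).const_sub z)
      rw [← ContinuousLinearMap.comp_neg]
      exact hb
    have h2 := (((h.supp z hz).hasFDerivAt_expIntegral hψ q.1).restrictScalars ℝ).comp q
      (hasFDerivAt_fst (𝕜 := ℝ) (p := q))
    refine (h1.mul h2).congr_fderiv (ContinuousLinearMap.ext fun v => ?_)
    exact (avgDeriv_apply ρ g ψ q z v).symm
  · rw [avgDeriv_eq_zero hg hq hz]
    refine (hasFDerivAt_const (0 : ℂ) q).congr_of_eventuallyEq ?_
    filter_upwards [(hT.preimage continuous_snd).mem_nhds hq] with q' hq'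
    rw [hg.eq_zero hq' hz, zero_mul]

/-- Momentum derivatives multiply `ψ` by coordinates and position derivatives act on the weight. The
derivative is a finite sum of averages of the same form. -/
theorem hasFDerivAt_avgExp (h : ThermalFamily ρ K B) (hT : IsOpen T) (hg : IsWeight g K T)
    (hψ : ContinuousOn ψ B) {q : (Fin 4 → ℂ) × Spacetime} (hq : q.2 ∈ T) :
    HasFDerivAt (avgExp ρ g ψ)
      (∑ i, avgExp ρ (derivWeight g i) (derivFn ψ i) q • coordCLM i) q := by
  have hnear : Metric.ball q.1 1 ×ˢ T ∈ 𝓝 q :=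
    (Metric.isOpen_ball.prod hT).mem_nhds ⟨Metric.mem_ball_self one_pos, hq⟩
  obtain ⟨C, hC⟩ := h.exists_bound_avgDeriv hg hψ hq
  have h1 := h.integral_avgDeriv hg hψ hq
  rw [← h1.2]
  exact hasFDerivAt_integral_of_dominated_of_fderiv_le (𝕜 := ℝ) (s := Metric.ball q.1 1 ×ˢ T)
    (F := fun (q : (Fin 4 → ℂ) × Spacetime) z => g (z - q.2) * expIntegral ψ (ρ z) q.1)
    (F' := avgDeriv ρ g ψ) (bound := K.indicator fun _ => C) hnear
    (by filter_upwards [hnear] with q' hq' using (h.integrable_avgExp hg hψ hq'.2).1)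
    (h.integrable_avgExp hg hψ hq) h1.1.1 (Eventually.of_forall hC)
    ((integrable_indicator_iff h.compact.measurableSet).2
      (integrableOn_const h.compact.measure_lt_top.ne))
    (Eventually.of_forall fun z q' hq' => h.hasFDerivAt_avgExp_integrand hT hg hψ hq'.2 z)

/-- Induction on the order for all weights and all continuous `ψ` simultaneously, as the derivative
leads to new ones. -/
theorem contDiffOn_avgExp (h : ThermalFamily ρ K B) (hT : IsOpen T) (n : ℕ) :
    ∀ {g ψ : Spacetime → ℂ}, IsWeight g K T → ContinuousOn ψ B →
      ContDiffOn ℝ n (avgExp ρ g ψ) (univ ×ˢ T) := by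
  have hopen : IsOpen ((univ : Set (Fin 4 → ℂ)) ×ˢ T) := isOpen_univ.prod hT
  induction n with
  | zero =>
    intro g ψ hg hψ
    exact contDiffOn_zero.2 fun q hq =>
      (h.hasFDerivAt_avgExp hT hg hψ hq.2).continuousAt.continuousWithinAt
  | succ n ih =>
    intro g ψ hg hψ
    have hd := fun q (hq : q ∈ (univ : Set (Fin 4 → ℂ)) ×ˢ T) =>
      h.hasFDerivAt_avgExp hT hg hψ hq.2
    push_cast
    rw [contDiffOn_succ_iff_fderiv_of_isOpen hopen]
    refine ⟨fun q hq => (hd q hq).differentiableAt.differentiableWithinAt, by simp, ?_⟩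
    refine ContDiffOn.congr (f := fun q => ∑ i, avgExp ρ (derivWeight g i) (derivFn ψ i) q •
      coordCLM i) ?_ fun q hq => (hd q hq).fderiv
    exact ContDiffOn.sum fun i _ =>
      (ih (hg.derivWeight i) (continuousOn_derivFn hψ i)).smul contDiffOn_const

end ThermalFamily

/-! ### The lifts -/

theorem thermE_eq_cos_sin (p β : Spacetime) :
    thermE p β = (Real.cos (mink β p) : ℂ) + (Real.sin (mink β p) : ℂ) * I := by
  rw [thermE, mul_comm, Complex.exp_mul_I, Complex.ofReal_cos, Complex.ofReal_sin]

theorem continuous_thermM (p : Spacetime) (n : ℕ) : Continuous (thermM p n) := by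
  unfold thermM
  fun_prop

theorem norm_thermE (p β : Spacetime) : ‖thermE p β‖ = 1 := by
  rw [thermE, mul_comm, Complex.norm_exp_ofReal_mul_I]

theorem integral_thermE {ν : Measure Spacetime} {B : Set Spacetime} (h : SupportedIn ν B)
    (p : Spacetime) : ∫ β, thermE p β ∂ν =
      ((∫ β, Real.cos (mink β p) ∂ν : ℝ) : ℂ) + ((∫ β, Real.sin (mink β p) ∂ν : ℝ) : ℂ) * I := by
  have hc := Complex.continuous_ofReal
  rw [← integral_complex_ofReal, ← integral_complex_ofReal, ← integral_mul_const, ← integral_add]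
  · simp only [thermE_eq_cos_sin]
  · exact h.integrable (by fun_prop : Continuous fun β : Spacetime =>
      (Real.cos (mink β p) : ℂ)).continuousOn
  · exact h.integrable (by fun_prop : Continuous fun β : Spacetime =>
      (Real.sin (mink β p) : ℂ) * I).continuousOn

/-- The lift refers to an unspecified reference state; independence of the choice allows evaluation
in a known one. -/
theorem lift_eq {E : Type*} [NormedAddCommGroup E] [NormedSpace ℝ E] {ω : State} {x : Spacetime}
    {σ : Measure Spacetime} (h : IsThermalAt ω x σ) {Ξ : Spacetime → E}
    (hΞ : ∀ ρ, IsThermalAt ω x ρ → ∫ β, Ξ β ∂ρ = ∫ β, Ξ β ∂σ) : lift ω Ξ x = ∫ β, Ξ β ∂σ := by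
  have hex : ∃ ρ, IsThermalAt ω x ρ := ⟨σ, h⟩
  rw [lift, dif_pos hex]
  exact hΞ _ hex.choose_spec

theorem IsThermalAt.lift_thermM {ω : State} {x : Spacetime} {σ : Measure Spacetime}
    (h : IsThermalAt ω x σ) {p : Spacetime} (hp : IsPositiveLightlike p) (n : ℕ) :
    lift ω (thermM p n) x = ∫ β, thermM p n β ∂σ := by
  obtain ⟨q, hq, rfl⟩ := hp.exists_shell
  exact lift_eq h fun ρ hρ => hρ.integral_eq h (φ := fun s => s ^ n) (by fun_prop) hq

theorem IsThermalAt.lift_thermE {ω : State} {x : Spacetime} {σ : Measure Spacetime}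
    (h : IsThermalAt ω x σ) {p : Spacetime} (hp : IsPositiveLightlike p) :
    lift ω (thermE p) x = ∫ β, thermE p β ∂σ := by
  obtain ⟨q, hq, rfl⟩ := hp.exists_shell
  refine lift_eq h fun ρ hρ => ?_
  obtain ⟨B, hB⟩ := hρ.supportedIn
  obtain ⟨B', hB'⟩ := h.supportedIn
  rw [integral_thermE hB, integral_thermE hB',
    hρ.integral_eq h (φ := Real.cos) Real.continuous_cos.continuousOn hq,
    hρ.integral_eq h (φ := Real.sin) Real.continuous_sin.continuousOn hq]

theorem IsThermalAt.norm_lift_thermE_le {ω : State} {x : Spacetime} {σ : Measure Spacetime}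
    (h : IsThermalAt ω x σ) {p : Spacetime} (hp : IsPositiveLightlike p) :
    ‖lift ω (thermE p) x‖ ≤ 1 := by
  have := h.1
  rw [h.lift_thermE hp]
  have := norm_integral_le_of_norm_le_const (μ := σ) (f := thermE p) (C := 1)
    (Eventually.of_forall fun β => (norm_thermE p β).le)
  simpa using this

/-- The exponents match because `n² + 2n + 1 = (n + 1)²`. -/
theorem rpow_holder_exponents {s : ℝ} (hs : 0 < s) (n : ℕ) :
    s ^ (n + 1) = (s ^ n) ^ ((n : ℝ) / (n + 1)) * (s ^ (2 * n + 1)) ^ (1 / ((n : ℝ) + 1)) := by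
  have hn : (n : ℝ) + 1 ≠ 0 := by positivity
  rw [← Real.rpow_natCast, ← Real.rpow_natCast, ← Real.rpow_natCast, ← Real.rpow_mul hs.le,
    ← Real.rpow_mul hs.le, ← Real.rpow_add hs]
  congr 1
  push_cast
  field_simp
  ring

/-- The interpolation inequality for the moments of `β p`. -/
theorem SupportedIn.moment_inequality {σ : Measure Spacetime} {B : Set Spacetime}
    (h : SupportedIn σ B) [IsProbabilityMeasure σ] {p : Spacetime} (hp : IsPositiveLightlike p)
    (n : ℕ) :
    0 ≤ ∫ β, thermM p (n + 1) β ∂σ ∧ ∫ β, thermM p (n + 1) β ∂σ ≤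
      (∫ β, thermM p n β ∂σ) ^ ((n : ℝ) / ((n : ℝ) + 1)) *
        (∫ β, thermM p (2 * n + 1) β ∂σ) ^ (1 / ((n : ℝ) + 1)) := by
  have hpos : ∀ᵐ β ∂σ, 0 < mink β p := by
    obtain ⟨q, hq, rfl⟩ := hp.exists_shell
    filter_upwards [h.ae_mem] with β hβ using mink_shell_pos (h.subset hβ) hq
  have hnn : ∀ m, ∀ᵐ β ∂σ, 0 ≤ thermM p m β := fun m => by
    filter_upwards [hpos] with β hβ using pow_nonneg hβ.le m
  refine ⟨integral_nonneg_of_ae (hnn _), ?_⟩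
  -- For `n = 0` the exponent `(n + 1)/n` is not available for Hölder's inequality; there the claim
  -- is an equality, as the first factor has exponent zero.
  rcases Nat.eq_zero_or_pos n with rfl | hn
  · simp
  have hn' : (0 : ℝ) < n := by exact_mod_cast hn
  have hconj : (((n : ℝ) + 1) / n).HolderConjugate ((n : ℝ) + 1) := by
    rw [Real.holderConjugate_iff]
    constructor
    · rw [lt_div_iff₀ hn']; linarith
    · field_simp
  have hrc : ∀ (m : ℕ) (e : ℝ), 0 ≤ e → ContinuousOn (fun β => thermM p m β ^ e) forwardCone :=
    fun m e he => ((continuous_thermM p m).rpow_const fun _ => Or.inr he).continuousOn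
  have hmem : ∀ (m : ℕ) (e r : ℝ), 0 ≤ e → MemLp (fun β => thermM p m β ^ e)
      (ENNReal.ofReal r) σ := fun m e r he => by
    obtain ⟨C, hC⟩ := h.compact.exists_bound_of_continuousOn ((hrc m e he).mono h.subset)
    exact MemLp.of_bound (h.integrable (hrc m e he)).1 C (h.ae_mem.mono hC)
  have he1 : 0 ≤ (n : ℝ) / ((n : ℝ) + 1) := by positivity
  have he2 : 0 ≤ 1 / ((n : ℝ) + 1) := by positivity
  have key := integral_mul_le_Lp_mul_Lq_of_nonneg (μ := σ) hconj
    (f := fun β => thermM p n β ^ ((n : ℝ) / ((n : ℝ) + 1)))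
    (g := fun β => thermM p (2 * n + 1) β ^ (1 / ((n : ℝ) + 1)))
    ((hnn n).mono fun β hβ => Real.rpow_nonneg hβ _)
    ((hnn (2 * n + 1)).mono fun β hβ => Real.rpow_nonneg hβ _)
    (hmem n _ _ he1) (hmem (2 * n + 1) _ _ he2)
  have h0 : ∫ β, thermM p (n + 1) β ∂σ = ∫ β, thermM p n β ^ ((n : ℝ) / ((n : ℝ) + 1)) *
      thermM p (2 * n + 1) β ^ (1 / ((n : ℝ) + 1)) ∂σ :=
    integral_congr_ae (hpos.mono fun β hβ => rpow_holder_exponents hβ n)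
  have h1 : ∫ β, (thermM p n β ^ ((n : ℝ) / ((n : ℝ) + 1))) ^ (((n : ℝ) + 1) / n) ∂σ =
      ∫ β, thermM p n β ∂σ := by
    refine integral_congr_ae ((hnn n).mono fun β hβ => ?_)
    change (_ ^ _) ^ _ = _
    rw [← Real.rpow_mul hβ, show (n : ℝ) / ((n : ℝ) + 1) * (((n : ℝ) + 1) / n) = 1 by field_simp,
      Real.rpow_one]
  have h2 : ∫ β, (thermM p (2 * n + 1) β ^ (1 / ((n : ℝ) + 1))) ^ ((n : ℝ) + 1) ∂σ =
      ∫ β, thermM p (2 * n + 1) β ∂σ := by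
    refine integral_congr_ae ((hnn (2 * n + 1)).mono fun β hβ => ?_)
    change (_ ^ _) ^ _ = _
    rw [← Real.rpow_mul hβ, one_div_mul_cancel (by positivity), Real.rpow_one]
  rw [h1, h2, ← h0, one_div_div] at key
  exact key

/-! ### Averages of exponentials -/

theorem differentiable_expIntegral {ν : Measure Spacetime} {B : Set Spacetime}
    (h : SupportedIn ν B) {ψ : Spacetime → ℂ} (hψ : ContinuousOn ψ B) :
    Differentiable ℂ (expIntegral ψ ν) := fun k => (h.hasFDerivAt_expIntegral hψ k).differentiableAt

theorem expIntegral_real (p : Spacetime) (ν : Measure Spacetime) :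
    expIntegral (fun _ => 1) ν (fun i => (p i : ℂ)) = ∫ β, thermE p β ∂ν := by
  simp only [expIntegral, pairL_real, thermE, one_mul]

theorem IsAverage.avgExp_eq {ρ : Spacetime → Measure Spacetime} {f : Spacetime → ℝ}
    {σ : Measure Spacetime} {x : Spacetime} (h : IsAverage ρ (fun z => f (z - x)) σ)
    (k : Fin 4 → ℂ) :
    avgExp ρ (fun y => (f y : ℂ)) (fun _ => 1) (k, x) = expIntegral (fun _ => 1) σ k := by
  refine (h.2 (fun β => 1 * exp (I * pairL β k)) ?_).symm
  exact (continuous_const.mul (continuous_const.mul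
    (continuous_pairL.comp (by fun_prop : Continuous fun β : Spacetime => (k, β)))).cexp).continuousOn

/-- Averages with real weights of the expectation values of the exponential, by real and
imaginary part. -/
theorem ThermalFamily.avgExp_real {ρ : Spacetime → Measure Spacetime} {K B : Set Spacetime}
    (h : ThermalFamily ρ K B) {g : Spacetime → ℝ} (hg : Continuous g) {x : Spacetime}
    (hgK : ∀ z, z ∉ K → g (z - x) = 0) (p : Spacetime) :
    avgExp ρ (fun y => (g y : ℂ)) (fun _ => 1) (fun i => (p i : ℂ), x) =
      ((∫ z, g (z - x) * ∫ β, Real.cos (mink β p) ∂ρ z : ℝ) : ℂ) +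
        ((∫ z, g (z - x) * ∫ β, Real.sin (mink β p) ∂ρ z : ℝ) : ℂ) * I := by
  have hint : ∀ {φ : ℝ → ℝ}, Continuous φ →
      Integrable fun z => ((g (z - x) * ∫ β, φ (mink β p) ∂ρ z : ℝ) : ℂ) := fun {φ} hφ =>
    (h.integrable_mul_real (g := fun z => g (z - x)) (by fun_prop)
      (HasCompactSupport.intro h.compact hgK)
      (closure_minimal (fun z hz => by by_contra hzK; exact hz (hgK z hzK)) h.compact.isClosed)
      (by fun_prop : Continuous fun β : Spacetime => φ (mink β p)).continuousOn).ofReal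
  rw [← integral_complex_ofReal, ← integral_complex_ofReal, ← integral_mul_const, ← integral_add
    (hint Real.continuous_cos) ((hint Real.continuous_sin).mul_const I)]
  refine integral_congr_ae (Eventually.of_forall fun z => ?_)
  by_cases hz : z ∈ K
  · simp only [expIntegral_real, integral_thermE (h.supp z hz)]
    push_cast
    ring
  · simp [hgK z hz]

namespace ThermalFamily

variable {ρ : Spacetime → Measure Spacetime} {K B T : Set Spacetime} {g ψ : Spacetime → ℂ}

theorem hasFDerivAt_avgExp_position (h : ThermalFamily ρ K B) (hT : IsOpen T)
    (hg : IsWeight g K T) (hψ : ContinuousOn ψ B) (k : Fin 4 → ℂ) {x : Spacetime} (hx : x ∈ T) :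
    ∃ D : Spacetime →L[ℝ] ℂ, HasFDerivAt (fun x => avgExp ρ g ψ (k, x)) D x ∧
      ∀ v, D v = -∑ μ, (v μ : ℂ) * avgExp ρ (LocalEq.dirDeriv (basisVec μ) g) ψ (k, x) := by
  refine ⟨_, (h.hasFDerivAt_avgExp hT hg hψ (q := (k, x)) hx).comp x
    (hasFDerivAt_prodMk_right k x), fun v => ?_⟩
  have h1 : ∀ j, coordCLM (.inl j) (0, v) = 0 := fun j => rfl
  have h2 : ∀ μ, coordCLM (.inr μ) (0, v) = -(v μ : ℂ) := fun μ => rfl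
  simp only [ContinuousLinearMap.comp_apply, ContinuousLinearMap.inr_apply, _root_.sum_apply,
    Fintype.sum_sum_type, _root_.add_apply, _root_.smul_apply, h1, h2, mul_zero, Finset.sum_const_zero, zero_add,
    smul_eq_mul, derivWeight, derivFn, ← Finset.sum_neg_distrib]
  exact Finset.sum_congr rfl fun μ _ => by ring

theorem pd_avgExp (h : ThermalFamily ρ K B) (hT : IsOpen T) (hg : IsWeight g K T)
    (hψ : ContinuousOn ψ B) (k : Fin 4 → ℂ) {x : Spacetime} (hx : x ∈ T) (μ : Fin 4) :
    pd μ (fun x => avgExp ρ g ψ (k, x)) x =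
      -avgExp ρ (LocalEq.dirDeriv (basisVec μ) g) ψ (k, x) := by
  obtain ⟨D, hD, hDv⟩ := h.hasFDerivAt_avgExp_position hT hg hψ k hx
  rw [pd, hD.fderiv, hDv]
  simp [basisVec, apply_ite Complex.ofReal]

theorem pd_pd_avgExp (h : ThermalFamily ρ K B) (hT : IsOpen T) (hg : IsWeight g K T)
    (hψ : ContinuousOn ψ B) (k : Fin 4 → ℂ) {x : Spacetime} (hx : x ∈ T) (μ : Fin 4) :
    pd μ (pd μ fun x => avgExp ρ g ψ (k, x)) x =
      avgExp ρ (LocalEq.dirDeriv (basisVec μ) (LocalEq.dirDeriv (basisVec μ) g)) ψ (k, x) := by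
  have hev : (pd μ fun x => avgExp ρ g ψ (k, x)) =ᶠ[𝓝 x]
      fun x => -avgExp ρ (LocalEq.dirDeriv (basisVec μ) g) ψ (k, x) := by
    filter_upwards [hT.mem_nhds hx] with y hy using h.pd_avgExp hT hg hψ k hy μ
  rw [pd, hev.fderiv_eq, fderiv_fun_neg]
  have := h.pd_avgExp hT (hg.dirDeriv (basisVec μ)) hψ k hx μ
  rw [pd] at this
  rw [_root_.neg_apply, this, neg_neg]

end ThermalFamily

/-- The lift agrees with an average only on an open set; equality near a point suffices for a second
order operator. -/
theorem box_congr {u v : Spacetime → ℂ} {x : Spacetime} (h : u =ᶠ[𝓝 x] v) :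
    box u x = box v x := by
  have h1 : ∀ μ, pd μ u =ᶠ[𝓝 x] pd μ v := fun μ => by
    filter_upwards [h.fderiv (𝕜 := ℝ)] with y hy
    rw [pd, pd, hy]
  simp only [box]
  refine Finset.sum_congr rfl fun μ _ => ?_
  rw [pd, (h1 μ).fderiv_eq (𝕜 := ℝ), ← pd]

section equations

variable {ω ωf : State} {ρ : Spacetime → Measure Spacetime} {Oω : Set Spacetime}
  {f : Spacetime → ℝ} {x : Spacetime}

/-- The averages of functions of `β p`, for positive light-like `p`, are constant along `p`. -/
theorem transport_equation_momentum (hρ : ∀ x ∈ Oω, IsThermalAt ω x (ρ x)) (hOω : IsOpen Oω)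
    (hfam : ∀ K ⊆ Oω, IsCompact K → ∃ B, ThermalFamily ρ K B)
    (hf : IsMollifier f) (hreg : IsRegularization ω f ωf) (hx : ∀ y ∈ tsupport f, x + y ∈ Oω)
    {φ : ℝ → ℝ} (hφ : Continuous φ) {p : Spacetime} (hp : IsPositiveLightlike p) :
    ∑ ν, p ν * ∫ z, fderiv ℝ f (z - x) (basisVec ν) * ∫ β, φ (mink β p) ∂ρ z = 0 := by
  obtain ⟨q, hq, rfl⟩ := hp.exists_shell
  obtain ⟨n, hn⟩ := shell_eq_ray hq
  -- A positive light-like momentum is a positive multiple of a ray; the multiple is absorbed into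
  -- `φ`, and the equation is homogeneous in the momentum.
  have := transport_equation hρ hOω hfam hf hreg hx (φ := fun s => φ (‖q‖ * s)) (by fun_prop) n
  simp only [hn, mink_smul_right, PiLp.smul_apply, smul_eq_mul, mul_assoc, ← Finset.mul_sum, this,
    mul_zero]

/-- The averages of functions of `β p`, for positive light-like `p`, solve the wave equation. -/
theorem wave_equation_momentum (hρ : ∀ x ∈ Oω, IsThermalAt ω x (ρ x)) (hOω : IsOpen Oω)
    (hfam : ∀ K ⊆ Oω, IsCompact K → ∃ B, ThermalFamily ρ K B)
    (hf : IsMollifier f) (hreg : IsRegularization ω f ωf) (hx : ∀ y ∈ tsupport f, x + y ∈ Oω)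
    {φ : ℝ → ℝ} (hφ : Continuous φ) {p : Spacetime} (hp : IsPositiveLightlike p) :
    ∑ ν, eta ν * ∫ z, fderiv ℝ (fun y => fderiv ℝ f y (basisVec ν)) (z - x) (basisVec ν) *
      ∫ β, φ (mink β p) ∂ρ z = 0 := by
  obtain ⟨q, hq, rfl⟩ := hp.exists_shell
  obtain ⟨n, hn⟩ := shell_eq_ray hq
  have := wave_equation hρ hOω hfam hf hreg hx (φ := fun s => φ (‖q‖ * s)) (by fun_prop) n
  simpa only [hn, mink_smul_right] using this

theorem transport_equation_avgExp (hρ : ∀ x ∈ Oω, IsThermalAt ω x (ρ x)) (hOω : IsOpen Oω)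
    (hfam : ∀ K ⊆ Oω, IsCompact K → ∃ B, ThermalFamily ρ K B)
    (hf : IsMollifier f) (hreg : IsRegularization ω f ωf) (hx : ∀ y ∈ tsupport f, x + y ∈ Oω)
    {p : Spacetime} (hp : IsPositiveLightlike p) {K B T : Set Spacetime}
    (hB : ThermalFamily ρ K B) (hw : IsWeight (fun y => (f y : ℂ)) K T) (hxT : x ∈ T) :
    ∑ ν, (p ν : ℂ) * avgExp ρ (dirDeriv (basisVec ν) fun y => (f y : ℂ)) (fun _ => 1)
      (fun i => (p i : ℂ), x) = 0 := by
  have hd := hf.smooth.differentiable (by simp)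
  have hfd : Continuous (fderiv ℝ f) := hf.smooth.continuous_fderiv (by simp)
  have hgK : ∀ ν z, z ∉ K → fderiv ℝ f (z - x) (basisVec ν) = 0 := fun ν z hz => by
    have := (hw.dirDeriv (basisVec ν)).eq_zero hxT hz
    rw [dirDeriv_ofReal hd] at this
    exact Complex.ofReal_eq_zero.1 this
  have h1 := transport_equation_momentum hρ hOω hfam hf hreg hx Real.continuous_cos hp
  have h2 := transport_equation_momentum hρ hOω hfam hf hreg hx Real.continuous_sin hp
  simp only [dirDeriv_ofReal hd]
  simp only [hB.avgExp_real (g := fun y => fderiv ℝ f y (basisVec _)) (by fun_prop) (hgK _) p,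
    mul_add, ← mul_assoc, Finset.sum_add_distrib, ← Finset.sum_mul]
  simp only [← Complex.ofReal_mul, ← Complex.ofReal_sum, h1, h2, Complex.ofReal_zero, zero_mul,
    add_zero]

theorem wave_equation_avgExp (hρ : ∀ x ∈ Oω, IsThermalAt ω x (ρ x)) (hOω : IsOpen Oω)
    (hfam : ∀ K ⊆ Oω, IsCompact K → ∃ B, ThermalFamily ρ K B)
    (hf : IsMollifier f) (hreg : IsRegularization ω f ωf) (hx : ∀ y ∈ tsupport f, x + y ∈ Oω)
    {p : Spacetime} (hp : IsPositiveLightlike p) {K B T : Set Spacetime}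
    (hB : ThermalFamily ρ K B) (hw : IsWeight (fun y => (f y : ℂ)) K T) (hxT : x ∈ T) :
    ∑ ν, (eta ν : ℂ) * avgExp ρ (dirDeriv (basisVec ν) (dirDeriv (basisVec ν) fun y => (f y : ℂ)))
      (fun _ => 1) (fun i => (p i : ℂ), x) = 0 := by
  have hd := hf.smooth.differentiable (by simp)
  have hs2 : ∀ e, ContDiff ℝ (⊤ : ℕ∞) fun y => fderiv ℝ f y e := fun e =>
    (hf.smooth.fderiv_right (by exact_mod_cast le_top)).clm_apply contDiff_const
  have hd2 : ∀ e, Differentiable ℝ fun y => fderiv ℝ f y e := fun e =>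
    (hs2 e).differentiable (by simp)
  have hc2 : ∀ e, Continuous (fderiv ℝ fun y => fderiv ℝ f y e) := fun e =>
    (hs2 e).continuous_fderiv (by simp)
  have hgK : ∀ ν z, z ∉ K →
      fderiv ℝ (fun y => fderiv ℝ f y (basisVec ν)) (z - x) (basisVec ν) = 0 := fun ν z hz => by
    have := ((hw.dirDeriv (basisVec ν)).dirDeriv (basisVec ν)).eq_zero hxT hz
    rw [dirDeriv_ofReal hd, dirDeriv_ofReal (hd2 _)] at this
    exact Complex.ofReal_eq_zero.1 this
  have h1 := wave_equation_momentum hρ hOω hfam hf hreg hx Real.continuous_cos hp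
  have h2 := wave_equation_momentum hρ hOω hfam hf hreg hx Real.continuous_sin hp
  simp only [dirDeriv_ofReal hd, dirDeriv_ofReal (hd2 _)]
  simp only [hB.avgExp_real
      (g := fun y => fderiv ℝ (fun y => fderiv ℝ f y (basisVec _)) y (basisVec _))
      ((hc2 _).clm_apply continuous_const) (hgK _) p,
    mul_add, ← mul_assoc, Finset.sum_add_distrib, ← Finset.sum_mul]
  simp only [← Complex.ofReal_mul, ← Complex.ofReal_sum, h1, h2, Complex.ofReal_zero, zero_mul,
    add_zero]

/-- The averages of the exponentials of a locally thermal state are smooth. -/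
theorem contDiffOn_avgExp_regularized (hρ : ∀ x ∈ Oω, IsThermalAt ω x (ρ x)) (hOω : IsOpen Oω)
    (hfam : ∀ K ⊆ Oω, IsCompact K → ∃ B, ThermalFamily ρ K B) (hf : IsMollifier f)
    {O : Set Spacetime} (hsub : ∀ x ∈ O, ∀ y ∈ tsupport f, x + y ∈ Oω) :
    ContDiffOn ℝ (⊤ : ℕ∞) (avgExp ρ (fun y => (f y : ℂ)) fun _ => 1) (univ ×ˢ O) := by
  rintro ⟨k, x⟩ ⟨-, hx⟩
  obtain ⟨K, δ, r, hδ, hr, hK, hKO, hw, hh, hker⟩ := exists_kernelFamily hρ hOω hf (hsub x hx)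
  obtain ⟨B, hB⟩ := hfam K hKO hK
  have h := contDiffOn_infty.2 fun n =>
    hB.contDiffOn_avgExp (ψ := fun _ => 1) Metric.isOpen_ball n hh continuousOn_const
  exact (h.contDiffAt ((isOpen_univ.prod Metric.isOpen_ball).mem_nhds
    ⟨trivial, Metric.mem_ball_self hδ⟩)).contDiffWithinAt

/-- The equations of motion of the averages of the exponentials. -/
theorem equations_avgExp (hρ : ∀ x ∈ Oω, IsThermalAt ω x (ρ x)) (hOω : IsOpen Oω)
    (hfam : ∀ K ⊆ Oω, IsCompact K → ∃ B, ThermalFamily ρ K B)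
    (hf : IsMollifier f) (hreg : IsRegularization ω f ωf) (hx : ∀ y ∈ tsupport f, x + y ∈ Oω)
    {p : Spacetime} (hp : IsPositiveLightlike p) :
    fderiv ℝ (fun x => avgExp ρ (fun y => (f y : ℂ)) (fun _ => 1) (fun i => (p i : ℂ), x)) x p = 0 ∧
    box (fun x => avgExp ρ (fun y => (f y : ℂ)) (fun _ => 1) (fun i => (p i : ℂ), x)) x = 0 := by
  obtain ⟨K, δ, r, hδ, hr, hK, hKO, hw, hh, hker⟩ := exists_kernelFamily hρ hOω hf hx
  obtain ⟨B, hB⟩ := hfam K hKO hK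
  have hxT : x ∈ Metric.ball x δ := Metric.mem_ball_self hδ
  constructor
  · obtain ⟨D, hD, hDv⟩ := hB.hasFDerivAt_avgExp_position (ψ := fun _ => 1) Metric.isOpen_ball hh
      continuousOn_const (fun i => (p i : ℂ)) hxT
    rw [hD.fderiv, hDv, transport_equation_avgExp hρ hOω hfam hf hreg hx hp hB hh hxT, neg_zero]
  · rw [box, ← wave_equation_avgExp hρ hOω hfam hf hreg hx hp hB hh hxT]
    refine Finset.sum_congr rfl fun ν _ => ?_
    rw [hB.pd_pd_avgExp Metric.isOpen_ball hh continuousOn_const _ hxT]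

end equations

end LocalEq

end

/-! ### The theorem on regularized states -/

theorem mainTheorem5 (ω ωf : LocalEq.State) (Oω O : Set LocalEq.Spacetime)
    (hOω : IsOpen Oω) (hω : LocalEq.IsThermalOn ω Oω)
    (f : LocalEq.Spacetime → ℝ) (hf : LocalEq.IsMollifier f)
    (hreg : LocalEq.IsRegularization ω f ωf)
    (hO : IsOpen O) (hsub : ∀ x ∈ O, ∀ y ∈ tsupport f, x + y ∈ Oω) :
    LocalEq.IsThermalOn ωf O ∧
    (∀ p, LocalEq.IsPositiveLightlike p →
      ContDiffOn ℝ (⊤ : ℕ∞) (LocalEq.lift ωf (LocalEq.thermE p)) O ∧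
      ∀ x ∈ O,
        fderiv ℝ (LocalEq.lift ωf (LocalEq.thermE p)) x p = 0 ∧
        LocalEq.box (LocalEq.lift ωf (LocalEq.thermE p)) x = 0) ∧
    (∀ p, LocalEq.IsPositiveLightlike p → ∀ x ∈ O,
      ‖LocalEq.lift ωf (LocalEq.thermE p) x‖ ≤ 1) ∧
    (∃ F : (Fin 4 → ℂ) → LocalEq.Spacetime → ℂ,
      (∀ x ∈ O, Differentiable ℂ (fun k => F k x)) ∧
      ContDiffOn ℝ (⊤ : ℕ∞) (fun q : (Fin 4 → ℂ) × LocalEq.Spacetime => F q.1 q.2) (Set.univ ×ˢ O) ∧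
      ∀ p, LocalEq.IsPositiveLightlike p → ∀ x ∈ O,
        F (fun i => (p i : ℂ)) x = LocalEq.lift ωf (LocalEq.thermE p) x) ∧
    (∀ p, LocalEq.IsPositiveLightlike p → ∀ x ∈ O, ∀ n : ℕ,
      0 ≤ LocalEq.lift ωf (LocalEq.thermM p (n + 1)) x ∧
      LocalEq.lift ωf (LocalEq.thermM p (n + 1)) x ≤
        LocalEq.lift ωf (LocalEq.thermM p n) x ^ ((n : ℝ) / ((n : ℝ) + 1)) *
          LocalEq.lift ωf (LocalEq.thermM p (2 * n + 1)) x ^ (1 / ((n : ℝ) + 1))) := by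
  obtain ⟨ρ, hρ, hint, hsupp⟩ := hω
  have hfam : ∀ K ⊆ Oω, IsCompact K → ∃ B, LocalEq.ThermalFamily ρ K B := fun K hKO hK =>
    LocalEq.IsThermalOn.exists_thermalFamily hρ hint hsupp hK hKO
  obtain ⟨σ, hav, hth, hσint, hσsupp⟩ :=
    LocalEq.isThermalOn_regularized hρ hOω hfam hf hreg hO hsub
  have hsm := LocalEq.contDiffOn_avgExp_regularized hρ hOω hfam hf hsub
  -- On real light-like momenta the lift is the average of the exponentials, a formula that makes
  -- sense for all complex momenta. Smoothness, the equations and the entire extension are read off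
  -- from it.
  have hlift : ∀ p, LocalEq.IsPositiveLightlike p → ∀ x ∈ O,
      LocalEq.avgExp ρ (fun y => (f y : ℂ)) (fun _ => 1) (fun i => (p i : ℂ), x) =
        LocalEq.lift ωf (LocalEq.thermE p) x := fun p hp x hx => by
    rw [(hav x hx).avgExp_eq, LocalEq.expIntegral_real, (hth x hx).lift_thermE hp]
  refine ⟨⟨σ, hth, hσint, hσsupp⟩, fun p hp => ⟨?_, fun x hx => ?_⟩,
    fun p hp x hx => (hth x hx).norm_lift_thermE_le hp,
    ⟨fun k x => LocalEq.avgExp ρ (fun y => (f y : ℂ)) (fun _ => 1) (k, x), fun x hx => ?_, hsm,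
      hlift⟩, fun p hp x hx n => ?_⟩
  · exact (hsm.comp (f := fun x => ((fun i => (p i : ℂ) : Fin 4 → ℂ), x))
      (contDiff_const.prodMk contDiff_id).contDiffOn fun x hx => ⟨trivial, hx⟩).congr
        fun x hx => (hlift p hp x hx).symm
  · have hev : LocalEq.lift ωf (LocalEq.thermE p) =ᶠ[nhds x] fun x =>
        LocalEq.avgExp ρ (fun y => (f y : ℂ)) (fun _ => 1) (fun i => (p i : ℂ), x) := by
      filter_upwards [hO.mem_nhds hx] with y hy using (hlift p hp y hy).symm
    rw [hev.fderiv_eq, LocalEq.box_congr hev]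
    exact LocalEq.equations_avgExp hρ hOω hfam hf hreg (hsub x hx) hp
  · obtain ⟨B, hB⟩ := (hth x hx).supportedIn
    -- For fixed `x` the extension is the Fourier-Laplace transform of the compactly supported
    -- measure `σ x`.
    simp only [(hav x hx).avgExp_eq]
    exact LocalEq.differentiable_expIntegral hB continuousOn_const
  · have := (hth x hx).1
    obtain ⟨B, hB⟩ := (hth x hx).supportedIn
    simp only [(hth x hx).lift_thermM hp]
    exact hB.moment_inequality hp n
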